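/- Write $[a,b]=a^{-1}b^{-1}ab$, let $\gamma_1(G)=G$, $\gamma_{j+1}(G)=[\gamma_j(G),G]$ be the lower central series, and let $\mathrm{SmallGroup}(243,8)$ be the group of order $243$ with generators $x,y,t_2,s_3,t_3$ and relations $t_2=[y,x]$, $s_3=[t_2,x]$, $t_3=[t_2,y]$, $x^3=t_3$, $y^3=s_3$, $t_2^3=s_3^3=t_3^3=1$, with $s_3,t_3$ central. For an integer $c\ge 5$ and $e\in\{0,1\}$, $b\in\{0,1,2\}$ let $G=G(c;e,b)$ be the group given by the pc-presentation $$\begin{aligned}\langle\,x,y,t_2,s_3,t_3,\ldots,t_c\mid{}& t_2=[y,x],\ s_3=[t_2,x],\ t_j=[t_{j-1},y]\ (3\le j\le c),\\ & t_j^3=t_{j+2}^2t_{j+3}\ (2\le j\le c-3),\ t_{c-2}^3=t_c^2,\ s_3^3=1,\\ & y^3=s_3t_c^{e},\quad x^3=t_3t_4^{2}t_5t_c^{b}\,\rangle,\end{aligned}$$ where, as usual, the trivial power and commutator relations are understood: $t_{c-1}^3=t_c^3=1$, $[t_c,y]=1$, $[t_j,x]=1$ for $3\le j\le c$, $[s_3,x]=[s_3,y]=1$,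 and $s_3,t_2,\ldots,t_c$ commute with each other. A transfer kernel type (TKT) of a group $G$ with exactly four maximal subgroups is a tuple $\varkappa=(\varkappa_1,\ldots,\varkappa_4)\in\{0,\ldots,4\}^4$ such that, for a suitable numbering $H_1,\ldots,H_4$ of the maximal subgroups, the kernel of the Artin transfer $G\to H_i/H_i'$ is $G$ if $\varkappa_i=0$ and is $H_j$ if $\varkappa_i=j\ge 1$. The types are c.21: $(0,2,3,1)$, E.8: $(1,2,3,1)$, E.9: $(2,2,3,1)$, G.16: $(4,2,3,1)$. Call an automorphism $\sigma$ of order $2$ of a finite $3$-group $G$ *generator-inverting* if it acts as inversion on $H^1(G,\mathbb F_3)$ (equivalently on $G$ modulo its Frattini subgroup), and *generator- and relator-inverting* if it acts as inversion on both $H^1(G,\mathbb F_3)$ and $H^2(G,\mathbb F_3)$. Let $c\ge 5$. Then: 1. Each of the six groups $G(c;e,b)$ has order $3^{c+2}$, nilpotency class $c$ and coclass $2$, is metabelian (of soluble length exactly two), is generated by $x$ and $y$, has $s_3,t_2,\ldots,t_c\in G'$, and is a descendant of $\mathrm{SmallGroup}(243,8)$ (with respect to the lower exponent-$3$ central series,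 and also $G/\gamma_4(G)\cong\mathrm{SmallGroup}(243,8)$). 2. The TKT is c.21 for $(e,b)=(0,0)$, G.16 for $(0,1)$ and $(0,2)$, E.8 for $(1,0)$, and E.9 for $(1,1)$ and $(1,2)$. The groups $G(c;0,0)$ form the mainline: $G(c+1;0,0)/\gamma_{c+1}(G(c+1;0,0))\cong G(c;0,0)$. 3. If $c$ is odd, then the six groups are pairwise non-isomorphic, each of them has a generator-inverting automorphism of order $2$, and each of those of types E.8 and E.9 has a generator- and relator-inverting automorphism of order $2$. 4. If $c$ is even, then $G(c;e,1)\cong G(c;e,2)$ for $e=0$ (type G.16) and for $e=1$ (type E.9), and the four groups $G(c;e,b)$ with $e,b\in\{0,1\}$ are pairwise non-isomorphic. The mainline group $G(c;0,0)$ has a generator- and relator-inverting automorphism of order $2$, whereas the other groups do not even have a generator-inverting automorphism of order $2$. -/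

import Mathlib

/-- The commutator `[a, b] = a⁻¹ b⁻¹ a b` (the convention of power-commutator presentations). -/
def pcComm {G : Type*} [Group G] (a b : G) : G := a⁻¹ * b⁻¹ * a * b

/-- The pc-generators `x, y, s₃, t₂, t₃, …, t_c`. -/
inductive UGen (c : ℕ) : Type
  | x : UGen c
  | y : UGen c
  | s₃ : UGen c
  | t (j : ℕ) (hj : 2 ≤ j ∧ j ≤ c) : UGen c

namespace UGen

/-- The free generator `x`. -/
def wx (c : ℕ) : FreeGroup (UGen c) := FreeGroup.of UGen.x

/-- The free generator `y`. -/
def wy (c : ℕ) : FreeGroup (UGen c) := FreeGroup.of UGen.y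

/-- The free generator `s₃`. -/
def ws₃ (c : ℕ) : FreeGroup (UGen c) := FreeGroup.of UGen.s₃

/-- The free generator `t_j` for `2 ≤ j ≤ c` (and the empty word for all other `j`). -/
def wt (c j : ℕ) : FreeGroup (UGen c) :=
  if hj : 2 ≤ j ∧ j ≤ c then FreeGroup.of (UGen.t j hj) else 1

end UGen

open UGen in
/-- The relators of the parametrized pc-presentation of class `c` with exponents `e` (of `t_c` in
the relator of `y`) and `b` (of `t_c` in the relator of `x`). The first group of constructors are
the displayed relators; the second group are the trivial powers and trivial commutators of
pc-generators, which a pc-presentation leaves out by convention. -/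
inductive URelator (c e b : ℕ) : FreeGroup (UGen c) → Prop
  | def_t₂ : URelator c e b ((wt c 2)⁻¹ * pcComm (wy c) (wx c))
  | def_s₃ : URelator c e b ((ws₃ c)⁻¹ * pcComm (wt c 2) (wx c))
  | def_t (j : ℕ) (h₁ : 3 ≤ j) (h₂ : j ≤ c) :
      URelator c e b ((wt c j)⁻¹ * pcComm (wt c (j - 1)) (wy c))
  | pow_t (j : ℕ) (h₁ : 2 ≤ j) (h₂ : j + 3 ≤ c) :
      URelator c e b (wt c j ^ 3 * (wt c (j + 2) ^ 2 * wt c (j + 3))⁻¹)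
  | pow_t_sub_two : URelator c e b (wt c (c - 2) ^ 3 * (wt c c ^ 2)⁻¹)
  | pow_s₃ : URelator c e b (ws₃ c ^ 3)
  | rel_y : URelator c e b (wy c ^ 3 * (ws₃ c)⁻¹ * (wt c c ^ e)⁻¹)
  | rel_x : URelator c e b
      (wx c ^ 3 * (wt c 3)⁻¹ * (wt c 4 ^ 2)⁻¹ * (wt c 5)⁻¹ * (wt c c ^ b)⁻¹)
  | pow_t_sub_one : URelator c e b (wt c (c - 1) ^ 3)
  | pow_t_last : URelator c e b (wt c c ^ 3)
  | comm_t_last_y : URelator c e b (pcComm (wt c c) (wy c))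
  | comm_t_x (j : ℕ) (h₁ : 3 ≤ j) (h₂ : j ≤ c) : URelator c e b (pcComm (wt c j) (wx c))
  | comm_s₃_x : URelator c e b (pcComm (ws₃ c) (wx c))
  | comm_s₃_y : URelator c e b (pcComm (ws₃ c) (wy c))
  | comm_t_s₃ (j : ℕ) (h₁ : 2 ≤ j) (h₂ : j ≤ c) : URelator c e b (pcComm (wt c j) (ws₃ c))
  | comm_t_t (i j : ℕ) (h₁ : 2 ≤ i) (h₂ : i ≤ c) (h₃ : 2 ≤ j) (h₄ : j ≤ c) :
      URelator c e b (pcComm (wt c i) (wt c j))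

/-- The group `G = G(c; e, b)` given by the pc-presentation. -/
abbrev UGroup (c e b : ℕ) : Type := PresentedGroup {r | URelator c e b r}

namespace UGroup

/-- The image of a word of the free group in `G(c; e, b)`. -/
def img (c e b : ℕ) (w : FreeGroup (UGen c)) : UGroup c e b :=
  PresentedGroup.mk {r | URelator c e b r} w

end UGroup

/-- The five pc-generators of `⟨243, 8⟩`. -/
inductive RootGen : Type
  | x | y | t₂ | s₃ | t₃

/-- The relators of `⟨243, 8⟩`: `t₂ = [y, x]`, `s₃ = [t₂, x]`, `t₃ = [t₂, y]`, `x³ = t₃`,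
`y³ = s₃`, `t₂³ = s₃³ = t₃³ = 1`, with `s₃` and `t₃` central. -/
inductive RootRelator : FreeGroup RootGen → Prop
  | def_t₂ : RootRelator ((FreeGroup.of .t₂)⁻¹ * pcComm (FreeGroup.of .y) (FreeGroup.of .x))
  | def_s₃ : RootRelator ((FreeGroup.of .s₃)⁻¹ * pcComm (FreeGroup.of .t₂) (FreeGroup.of .x))
  | def_t₃ : RootRelator ((FreeGroup.of .t₃)⁻¹ * pcComm (FreeGroup.of .t₂) (FreeGroup.of .y))
  | pow_x : RootRelator (FreeGroup.of .x ^ 3 * (FreeGroup.of .t₃)⁻¹)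
  | pow_y : RootRelator (FreeGroup.of .y ^ 3 * (FreeGroup.of .s₃)⁻¹)
  | pow_t₂ : RootRelator (FreeGroup.of .t₂ ^ 3)
  | pow_s₃ : RootRelator (FreeGroup.of .s₃ ^ 3)
  | pow_t₃ : RootRelator (FreeGroup.of .t₃ ^ 3)
  | comm_s₃ (g : RootGen) : RootRelator (pcComm (FreeGroup.of .s₃) (FreeGroup.of g))
  | comm_t₃ (g : RootGen) : RootRelator (pcComm (FreeGroup.of .t₃) (FreeGroup.of g))

/-- The group `SmallGroup(243, 8)`, the root of the coclass tree. -/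
abbrev SmallGroup243_8 : Type := PresentedGroup {r | RootRelator r}

/-- The lower exponent-`p` central series `P₀ = G`, `P_{n+1} = [P_n, G] P_n^p`. -/
def lowerPCentralSeries (p : ℕ) (G : Type*) [Group G] : ℕ → Subgroup G
  | 0 => ⊤
  | n + 1 => Subgroup.normalClosure
      ({z | ∃ g ∈ lowerPCentralSeries p G n, ∃ h : G, z = pcComm g h} ∪
        {z | ∃ g ∈ lowerPCentralSeries p G n, z = g ^ p})

instance lowerPCentralSeries_normal (p : ℕ) (G : Type*) [Group G] (n : ℕ) :
    (lowerPCentralSeries p G n).Normal := by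
  cases n with
  | zero => exact (inferInstance : (⊤ : Subgroup G).Normal)
  | succ n => exact Subgroup.normalClosure_normal

/-- `G` is a descendant of `P` in the tree of finite `p`-groups: `P` is isomorphic to a quotient of
`G` by a term of its lower exponent-`p` central series. -/
def IsDescendant (p : ℕ) (G P : Type*) [Group G] [Group P] : Prop :=
  ∃ n : ℕ, Nonempty (G ⧸ lowerPCentralSeries p G n ≃* P)

/-- `G` is a finite `p`-group of coclass `r`: `|G| = p ^ (cl(G) + r)`. -/
def HasCoclass (p : ℕ) (G : Type*) [Group G] (r : ℕ) : Prop :=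
  Group.IsNilpotent G ∧ Nat.card G = p ^ (Group.nilpotencyClass G + r)

/-- `G` is metabelian: its soluble length is exactly two. -/
def IsMetabelianGroup (G : Type*) [Group G] : Prop :=
  derivedSeries G 2 = ⊥ ∧ derivedSeries G 1 ≠ ⊥

/-- The kernel in `G` of the Artin transfer `G → H / H'`. It contains `G'`, so that it is the
preimage of the kernel of the induced homomorphism `G / G' → H / H'`. -/
noncomputable def artinKernel {G : Type*} [Group G] (H : Subgroup G) [H.FiniteIndex] :
    Subgroup G :=
  (MonoidHom.transfer (Abelianization.of : H →* Abelianization H)).ker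

/-- `G` has exactly four maximal subgroups `H₁, …, H₄`, and for a suitable numbering the transfer
kernel type of `G` is `ϰ`: the kernel of the transfer to `H_i` is `G` if `ϰ_i = 0`, and is `H_j` if
`ϰ_i = j`. -/
def HasTKT (G : Type*) [Group G] (ϰ : Fin 4 → Fin 5) : Prop :=
  ∃ H : Fin 4 → Subgroup G, Function.Injective H ∧
    (∀ M : Subgroup G, IsCoatom M ↔ ∃ i, H i = M) ∧
    ∀ i, ∃ _ : (H i).FiniteIndex,
      artinKernel (H i) = (Fin.cons ⊤ H : Fin 5 → Subgroup G) (ϰ i)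

/-- The transfer kernel type c.21. -/
def tktC21 : Fin 4 → Fin 5 := ![0, 2, 3, 1]

/-- The transfer kernel type E.8. -/
def tktE8 : Fin 4 → Fin 5 := ![1, 2, 3, 1]

/-- The transfer kernel type E.9. -/
def tktE9 : Fin 4 → Fin 5 := ![2, 2, 3, 1]

/-- The transfer kernel type G.16. -/
def tktG16 : Fin 4 → Fin 5 := ![4, 2, 3, 1]

/-- The automorphism `σ` acts as inversion on the cohomology group `Hⁱ(G, 𝔽_p)`. -/
def InvertsCohomology (p : ℕ) {G : Type} [Group G] (σ : MulAut G) (i : ℕ) : Prop :=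
  ∀ z : groupCohomology (Rep.trivial (ZMod p) G (ZMod p)) i,
    groupCohomology.map (A := Rep.trivial (ZMod p) G (ZMod p))
      (B := Rep.trivial (ZMod p) G (ZMod p)) σ.toMonoidHom
      (Rep.ofHom ⟨LinearMap.id, fun _ => rfl⟩) i z = -z

/-- `G` has a generator-inverting automorphism: an automorphism of order two which acts as
inversion on `H¹(G, 𝔽_p)`. -/
def HasGeneratorInvertingAut (p : ℕ) (G : Type) [Group G] : Prop :=
  ∃ σ : MulAut G, orderOf σ = 2 ∧ InvertsCohomology p σ 1

/-- `G` has a generator- and relator-inverting automorphism: an automorphism of order two which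
acts as inversion on both `H¹(G, 𝔽_p)` and `H²(G, 𝔽_p)`. -/
def HasRelatorInvertingAut (p : ℕ) (G : Type) [Group G] : Prop :=
  ∃ σ : MulAut G, orderOf σ = 2 ∧ InvertsCohomology p σ 1 ∧ InvertsCohomology p σ 2

/-!
Write `c = n + 2`. Let `ζ` be a primitive third root of unity and `D = ζ - 1`, so that
`D ^ 2 = -3 - 3 * D`. The derived subgroup of `G(c; e, b)` is the additive group of `CycR n × 𝔽₃`,
where `CycR n = ℤ[ζ] / (D ^ (n + 1))`: the element `t_j` corresponds to `D ^ (j - 2)` and `s₃` to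
the generator of `𝔽₃`. Conjugation by `y` is multiplication by `ζ` on the first factor, and `x`
sends `t` to `t * s₃ ^ ε(t)`, where `ε` is the residue of `t` modulo `D`. The relation
`t_j³ = t_{j+2}² * t_{j+3}` is the identity `3 = 2 * D ^ 2 + D ^ 3`.

`Model n` is the resulting extension of `ℤ²` (the exponents of `x` and `y`) with an explicit
product, and the relations for `x³` and `y³` span a central subgroup `Model.rel`. The quotient has
at least `3 ^ (c + 2)` elements (`Model.card_le_index`), and a group generated by elements that
satisfy the relations has at most that many (`card_closure_le`), so the quotient is `G(c; e, b)`
(`UGroup.exists_coord`). Calculations in `G(c; e, b)` are thereby reduced to calculations with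
quadruples. The order, the class and the solubility length can be read off, as can the quotients by
the terms of the central series, which are compared with `⟨243, 8⟩` and with the mainline by
homomorphisms in both directions (`UGroup.quotient_root`, `UGroup.mainline_quotient`).

*Transfers.* The maximal subgroups are `⟨g, G'⟩` for `g = x, x * y, x * y⁻¹, y`. The transfer to a
maximal subgroup `H` maps an element outside `H` to the class of its cube
(`transfer_eq_pow_three`), and `H'` consists of the commutators of `g` with `G'`
(`UGroup.mem_commutator_line`). Outside `⟨x, G'⟩` the leading terms of the cube cancel
(`UGroup.coord_pow_three_of_ne`): for `j` prime to `3` the cube of `x ^ i * y ^ j` is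
`t_c ^ (i * b + j * e)` times a power of `s₃`. Consequently the kernels for `⟨x * y, G'⟩` and
`⟨x * y⁻¹, G'⟩` are these groups themselves, the kernel for `⟨y, G'⟩` is `⟨x, G'⟩`, and the kernel
for `⟨x, G'⟩` is given by the linear form `i * b + j * e` (`UGroup.mem_artinKernel_one_zero`); the
four shapes of this form are the four types.

*Isomorphisms.* An isomorphism from `G(c; e', b')` to `G(c; e, b)` maps `x` and `y` to `x ^ i` and
`y ^ l` modulo the derived subgroup, for signs `i` and `l`, and comparison of the relations at
`t_c` yields `e = e' * i * l ^ c` and `b = b' * l ^ (c + 1)` in `𝔽₃`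
(`UGroup.exists_sign_of_injective`). Conversely these equations provide an isomorphism
(`UGroup.exists_sign_equiv`). This settles the isomorphism problem. A generator-inverting
automorphism is the case `i = l = -1`, `e = e'`, `b = b'`, which requires `c` to be odd or
`e = b = 0`.

*The second cohomology group.* Let `σ` be the automorphism inverting `x` and `y`, and let `f` be a
`2`-cocycle. The cocycle `f + σ^* f` is fixed by `σ`, so the central extension `E` that it defines
has an endomorphism `τ` that covers `σ` and fixes the kernel, and `x` and `y` have lifts inverted
by `τ`. An element of the kernel that is both fixed and inverted is trivial, since the kernel has
exponent `3`. Hence the preimage of `G'` in `E` is abelian (`IsInvertingExtension.comm_of_mem`) and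
the relations of `G(c; e, b)` hold in `E` exactly, not only up to elements of the kernel
(`errors_eq_zero`). So `E` splits and `f + σ^* f` is a coboundary. The sign by which `τ` acts on
`t_c` is where the parity of `c` enters.
-/

/-! ### The truncated ring of Eisenstein integers -/

/-- The ring `ℤ[ζ₃]`, on the basis `1, D` with `D = ζ₃ - 1`, so that `D² = -3 - 3D`. -/
abbrev EisInt : Type := QuadraticAlgebra ℤ (-3) (-3)

namespace EisInt

/-- The uniformizer `ζ₃ - 1` above `3`. -/
def D : EisInt := ⟨0, 1⟩

/-- The power `ζ₃ ^ j`, as a function of the exponent modulo `3`. -/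
def z : ZMod 3 → EisInt := ![1, ⟨1, 1⟩, ⟨-2, -1⟩]

/-- The quotient `(ζ₃ ^ j - 1) / (ζ₃ - 1)`, as a function of the exponent modulo `3`. -/
def br : ZMod 3 → EisInt := ![0, 1, ⟨2, 1⟩]

theorem z_add : ∀ j l : ZMod 3, z (j + l) = z j * z l := by decide

theorem br_add : ∀ j l : ZMod 3, br (j + l) = br l + z l * br j := by decide

theorem D_mul_br : ∀ j : ZMod 3, D * br j = z j - 1 := by decide

theorem D_mul_D : D * D = -3 - 3 * D := by decide

/-- The augmentation `ℤ[ζ₃] → 𝔽₃` with kernel `(D)`. -/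
def eps : EisInt →+* ZMod 3 where
  toFun r := (r.re : ZMod 3)
  map_one' := by
    change (((1 : EisInt).re : ℤ) : ZMod 3) = 1
    rw [QuadraticAlgebra.re_one, Int.cast_one]
  map_zero' := by
    change (((0 : EisInt).re : ℤ) : ZMod 3) = 0
    rw [QuadraticAlgebra.re_zero, Int.cast_zero]
  map_add' a b := by simp
  map_mul' a b := by
    have h3 : (3 : ZMod 3) = 0 := rfl
    simp [h3]

theorem eps_D : eps D = 0 := by simp [eps, D]

theorem D_mul (a : EisInt) : D * a = ⟨-3 * a.im, a.re - 3 * a.im⟩ := by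
  ext
  · simp [D]
  · simp [D]; ring

theorem eps_eq_zero_iff (r : EisInt) : eps r = 0 ↔ D ∣ r := by
  constructor
  · intro h
    have h' : ((r.re : ℤ) : ZMod 3) = 0 := h
    obtain ⟨k, hk⟩ := (ZMod.intCast_zmod_eq_zero_iff_dvd r.re 3).1 h'
    refine ⟨⟨r.im - 3 * k, -k⟩, ?_⟩
    rw [D_mul]
    ext
    · simp [hk]
    · simp
  · rintro ⟨s, rfl⟩
    rw [map_mul, eps_D, zero_mul]

theorem D_mul_injective : Function.Injective (fun a : EisInt => D * a) := by
  intro a b h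
  simp only [D_mul, QuadraticAlgebra.mk.injEq] at h
  ext <;> lia

theorem D_pow_mul_injective (k : ℕ) : Function.Injective (fun a : EisInt => D ^ k * a) := by
  induction k with
  | zero => intro a b h; simpa using h
  | succ k ih =>
    intro a b h
    apply ih
    apply D_mul_injective
    simpa only [pow_succ', mul_assoc] using h

/-- The subgroup `D ^ k ℤ[ζ₃]` has index `3 ^ k`: multiplication by `D` is injective with image
the kernel of the augmentation. -/
theorem index_range_mulLeft_D_pow (k : ℕ) : (AddMonoidHom.mulLeft (D ^ k)).range.index = 3 ^ k := by
  induction k with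
  | zero =>
    rw [AddMonoidHom.range_eq_top.2]
    · simp
    · intro a; exact ⟨a, by simp⟩
  | succ k ih =>
    have h1 : (AddMonoidHom.mulLeft D).range.index = 3 := by
      have : (AddMonoidHom.mulLeft D).range = (eps : EisInt →+ ZMod 3).ker := by
        ext r
        rw [AddMonoidHom.mem_range, AddMonoidHom.mem_ker]
        exact Iff.trans ⟨fun ⟨s, hs⟩ => ⟨s, hs.symm⟩, fun ⟨s, hs⟩ => ⟨s, hs.symm⟩⟩
          (eps_eq_zero_iff r).symm
      rw [this, AddSubgroup.index_ker, AddMonoidHom.range_eq_top.2]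
      · simp
      · intro a
        refine ⟨(a.val : EisInt), ?_⟩
        simp
    have h2 : (AddMonoidHom.mulLeft (D ^ (k + 1))).range
        = (AddMonoidHom.mulLeft (D ^ k)).range.map (AddMonoidHom.mulLeft D) := by
      ext r
      simp only [AddMonoidHom.mem_range, AddSubgroup.mem_map, AddMonoidHom.coe_mulLeft]
      constructor
      · rintro ⟨a, rfl⟩
        exact ⟨D ^ k * a, ⟨a, rfl⟩, by ring⟩
      · rintro ⟨_, ⟨a, rfl⟩, rfl⟩
        exact ⟨a, by ring⟩
    rw [h2, AddSubgroup.index_map_of_injective _ D_mul_injective, ih, h1, pow_succ]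

end EisInt

/-- The truncation `ℤ[ζ₃] / (D ^ (n + 1))`, which models the subgroup generated by
`t₂, …, t_{n+2}`, with `t_j` corresponding to `D ^ (j - 2)`. -/
def CycR (n : ℕ) : Type := EisInt ⧸ Ideal.span {EisInt.D ^ (n + 1)}

namespace CycR

variable {n : ℕ}

noncomputable instance : CommRing (CycR n) :=
  inferInstanceAs (CommRing (EisInt ⧸ Ideal.span {EisInt.D ^ (n + 1)}))

/-- The projection from `ℤ[ζ₃]`. -/
noncomputable def mk : EisInt →+* CycR n := Ideal.Quotient.mk (Ideal.span {EisInt.D ^ (n + 1)})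

theorem mk_surjective : Function.Surjective (mk : EisInt → CycR n) := Ideal.Quotient.mk_surjective

theorem mk_eq_zero_iff (r : EisInt) : (mk r : CycR n) = 0 ↔ EisInt.D ^ (n + 1) ∣ r := by
  rw [mk]
  exact Ideal.Quotient.eq_zero_iff_dvd _ _

/-- The image of `ζ₃ - 1`. -/
noncomputable def D : CycR n := mk EisInt.D

/-- The power `ζ₃ ^ j`. -/
noncomputable def z (j : ℤ) : CycR n := mk (EisInt.z j)

/-- The element `(ζ₃ ^ j - 1) / (ζ₃ - 1)`. -/
noncomputable def br (j : ℤ) : CycR n := mk (EisInt.br j)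

/-- The augmentation onto the residue field `𝔽₃`. -/
noncomputable def eps : CycR n →+* ZMod 3 :=
  Ideal.Quotient.lift _ EisInt.eps (by
    intro a ha
    obtain ⟨b, rfl⟩ := Ideal.mem_span_singleton.1 ha
    rw [map_mul, map_pow, EisInt.eps_D]
    simp)

theorem eps_mk (r : EisInt) : eps (mk r : CycR n) = EisInt.eps r := rfl

theorem z_add (j l : ℤ) : (z (j + l) : CycR n) = z j * z l := by
  simp only [z, Int.cast_add, EisInt.z_add, map_mul]

theorem br_add (j l : ℤ) : (br (j + l) : CycR n) = br l + z l * br j := by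
  simp only [z, br, Int.cast_add, EisInt.br_add, map_mul, map_add]

theorem D_mul_br (j : ℤ) : (D * br j : CycR n) = z j - 1 := by
  simp only [z, br, D, ← map_mul, EisInt.D_mul_br, map_sub, map_one]

theorem z_eq (j : ℤ) : (z j : CycR n) = 1 + D * br j := by rw [D_mul_br]; ring

theorem D_sq : (D ^ 2 : CycR n) = -3 - 3 * D := by
  rw [D, ← map_pow, sq, EisInt.D_mul_D, map_sub, map_mul, map_neg, map_ofNat]

theorem z_of_dvd {j : ℤ} (h : (3 : ℤ) ∣ j) : (z j : CycR n) = 1 := by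
  have : ((j : ℤ) : ZMod 3) = 0 := (ZMod.intCast_zmod_eq_zero_iff_dvd j 3).2 h
  rw [z, this]; exact map_one mk

theorem br_of_dvd {j : ℤ} (h : (3 : ℤ) ∣ j) : (br j : CycR n) = 0 := by
  have : ((j : ℤ) : ZMod 3) = 0 := (ZMod.intCast_zmod_eq_zero_iff_dvd j 3).2 h
  rw [br, this]; exact map_zero mk

theorem z_zero : (z 0 : CycR n) = 1 := z_of_dvd (dvd_zero _)

theorem br_zero : (br 0 : CycR n) = 0 := br_of_dvd (dvd_zero _)

theorem br_one : (br 1 : CycR n) = 1 := by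
  rw [br]; exact map_one mk

theorem z_one : (z 1 : CycR n) = 1 + D := by rw [z_eq, br_one, mul_one]

theorem br_neg_one : (br (-1) : CycR n) = 2 + D := by
  rw [br, D]
  have : EisInt.br ((-1 : ℤ) : ZMod 3) = 2 + EisInt.D := by decide
  rw [this, map_add, map_ofNat]

theorem D_pow_eq_zero {k : ℕ} (h : n < k) : (D ^ k : CycR n) = 0 := by
  rw [D, ← map_pow, mk_eq_zero_iff]
  exact pow_dvd_pow _ h

theorem eps_D : eps (D : CycR n) = 0 := by rw [D, eps_mk, EisInt.eps_D]

theorem eps_z (j : ℤ) : eps (z j : CycR n) = 1 := by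
  rw [z_eq, map_add, map_mul, eps_D, map_one]; simp

theorem eps_br (j : ℤ) : eps (br j : CycR n) = j := by
  rw [br, eps_mk]
  generalize (j : ZMod 3) = a
  revert a; decide

theorem eps_eq_zero_iff (r : CycR n) : eps r = 0 ↔ ∃ s, r = D * s := by
  constructor
  · obtain ⟨r, rfl⟩ := mk_surjective r
    rw [eps_mk, EisInt.eps_eq_zero_iff]
    rintro ⟨s, rfl⟩
    exact ⟨mk s, by rw [map_mul]; rfl⟩
  · rintro ⟨s, rfl⟩
    rw [map_mul, eps_D, zero_mul]

/-- The socle `D ^ n` of the truncated ring is annihilated exactly by the maximal ideal. -/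
theorem D_pow_mul_eq_zero_iff (r : CycR n) : D ^ n * r = 0 ↔ eps r = 0 := by
  obtain ⟨r, rfl⟩ := mk_surjective r
  rw [D, ← map_pow, ← map_mul, mk_eq_zero_iff, eps_mk, EisInt.eps_eq_zero_iff, pow_succ]
  constructor
  · rintro ⟨s, hs⟩
    exact ⟨s, EisInt.D_pow_mul_injective n (by simpa only [mul_assoc] using hs)⟩
  · exact fun h => mul_dvd_mul_left _ h

theorem D_pow_mul_eq_zero {k : ℕ} (hk : k ≤ n) {r : CycR n} (h : D ^ k * r = 0) : eps r = 0 := by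
  obtain ⟨m, hm⟩ := Nat.exists_eq_add_of_le' hk
  have h' : (D : CycR n) ^ (m + k) * r = 0 := by rw [pow_add, mul_assoc, h, mul_zero]
  rw [← hm] at h'
  exact (D_pow_mul_eq_zero_iff r).1 h'

theorem D_pow_ne_zero : (D ^ n : CycR n) ≠ 0 := by
  intro h
  have := (D_pow_mul_eq_zero_iff (1 : CycR n)).1 (by rw [mul_one, h])
  rw [map_one] at this
  exact one_ne_zero this

theorem exists_eq_int (r : CycR n) : ∃ u v : ℤ, r = (u : CycR n) + (v : CycR n) * D := by
  obtain ⟨r, rfl⟩ := mk_surjective r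
  refine ⟨r.re, r.im, ?_⟩
  have : r = (r.re : EisInt) + (r.im : EisInt) * EisInt.D := by ext <;> simp [EisInt.D]
  calc mk r = mk ((r.re : EisInt) + (r.im : EisInt) * EisInt.D) := congrArg mk this
    _ = _ := by rw [map_add, map_mul, map_intCast, map_intCast]; rfl

theorem card_eq : Nat.card (CycR n) = 3 ^ (n + 1) := by
  rw [← EisInt.index_range_mulLeft_D_pow (n + 1)]
  have : (AddMonoidHom.mulLeft (EisInt.D ^ (n + 1))).range
      = (Ideal.span {EisInt.D ^ (n + 1)}).toAddSubgroup := by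
    ext r
    rw [AddMonoidHom.mem_range, Submodule.mem_toAddSubgroup, Ideal.mem_span_singleton]
    exact ⟨fun ⟨s, hs⟩ => ⟨s, hs.symm⟩, fun ⟨s, hs⟩ => ⟨s, hs.symm⟩⟩
  rw [this]
  rfl

end CycR

/-! ### Tuples satisfying the relations -/

theorem pcComm_eq_iff {G : Type*} [Group G] {a b c : G} : pcComm a b = c ↔ a * b = b * a * c := by
  rw [pcComm, mul_assoc, mul_assoc, inv_mul_eq_iff_eq_mul, inv_mul_eq_iff_eq_mul, ← mul_assoc]

theorem pcComm_eq_one_iff {G : Type*} [Group G] {a b : G} : pcComm a b = 1 ↔ a * b = b * a := by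
  rw [pcComm_eq_iff, mul_one]

theorem map_pcComm {G H : Type*} [Group G] [Group H] (f : G →* H) (a b : G) :
    f (pcComm a b) = pcComm (f a) (f b) := by simp [pcComm]

/-- The elements `X, Y, S` and `t 2, t 3, …` of a group satisfy the relations of `G(c; e, b)`, where
`t j = 1` for `j > c`. With this convention the power relations of all the `t j` take the same
form. -/
structure IsUTuple {E : Type*} [Group E] (c e b : ℕ) (X Y S : E) (t : ℕ → E) : Prop where
  t_two : t 2 = pcComm Y X
  s_eq : S = pcComm (t 2) X
  t_succ : ∀ j, 2 ≤ j → t (j + 1) = pcComm (t j) Y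
  t_gt : ∀ j, c < j → t j = 1
  t_pow : ∀ j, 2 ≤ j → t j ^ 3 = t (j + 2) ^ 2 * t (j + 3)
  s_pow : S ^ 3 = 1
  y_pow : Y ^ 3 = S * t c ^ e
  x_pow : X ^ 3 = t 3 * t 4 ^ 2 * t 5 * t c ^ b
  t_x : ∀ j, 3 ≤ j → t j * X = X * t j
  s_x : S * X = X * S
  s_y : S * Y = Y * S
  t_s : ∀ j, 2 ≤ j → t j * S = S * t j
  t_t : ∀ i j, 2 ≤ i → 2 ≤ j → t i * t j = t j * t i

theorem IsUTuple.map {E F : Type*} [Group E] [Group F] {c e b : ℕ} {X Y S : E} {t : ℕ → E}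
    (h : IsUTuple c e b X Y S t) (f : E →* F) :
    IsUTuple c e b (f X) (f Y) (f S) (fun j => f (t j)) where
  t_two := by rw [h.t_two, map_pcComm]
  s_eq := by rw [← map_pcComm, ← h.s_eq]
  t_succ j hj := by rw [h.t_succ j hj, map_pcComm]
  t_gt j hj := by rw [h.t_gt j hj, map_one]
  t_pow j hj := by rw [← map_pow, h.t_pow j hj, map_mul, map_pow]
  s_pow := by rw [← map_pow, h.s_pow, map_one]
  y_pow := by rw [← map_pow, h.y_pow, map_mul, map_pow]
  x_pow := by rw [← map_pow, h.x_pow]; simp only [map_mul, map_pow]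
  t_x j hj := by rw [← map_mul, h.t_x j hj, map_mul]
  s_x := by rw [← map_mul, h.s_x, map_mul]
  s_y := by rw [← map_mul, h.s_y, map_mul]
  t_s j hj := by rw [← map_mul, h.t_s j hj, map_mul]
  t_t i j hi hj := by rw [← map_mul, h.t_t i j hi hj, map_mul]

namespace UGroup

variable {c e b : ℕ}

/-- The generator `x`. -/
def X (c e b : ℕ) : UGroup c e b := img c e b (UGen.wx c)

/-- The generator `y`. -/
def Y (c e b : ℕ) : UGroup c e b := img c e b (UGen.wy c)

/-- The generator `s₃`. -/
def S (c e b : ℕ) : UGroup c e b := img c e b (UGen.ws₃ c)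

/-- The generator `t_j`. -/
def t (c e b j : ℕ) : UGroup c e b := img c e b (UGen.wt c j)

theorem wt_of_not {c j : ℕ} (h : ¬(2 ≤ j ∧ j ≤ c)) : UGen.wt c j = 1 := dif_neg h

theorem t_eq_one_of_gt {j : ℕ} (h : c < j) : t c e b j = 1 := by
  rw [t, wt_of_not (by lia)]
  exact map_one (PresentedGroup.mk _)

theorem img_eq_one {r : FreeGroup (UGen c)} (h : URelator c e b r) : img c e b r = 1 :=
  PresentedGroup.one_of_mem h

/-- The generators satisfy the relations in the uniform shape of `IsUTuple`. The convention
`t j = 1` for `j > c` absorbs the truncated relations for `t_{c-2}`, `t_{c-1}` and `t_c`, and the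
factors of `x³` and `y³` may be reordered since they commute. -/
theorem isUTuple (hc : 5 ≤ c) :
    IsUTuple c e b (X c e b) (Y c e b) (S c e b) (t c e b) := by
  have key : ∀ {r}, URelator c e b r → PresentedGroup.mk {r | URelator c e b r} r = 1 :=
    fun h => img_eq_one h
  have comm : ∀ {u v}, URelator c e b (pcComm u v) →
      PresentedGroup.mk {r | URelator c e b r} u * PresentedGroup.mk {r | URelator c e b r} v =
      PresentedGroup.mk {r | URelator c e b r} v * PresentedGroup.mk {r | URelator c e b r} u := by
    intro u v h
    rw [← pcComm_eq_one_iff, ← map_pcComm]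
    exact key h
  refine ⟨?_, ?_, ?_, fun j => t_eq_one_of_gt, ?_, ?_, ?_, ?_, ?_, comm .comm_s₃_x,
    comm .comm_s₃_y, ?_, ?_⟩
  · have := key (.def_t₂ : URelator c e b _)
    rw [map_mul, map_inv, inv_mul_eq_one, map_pcComm] at this
    exact this
  · have := key (.def_s₃ : URelator c e b _)
    rw [map_mul, map_inv, inv_mul_eq_one, map_pcComm] at this
    exact this
  · intro j hj
    rcases Nat.lt_or_ge c (j + 1) with h | h
    · rw [t_eq_one_of_gt h, eq_comm, pcComm_eq_one_iff]
      rcases Nat.lt_or_ge c j with h' | h'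
      · rw [t_eq_one_of_gt h', one_mul, mul_one]
      · obtain rfl : j = c := by lia
        exact comm .comm_t_last_y
    · have := key (.def_t (j + 1) (by lia) h : URelator c e b _)
      rw [map_mul, map_inv, inv_mul_eq_one, map_pcComm] at this
      exact this
  · intro j hj
    rcases Nat.lt_or_ge c (j + 3) with h | h
    · rw [t_eq_one_of_gt h, mul_one]
      rcases Nat.lt_or_ge c (j + 2) with h2 | h2
      · rw [t_eq_one_of_gt h2, one_pow]
        rcases Nat.lt_or_ge c (j + 1) with h1 | h1
        · rcases Nat.lt_or_ge c j with h0 | h0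
          · rw [t_eq_one_of_gt h0, one_pow]
          · obtain rfl : j = c := by lia
            have := key (.pow_t_last : URelator j e b _)
            rwa [map_pow] at this
        · obtain rfl : c = j + 1 := by lia
          have := key (.pow_t_sub_one : URelator (j + 1) e b _)
          rwa [map_pow] at this
      · obtain rfl : c = j + 2 := by lia
        have := key (.pow_t_sub_two : URelator (j + 2) e b _)
        rw [map_mul, map_inv, mul_inv_eq_one, map_pow, map_pow] at this
        exact this
    · have := key (.pow_t j hj h : URelator c e b _)
      rw [map_mul, map_inv, mul_inv_eq_one, map_pow, map_mul, map_pow] at this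
      exact this
  · have := key (.pow_s₃ : URelator c e b _)
    rwa [map_pow] at this
  · have := key (.rel_y : URelator c e b _)
    simp only [map_mul, map_inv, map_pow] at this
    rw [mul_inv_eq_one, mul_inv_eq_iff_eq_mul] at this
    have h2 := comm (.comm_t_s₃ c (by lia) le_rfl : URelator c e b _)
    have h3 : Commute (t c e b c) (S c e b) := h2
    exact this.trans (h3.pow_left e).eq
  · have := key (.rel_x : URelator c e b _)
    simp only [map_mul, map_inv, map_pow] at this
    rw [mul_inv_eq_one, mul_inv_eq_iff_eq_mul, mul_inv_eq_iff_eq_mul, mul_inv_eq_iff_eq_mul] at this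
    have hc : ∀ i j, 2 ≤ i → i ≤ c → 2 ≤ j → j ≤ c → Commute (t c e b i) (t c e b j) :=
      fun i j h1 h2 h3 h4 => comm (.comm_t_t i j h1 h2 h3 h4)
    refine this.trans ?_
    change t c e b c ^ b * t c e b 5 * t c e b 4 ^ 2 * t c e b 3 = _
    have h1 := ((hc c 5 (by lia) (by lia) (by lia) (by lia)).pow_left b).eq
    have h2 := ((hc c 4 (by lia) (by lia) (by lia) (by lia)).pow_pow b 2).eq
    have h3 := ((hc c 3 (by lia) (by lia) (by lia) (by lia)).pow_left b).eq
    have h4 := ((hc 5 4 (by lia) (by lia) (by lia) (by lia)).pow_right 2).eq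
    have h5 := (hc 5 3 (by lia) (by lia) (by lia) (by lia)).eq
    have h6 := ((hc 4 3 (by lia) (by lia) (by lia) (by lia)).pow_left 2).eq
    rw [h1, mul_assoc (t c e b 5), h2, ← mul_assoc, h4, mul_assoc _ (t c e b c ^ b), h3,
      mul_assoc (t c e b 4 ^ 2), ← mul_assoc (t c e b 5), h5, ← mul_assoc, ← mul_assoc, h6]
  · intro j hj
    rcases Nat.lt_or_ge c j with h | h
    · rw [t_eq_one_of_gt h, one_mul, mul_one]
    · exact comm (.comm_t_x j hj h)
  · intro j hj
    rcases Nat.lt_or_ge c j with h | h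
    · rw [t_eq_one_of_gt h, one_mul, mul_one]
    · exact comm (.comm_t_s₃ j hj h)
  · intro i j hi hj
    rcases Nat.lt_or_ge c j with h | h
    · rw [t_eq_one_of_gt h, one_mul, mul_one]
    rcases Nat.lt_or_ge c i with h' | h'
    · rw [t_eq_one_of_gt h', one_mul, mul_one]
    exact comm (.comm_t_t i j hi h' hj h)

/-- The values of a tuple on the generators of the presentation. -/
def genMap {E : Type*} (X Y S : E) (t : ℕ → E) : UGen c → E
  | .x => X
  | .y => Y
  | .s₃ => S
  | .t j _ => t j

section lift

variable {E : Type*} [Group E] {X' Y' S' : E} {t' : ℕ → E}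

theorem lift_wt {j : ℕ} (h : IsUTuple c e b X' Y' S' t') (hj : 2 ≤ j) :
    FreeGroup.lift (genMap (c := c) X' Y' S' t') (UGen.wt c j) = t' j := by
  rcases Nat.lt_or_ge c j with h' | h'
  · rw [wt_of_not (by lia), map_one, h.t_gt j h']
  · rw [UGen.wt, dif_pos ⟨hj, h'⟩, FreeGroup.lift_apply_of]; rfl

theorem lift_relator (hc : 5 ≤ c) (h : IsUTuple c e b X' Y' S' t') :
    ∀ r ∈ {r | URelator c e b r}, FreeGroup.lift (genMap (c := c) X' Y' S' t') r = 1 := by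
  have hx : FreeGroup.lift (genMap (c := c) X' Y' S' t') (UGen.wx c) = X' :=
    FreeGroup.lift_apply_of
  have hy : FreeGroup.lift (genMap (c := c) X' Y' S' t') (UGen.wy c) = Y' :=
    FreeGroup.lift_apply_of
  have hs : FreeGroup.lift (genMap (c := c) X' Y' S' t') (UGen.ws₃ c) = S' :=
    FreeGroup.lift_apply_of
  have ht := fun {j} => lift_wt (j := j) h
  have htc : ∀ i j, 2 ≤ i → 2 ≤ j → Commute (t' i) (t' j) := h.t_t
  rintro r hr
  have hr' : URelator c e b r := hr
  cases hr' with
  | def_t₂ =>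
    rw [map_mul, map_inv, inv_mul_eq_one, map_pcComm, hx, hy, ht le_rfl, h.t_two]
  | def_s₃ =>
    rw [map_mul, map_inv, inv_mul_eq_one, map_pcComm, hx, hs, ht le_rfl, h.s_eq]
  | def_t j h₁ h₂ =>
    obtain ⟨j, rfl⟩ : ∃ k, j = k + 1 := ⟨j - 1, by lia⟩
    rw [map_mul, map_inv, inv_mul_eq_one, map_pcComm, hy, ht (by lia), Nat.add_sub_cancel,
      ht (by lia), h.t_succ j (by lia)]
  | pow_t j h₁ h₂ =>
    rw [map_mul, map_inv, mul_inv_eq_one, map_pow, map_mul, map_pow, ht h₁, ht (by lia),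
      ht (by lia), h.t_pow j h₁]
  | pow_t_sub_two =>
    rw [map_mul, map_inv, mul_inv_eq_one, map_pow, map_pow, ht (by lia), ht (by lia),
      h.t_pow _ (by lia), show c - 2 + 2 = c by lia, h.t_gt (c - 2 + 3) (by lia), mul_one]
  | pow_s₃ => rw [map_pow, hs, h.s_pow]
  | rel_y =>
    simp only [map_mul, map_inv, map_pow, hy, hs, ht (j := c) (by lia)]
    rw [h.y_pow, mul_inv_eq_one, mul_inv_eq_iff_eq_mul]
    have : Commute (t' c) S' := h.t_s c (by lia)
    exact (this.pow_left e).eq.symm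
  | rel_x =>
    simp only [map_mul, map_inv, map_pow, hx, ht (j := c) (by lia), ht (j := 3) (by lia),
      ht (j := 4) (by lia), ht (j := 5) (by lia)]
    rw [mul_inv_eq_one, mul_inv_eq_iff_eq_mul, mul_inv_eq_iff_eq_mul, mul_inv_eq_iff_eq_mul,
      h.x_pow]
    have h1 := ((htc c 5 (by lia) (by lia)).pow_left b).eq
    have h2 := ((htc c 4 (by lia) (by lia)).pow_pow b 2).eq
    have h3 := ((htc c 3 (by lia) (by lia)).pow_left b).eq
    have h4 := ((htc 5 4 (by lia) (by lia)).pow_right 2).eq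
    have h5 := (htc 5 3 (by lia) (by lia)).eq
    have h6 := ((htc 4 3 (by lia) (by lia)).pow_left 2).eq
    rw [h1, mul_assoc (t' 5), h2, ← mul_assoc (t' 5), h4, mul_assoc _ (t' c ^ b), h3,
      mul_assoc (t' 4 ^ 2), ← mul_assoc (t' 5), h5, ← mul_assoc (t' 4 ^ 2), ← mul_assoc (t' 4 ^ 2),
      h6]
  | pow_t_sub_one =>
    rw [map_pow, ht (by lia), h.t_pow _ (by lia), h.t_gt (c - 1 + 2) (by lia),
      h.t_gt (c - 1 + 3) (by lia), one_pow, one_mul]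
  | pow_t_last =>
    rw [map_pow, ht (by lia), h.t_pow _ (by lia), h.t_gt (c + 2) (by lia),
      h.t_gt (c + 3) (by lia), one_pow, one_mul]
  | comm_t_last_y =>
    rw [map_pcComm, hy, ht (by lia), ← h.t_succ c (by lia), h.t_gt _ (by lia)]
  | comm_t_x j h₁ h₂ =>
    rw [map_pcComm, hx, ht (by lia), pcComm_eq_one_iff, h.t_x j h₁]
  | comm_s₃_x => rw [map_pcComm, hx, hs, pcComm_eq_one_iff, h.s_x]
  | comm_s₃_y => rw [map_pcComm, hy, hs, pcComm_eq_one_iff, h.s_y]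
  | comm_t_s₃ j h₁ h₂ =>
    rw [map_pcComm, hs, ht (by lia), pcComm_eq_one_iff, h.t_s j h₁]
  | comm_t_t i j h₁ h₂ h₃ h₄ =>
    rw [map_pcComm, ht h₁, ht h₃, pcComm_eq_one_iff, h.t_t i j h₁ h₃]

/-- The homomorphism out of `G(c; e, b)` defined by a tuple satisfying the relations. -/
def lift (hc : 5 ≤ c) (h : IsUTuple c e b X' Y' S' t') : UGroup c e b →* E :=
  PresentedGroup.toGroup (lift_relator hc h)

variable (hc : 5 ≤ c) (h : IsUTuple c e b X' Y' S' t')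

theorem lift_X : lift hc h (X c e b) = X' := PresentedGroup.toGroup.of _

theorem lift_Y : lift hc h (Y c e b) = Y' := PresentedGroup.toGroup.of _

theorem lift_S : lift hc h (S c e b) = S' := PresentedGroup.toGroup.of _

theorem lift_t {j : ℕ} (hj : 2 ≤ j) : lift hc h (t c e b j) = t' j := lift_wt h hj

end lift

theorem closure_gens_eq_top (hc : 5 ≤ c) :
    Subgroup.closure {X c e b, Y c e b} = (⊤ : Subgroup (UGroup c e b)) := by
  have h := isUTuple (e := e) (b := b) hc
  set K := Subgroup.closure {X c e b, Y c e b}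
  have hX : X c e b ∈ K := Subgroup.subset_closure (by simp)
  have hY : Y c e b ∈ K := Subgroup.subset_closure (by simp)
  have hcomm : ∀ {u v}, u ∈ K → v ∈ K → pcComm u v ∈ K := fun hu hv =>
    K.mul_mem (K.mul_mem (K.mul_mem (K.inv_mem hu) (K.inv_mem hv)) hu) hv
  have ht : ∀ j, 2 ≤ j → t c e b j ∈ K := by
    intro j hj
    induction j, hj using Nat.le_induction with
    | base => rw [h.t_two]; exact hcomm hY hX
    | succ j hj ih => rw [h.t_succ j hj]; exact hcomm ih hY
  have hS : S c e b ∈ K := by rw [h.s_eq]; exact hcomm (ht 2 le_rfl) hX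
  rw [eq_top_iff, ← PresentedGroup.closure_range_of, Subgroup.closure_le]
  rintro _ ⟨g, rfl⟩
  cases g with
  | x => exact hX
  | y => exact hY
  | s₃ => exact hS
  | t j hj =>
    have := ht j hj.1
    rwa [t, UGen.wt, dif_pos hj] at this

/-- Homomorphisms out of `G(c; e, b)` that agree on `x` and `y` are equal. -/
theorem hom_ext (hc : 5 ≤ c) {E : Type*} [Group E] {f g : UGroup c e b →* E}
    (hX : f (X c e b) = g (X c e b)) (hY : f (Y c e b) = g (Y c e b)) : f = g := by
  refine MonoidHom.eq_of_eqOn_dense (closure_gens_eq_top hc) ?_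
  rintro _ (rfl | rfl)
  · exact hX
  · exact hY

end UGroup

/-! ### The model -/

/-- The underlying set of an extension of `ℤ²` by `CycR n × 𝔽₃`; the quadruple `(i, j, t, s)` stands
for the product of `x ^ i`, `y ^ j`, the element `t` of the module generated by `t₂`, and
`s₃ ^ s`. -/
@[ext]
structure Model (n : ℕ) : Type where
  /-- The exponent of `x`. -/
  i : ℤ
  /-- The exponent of `y`. -/
  j : ℤ
  /-- The component in the module generated by `t₂`. -/
  t : CycR n
  /-- The exponent of `s₃`. -/
  s : ZMod 3

namespace Model

variable {n : ℕ}

open CycR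

/-- The product is determined by `[y, x] = t₂`, the action `t ↦ t * s₃ ^ eps t` of `x` and the
multiplication by `ζ₃` as the action of `y`. The term `2 * k * (k - 1)` is the binomial coefficient
`k.choose 2` in `𝔽₃`. -/
noncomputable instance : Mul (Model n) where
  mul g h := ⟨g.i + h.i, g.j + h.j, z h.j * ((h.i : CycR n) * br g.j) + z h.j * g.t + h.t,
    g.j * (2 * h.i * (h.i - 1)) + h.i * eps g.t + g.s + h.s⟩

noncomputable instance : One (Model n) where
  one := ⟨0, 0, 0, 0⟩

noncomputable instance : Inv (Model n) where
  inv g := ⟨-g.i, -g.j, -((g.i : CycR n) * br (-g.j)) - z (-g.j) * g.t,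
    g.j * (2 * g.i * (g.i - 1)) - g.i * g.i * g.j + g.i * eps g.t - g.s⟩

theorem mul_def (g h : Model n) : g * h = ⟨g.i + h.i, g.j + h.j,
    z h.j * ((h.i : CycR n) * br g.j) + z h.j * g.t + h.t,
    g.j * (2 * h.i * (h.i - 1)) + h.i * eps g.t + g.s + h.s⟩ := rfl

theorem one_def : (1 : Model n) = ⟨0, 0, 0, 0⟩ := rfl

theorem inv_def (g : Model n) : g⁻¹ = ⟨-g.i, -g.j, -((g.i : CycR n) * br (-g.j)) - z (-g.j) * g.t,
    g.j * (2 * g.i * (g.i - 1)) - g.i * g.i * g.j + g.i * eps g.t - g.s⟩ := rfl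

theorem three_eq_zero : (3 : ZMod 3) = 0 := rfl

theorem three_cast_eq_zero : ((3 : ℤ) : ZMod 3) = 0 := rfl

noncomputable instance : Group (Model n) :=
  Group.ofLeftAxioms
    (by
      intro g h k
      simp only [mul_def, z_add, br_add, Int.cast_add, map_add, map_mul, eps_z, eps_br, map_intCast]
      ext
      · exact add_assoc _ _ _
      · exact add_assoc _ _ _
      · dsimp only; ring
      · dsimp only
        linear_combination (-(g.j * h.i * k.i) : ZMod 3) * three_eq_zero)
    (by
      intro g
      simp [mul_def, one_def, br_zero])
    (by
      intro g
      have h1 : (z g.j * z (-g.j) : CycR n) = 1 := by rw [← z_add]; simp [z_zero]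
      simp only [mul_def, one_def, inv_def, map_sub, map_neg, map_mul, eps_z, eps_br, map_intCast]
      ext
      · simp
      · simp
      · dsimp only; linear_combination (-g.t) * h1
      · dsimp only; push_cast; ring)

/-- The commutator of two elements of the model. -/
theorem pcComm_def (g h : Model n) : pcComm g h = ⟨0, 0,
    z h.j * ((h.i : CycR n) * br g.j) - z g.j * ((g.i : CycR n) * br h.j)
      + (z h.j - 1) * g.t - (z g.j - 1) * h.t,
    g.j * (2 * h.i * (h.i - 1)) - h.j * (2 * g.i * (g.i - 1)) + h.i * eps g.t - g.i * eps h.t⟩ := by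
  rw [pcComm_eq_iff]
  simp only [mul_def, z_zero, Int.cast_zero]
  ext
  · dsimp only; ring
  · dsimp only; ring
  · dsimp only; ring
  · dsimp only; ring

theorem pow_three (g : Model n) : g ^ 3 = ⟨3 * g.i, 3 * g.j,
    z g.j * ((g.i : CycR n) * br (2 * g.j)) + z (2 * g.j) * ((g.i : CycR n) * br g.j)
      + (1 + z g.j + z (2 * g.j)) * g.t,
    g.i * g.i * g.j⟩ := by
  rw [pow_succ, pow_two]
  simp only [mul_def, z_add, br_add, map_add, map_mul, eps_z, eps_br, map_intCast, two_mul]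
  ext
  · dsimp only; ring
  · dsimp only; ring
  · dsimp only; ring
  · dsimp only; push_cast
    linear_combination (g.j * (2 * g.i * (g.i - 1)) + g.i * eps g.t + g.s : ZMod 3) * three_eq_zero

/-- The embedding of the module. -/
noncomputable def ofPair : Multiplicative (CycR n × ZMod 3) →* Model n where
  toFun a := ⟨0, 0, a.toAdd.1, a.toAdd.2⟩
  map_one' := rfl
  map_mul' a b := by
    simp [mul_def, z_zero]

theorem pow_mk (r : CycR n) (s : ZMod 3) (k : ℕ) :
    (⟨0, 0, r, s⟩ : Model n) ^ k = ⟨0, 0, (k : CycR n) * r, (k : ZMod 3) * s⟩ := by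
  change ofPair (Multiplicative.ofAdd (r, s)) ^ k = _
  rw [← map_pow, ← ofAdd_nsmul]
  simp [ofPair]

theorem mk_mul_mk (r r' : CycR n) (s s' : ZMod 3) :
    (⟨0, 0, r, s⟩ : Model n) * ⟨0, 0, r', s'⟩ = ⟨0, 0, r + r', s + s'⟩ := by
  simp [mul_def, z_zero]

/-- The value of `x³`, which corresponds to the product `t₃ * t₄ ^ 2 * t₅ * t_c ^ b`. -/
noncomputable def xCube (n b : ℕ) : CycR n := D * (1 + D) ^ 2 + (b : CycR n) * D ^ n

/-- The identity behind the centrality of the relation for `x³`: it matches the action of `y` on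
`x³` with the commutator `[y, x³]`. -/
theorem D_mul_xCube (b : ℕ) : D * xCube n b = -3 := by
  rw [xCube]
  linear_combination (b : CycR n) * D_pow_eq_zero (n := n) (k := n + 1) (by lia)
    + (D ^ 2 - D + 1) * (D_sq : (D ^ 2 : CycR n) = _)

theorem eps_xCube (hn : 1 ≤ n) (b : ℕ) : eps (xCube n b) = 0 := by
  rw [xCube, map_add, map_mul, map_mul, map_pow, map_pow, eps_D, zero_pow (by lia)]
  ring

/-- The central subgroup of relations `x³ = xCube`, `y³ = s₃ * t_{n+2}^e`. -/
noncomputable def rel (n e b : ℕ) : Subgroup (Model n) where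
  carrier := {g | ∃ p q : ℤ, g = ⟨3 * p, 3 * q,
    -((p : CycR n) * xCube n b) - (q : CycR n) * ((e : CycR n) * D ^ n), -q⟩}
  one_mem' := ⟨0, 0, by simp [one_def]⟩
  mul_mem' := by
    rintro _ _ ⟨p, q, rfl⟩ ⟨p', q', rfl⟩
    refine ⟨p + p', q + q', ?_⟩
    simp only [mul_def, z_of_dvd (Dvd.intro q' rfl), br_of_dvd (Dvd.intro q rfl), Int.cast_mul,
      three_cast_eq_zero]
    ext
    · dsimp only; ring
    · dsimp only; ring
    · dsimp only; push_cast; ring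
    · dsimp only; push_cast; ring
  inv_mem' := by
    rintro _ ⟨p, q, rfl⟩
    refine ⟨-p, -q, ?_⟩
    have hd : (3 : ℤ) ∣ -(3 * q) := (Dvd.intro q rfl).neg_right
    simp only [inv_def, z_of_dvd hd, br_of_dvd hd, Int.cast_mul, three_cast_eq_zero]
    ext
    · dsimp only; ring
    · dsimp only; ring
    · dsimp only; push_cast; ring
    · dsimp only; push_cast; ring

theorem mem_rel {e b : ℕ} {g : Model n} : g ∈ rel n e b ↔
    ∃ p q : ℤ, g = ⟨3 * p, 3 * q,
      -((p : CycR n) * xCube n b) - (q : CycR n) * ((e : CycR n) * D ^ n), -q⟩ := Iff.rfl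

theorem rel_central {e b : ℕ} (hn : 1 ≤ n) {g : Model n} (hg : g ∈ rel n e b) (h : Model n) :
    g * h = h * g := by
  obtain ⟨p, q, rfl⟩ := hg
  rw [← pcComm_eq_one_iff, pcComm_def]
  have hD : (D : CycR n) * D ^ n = 0 := by rw [← pow_succ', D_pow_eq_zero (by lia)]
  have hb : (z h.j - 1 : CycR n) * D ^ n = 0 := by
    rw [← D_mul_br]; linear_combination br h.j * hD
  have hx : (z h.j - 1 : CycR n) * xCube n b = -(3 * br h.j) := by
    rw [← D_mul_br]; linear_combination br h.j * D_mul_xCube (n := n) b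
  simp only [z_of_dvd (Dvd.intro q rfl), br_of_dvd (Dvd.intro q rfl), Int.cast_mul,
    three_cast_eq_zero, one_def]
  ext
  · rfl
  · rfl
  · dsimp only; push_cast
    linear_combination (-p : CycR n) * hx - (q * e : CycR n) * hb
  · dsimp only
    rw [map_sub, map_neg, map_mul, map_mul, map_mul, eps_xCube hn, map_pow, eps_D,
      zero_pow (by lia)]
    ring

theorem rel_normal {e b : ℕ} (hn : 1 ≤ n) : (rel n e b).Normal :=
  ⟨fun g hg h => by rwa [← rel_central hn hg, mul_inv_cancel_right]⟩

theorem comm_y_x : pcComm (⟨0, 1, 0, 0⟩ : Model n) ⟨1, 0, 0, 0⟩ = ⟨0, 0, 1, 0⟩ := by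
  rw [pcComm_def]
  simp [z_zero, br_zero, br_one]

theorem comm_t_x (r : CycR n) (s : ZMod 3) :
    pcComm (⟨0, 0, r, s⟩ : Model n) ⟨1, 0, 0, 0⟩ = ⟨0, 0, 0, eps r⟩ := by
  rw [pcComm_def]
  simp [z_zero, br_zero]

theorem comm_t_y (r : CycR n) (s : ZMod 3) :
    pcComm (⟨0, 0, r, s⟩ : Model n) ⟨0, 1, 0, 0⟩ = ⟨0, 0, D * r, 0⟩ := by
  rw [pcComm_def]
  simp [z_zero, br_zero, z_one]

/-- The relations of `G(n + 2; e, b)` hold in every image of the model that kills `rel n e b`, with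
`t_j` the image of `D ^ (j - 2)`. The power relation of the `t_j` is the identity
`3 = 2 * D ^ 2 + D ^ 3`. -/
theorem isUTuple {e b : ℕ} (hn : 3 ≤ n) {E : Type*} [Group E] (f : Model n →* E)
    (hf : ∀ g ∈ rel n e b, f g = 1) :
    IsUTuple (n + 2) e b (f ⟨1, 0, 0, 0⟩) (f ⟨0, 1, 0, 0⟩) (f ⟨0, 0, 0, 1⟩)
      (fun j => f ⟨0, 0, D ^ (j - 2), 0⟩) := by
  have hcomm : ∀ r r' s s', (⟨0, 0, r, s⟩ : Model n) * ⟨0, 0, r', s'⟩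
      = ⟨0, 0, r', s'⟩ * ⟨0, 0, r, s⟩ := by
    intro r r' s s'
    rw [mk_mul_mk, mk_mul_mk, add_comm r, add_comm s]
  have h2 : pcComm (⟨0, 0, 1, 0⟩ : Model n) ⟨1, 0, 0, 0⟩ = ⟨0, 0, 0, 1⟩ := by
    rw [comm_t_x, map_one]
  have h4 : ∀ r : CycR n, (⟨0, 0, D * r, 0⟩ : Model n) * ⟨1, 0, 0, 0⟩
      = ⟨1, 0, 0, 0⟩ * ⟨0, 0, D * r, 0⟩ := by
    intro r
    rw [← pcComm_eq_one_iff, pcComm_def]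
    simp [z_zero, br_zero, eps_D, one_def]
  have h6 : (⟨0, 0, 0, 1⟩ : Model n) * ⟨1, 0, 0, 0⟩ = ⟨1, 0, 0, 0⟩ * ⟨0, 0, 0, 1⟩ := by
    rw [← pcComm_eq_one_iff, pcComm_def]
    simp [z_zero, br_zero, one_def]
  have h7 : (⟨0, 0, 0, 1⟩ : Model n) * ⟨0, 1, 0, 0⟩ = ⟨0, 1, 0, 0⟩ * ⟨0, 0, 0, 1⟩ := by
    rw [← pcComm_eq_one_iff, pcComm_def]
    simp [z_zero, br_zero, one_def]
  refine ⟨?_, ?_, ?_, ?_, ?_, ?_, ?_, ?_, ?_, ?_, ?_, ?_, ?_⟩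
  · rw [← map_pcComm, comm_y_x]; simp
  · rw [← map_pcComm, ← h2]; simp
  · intro j hj
    obtain ⟨k, rfl⟩ := Nat.exists_eq_add_of_le' hj
    rw [← map_pcComm, comm_t_y, ← pow_succ', show k + 2 + 1 - 2 = k + 2 - 2 + 1 by lia]
  · intro j hj
    rw [D_pow_eq_zero (by lia)]
    exact map_one f
  · intro j hj
    obtain ⟨k, rfl⟩ := Nat.exists_eq_add_of_le' hj
    simp only [← map_pow, ← map_mul, pow_mk, mk_mul_mk]
    congr 2
    · rw [show k + 2 - 2 = k by lia, show k + 2 + 2 - 2 = k + 2 by lia,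
        show k + 2 + 3 - 2 = k + 3 by lia]
      push_cast
      linear_combination (-(D ^ k) * (D - 1)) * (D_sq : (D ^ 2 : CycR n) = _)
  · rw [← map_pow, pow_mk]
    have : ((3 : ℕ) : ZMod 3) * 1 = 0 := rfl
    rw [mul_zero, this]
    exact map_one f
  · rw [← map_pow, ← map_pow, ← map_mul, pow_mk, mk_mul_mk]
    apply eq_of_mul_inv_eq_one
    rw [← map_inv, ← map_mul]
    apply hf
    refine ⟨0, 1, ?_⟩
    rw [pow_three]
    simp [mul_def, inv_def, z_zero, br_of_dvd]
  · simp only [← map_pow, ← map_mul, pow_mk, mk_mul_mk]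
    apply eq_of_mul_inv_eq_one
    rw [← map_inv, ← map_mul]
    apply hf
    refine ⟨1, 0, ?_⟩
    rw [pow_three]
    simp [mul_def, inv_def, z_zero, br_zero, xCube]
    ring
  · intro j hj
    obtain ⟨k, rfl⟩ := Nat.exists_eq_add_of_le' hj
    rw [← map_mul, ← map_mul, show k + 3 - 2 = k + 1 by lia, pow_succ', h4]
  · rw [← map_mul, h6, map_mul]
  · rw [← map_mul, h7, map_mul]
  · intro j hj
    rw [← map_mul, hcomm, map_mul]
  · intro i j hi hj
    rw [← map_mul, hcomm, map_mul]

end Model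

/-! ### The order of the groups -/

section bound

variable {G : Type*} [Group G]

/-- If conjugation by `g` maps `N` into itself and `g ^ 3 ∈ N`, then `N` together with `g` generates
a subgroup at most three times as large. -/
theorem card_closure_insert_le {N : Subgroup G} {g : G} {m : ℕ}
    (hconj : ∀ h ∈ N, g⁻¹ * h * g ∈ N) (hg : g ^ 3 ∈ N) (hN : Finite N ∧ Nat.card N ≤ m) :
    Finite (Subgroup.closure (insert g (N : Set G))) ∧
      Nat.card (Subgroup.closure (insert g (N : Set G))) ≤ 3 * m := by
  have hmulg : ∀ x, (∃ k : ℕ, ∃ h ∈ N, x = g ^ k * h) → ∃ k : ℕ, ∃ h ∈ N, x * g = g ^ k * h := by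
    rintro _ ⟨k, h, hh, rfl⟩
    exact ⟨k + 1, g⁻¹ * h * g, hconj h hh, by group⟩
  have hmulN : ∀ x, (∃ k : ℕ, ∃ h ∈ N, x = g ^ k * h) → ∀ u ∈ N,
      ∃ k : ℕ, ∃ h ∈ N, x * u = g ^ k * h := by
    rintro _ ⟨k, h, hh, rfl⟩ u hu
    exact ⟨k, h * u, N.mul_mem hh hu, by group⟩
  have hform : ∀ x ∈ Subgroup.closure (insert g (N : Set G)), ∃ k : ℕ, ∃ h ∈ N, x = g ^ k * h := by
    intro x hx
    induction hx using Subgroup.closure_induction_right with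
    | one => exact ⟨0, 1, N.one_mem, by simp⟩
    | mul_right x hx y hy ih =>
      rcases hy with rfl | hy
      · exact hmulg x ih
      · exact hmulN x ih y hy
    | mul_inv_cancel x hx y hy ih =>
      rcases hy with rfl | hy
      · have := hmulN _ (hmulg _ (hmulg _ ih)) _ (N.inv_mem hg)
        have e : x * y * y * (y ^ 3)⁻¹ = x * y⁻¹ := by group
        rwa [e] at this
      · exact hmulN x ih _ (N.inv_mem hy)
  have hform' : ∀ x ∈ Subgroup.closure (insert g (N : Set G)),
      ∃ k : Fin 3, ∃ h : N, x = g ^ (k : ℕ) * h := by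
    intro x hx
    obtain ⟨k, h, hh, rfl⟩ := hform x hx
    refine ⟨⟨k % 3, Nat.mod_lt _ (by norm_num)⟩, ⟨(g ^ 3) ^ (k / 3) * h,
      N.mul_mem (N.pow_mem hg _) hh⟩, ?_⟩
    rw [← mul_assoc, ← pow_mul, ← pow_add, Nat.mod_add_div]
  have := hN.1
  let F : Fin 3 × N → Subgroup.closure (insert g (N : Set G)) := fun p =>
    ⟨g ^ (p.1 : ℕ) * p.2, Subgroup.mul_mem _
      (Subgroup.pow_mem _ (Subgroup.subset_closure (Set.mem_insert _ _)) _)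
      (Subgroup.subset_closure (Set.mem_insert_of_mem _ p.2.2))⟩
  have hF : Function.Surjective F := by
    rintro ⟨x, hx⟩
    obtain ⟨k, h, rfl⟩ := hform' x hx
    exact ⟨(k, h), rfl⟩
  refine ⟨Finite.of_surjective F hF, (Nat.card_le_card_of_surjective F hF).trans ?_⟩
  rw [Nat.card_prod, Nat.card_eq_fintype_card, Fintype.card_fin]
  exact Nat.mul_le_mul_left 3 hN.2

theorem conj_mem_closure {S : Set G} {g : G} (h : ∀ s ∈ S, g⁻¹ * s * g ∈ Subgroup.closure S) :
    ∀ s ∈ Subgroup.closure S, g⁻¹ * s * g ∈ Subgroup.closure S := by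
  have : Subgroup.closure S ≤ (Subgroup.closure S).comap (MulAut.conj g⁻¹).toMonoidHom := by
    rw [Subgroup.closure_le]
    intro s hs
    simpa using h s hs
  intro s hs
  simpa using this hs

variable {c e b : ℕ} {X Y S : G} {t : ℕ → G}

/-- The subgroup generated by `t_{c + 1 - k}, …, t_c`. -/
def tChain (t : ℕ → G) (c : ℕ) : ℕ → Subgroup G
  | 0 => ⊥
  | k + 1 => Subgroup.closure (insert (t (c - k)) (tChain t c k : Set G))

theorem mem_tChain (h : IsUTuple c e b X Y S t) {j k : ℕ} (hj : c < j + k) :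
    t j ∈ tChain t c k := by
  induction k with
  | zero => rw [h.t_gt j (by lia)]; exact Subgroup.one_mem _
  | succ k ih =>
    rcases Nat.lt_or_ge c (j + k) with h' | h'
    · exact Subgroup.subset_closure (Set.mem_insert_of_mem _ (ih h'))
    · obtain rfl : j = c - k := by lia
      exact Subgroup.subset_closure (Set.mem_insert _ _)

theorem tChain_le {k : ℕ} (hk : k < c) {H : Subgroup G} (hH : ∀ j, 2 ≤ j → t j ∈ H) :
    tChain t c k ≤ H := by
  induction k with
  | zero => exact bot_le
  | succ k ih =>
    rw [tChain, Subgroup.closure_le, Set.insert_subset_iff]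
    exact ⟨hH _ (by lia), ih (by lia)⟩

theorem card_tChain_le (h : IsUTuple c e b X Y S t) {k : ℕ} (hk : k < c) :
    Finite (tChain t c k) ∧ Nat.card (tChain t c k) ≤ 3 ^ k := by
  induction k with
  | zero => exact ⟨inferInstanceAs (Finite (⊥ : Subgroup G)), by simp [tChain]⟩
  | succ k ih =>
    rw [pow_succ']
    refine card_closure_insert_le ?_ ?_ (ih (by lia))
    · intro a ha
      have : tChain t c k ≤ Subgroup.centralizer {t (c - k)} :=
        tChain_le (by lia) fun j hj => Subgroup.mem_centralizer_singleton_iff.2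
          (h.t_t _ _ hj (by lia))
      have := Subgroup.mem_centralizer_singleton_iff.1 (this ha)
      rw [mul_assoc, this, inv_mul_cancel_left]
      exact ha
    · rw [h.t_pow _ (by lia)]
      exact Subgroup.mul_mem _ (Subgroup.pow_mem _ (mem_tChain h (by lia)) _)
        (mem_tChain h (by lia))

/-- Each of the generators `t_c, …, t₂, s₃, y, x`, in this order, normalizes the subgroup generated
by its predecessors and has its cube there, so that it contributes a factor of at most `3`. -/
theorem card_closure_le (h : IsUTuple c e b X Y S t) (hc : 5 ≤ c) :
    Finite (Subgroup.closure {X, Y}) ∧ Nat.card (Subgroup.closure {X, Y}) ≤ 3 ^ (c + 2) := by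
  set T := tChain t c (c - 1)
  have hT := card_tChain_le h (k := c - 1) (by lia)
  have htT : ∀ j, 2 ≤ j → t j ∈ T := fun j hj => mem_tChain h (by lia)
  set A := Subgroup.closure (insert S (T : Set G))
  have htA : ∀ j, 2 ≤ j → t j ∈ A :=
    fun j hj => Subgroup.subset_closure (Set.mem_insert_of_mem _ (htT j hj))
  have hSA : S ∈ A := Subgroup.subset_closure (Set.mem_insert _ _)
  have hA : Finite A ∧ Nat.card A ≤ 3 * 3 ^ (c - 1) := by
    refine card_closure_insert_le ?_ ?_ hT
    · intro a ha
      have : T ≤ Subgroup.centralizer {S} := tChain_le (by lia)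
        fun j hj => Subgroup.mem_centralizer_singleton_iff.2 (h.t_s _ hj)
      have := Subgroup.mem_centralizer_singleton_iff.1 (this ha)
      rw [mul_assoc, this, inv_mul_cancel_left]
      exact ha
    · rw [h.s_pow]; exact Subgroup.one_mem _
  have hconj : ∀ g : G, g⁻¹ * S * g ∈ A → (∀ j, 2 ≤ j → g⁻¹ * t j * g ∈ A) →
      ∀ a ∈ A, g⁻¹ * a * g ∈ A := by
    intro g hS ht
    refine conj_mem_closure ?_
    rintro s (rfl | hs)
    · exact hS
    · have : T ≤ A.comap (MulAut.conj g⁻¹).toMonoidHom := tChain_le (by lia)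
        fun j hj => by simpa using ht j hj
      simpa using this hs
  have hXA : ∀ a ∈ A, X⁻¹ * a * X ∈ A := by
    refine hconj X ?_ ?_
    · rwa [mul_assoc, h.s_x, inv_mul_cancel_left]
    · intro j hj
      rcases hj.eq_or_lt with rfl | hj
      · have := h.s_eq
        rw [eq_comm, pcComm_eq_iff] at this
        rw [mul_assoc, this, mul_assoc, inv_mul_cancel_left]
        exact A.mul_mem (htA 2 le_rfl) hSA
      · rw [mul_assoc, h.t_x j hj, inv_mul_cancel_left]
        exact htA j (by lia)
  have hYA : ∀ a ∈ A, Y⁻¹ * a * Y ∈ A := by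
    refine hconj Y ?_ ?_
    · rwa [mul_assoc, h.s_y, inv_mul_cancel_left]
    · intro j hj
      have := h.t_succ j hj
      rw [eq_comm, pcComm_eq_iff] at this
      rw [mul_assoc, this, mul_assoc, inv_mul_cancel_left]
      exact A.mul_mem (htA j hj) (htA _ (by lia))
  set B := Subgroup.closure (insert Y (A : Set G))
  have hAB : A ≤ B := fun a ha => Subgroup.subset_closure (Set.mem_insert_of_mem _ ha)
  have hYB : Y ∈ B := Subgroup.subset_closure (Set.mem_insert _ _)
  have hB : Finite B ∧ Nat.card B ≤ 3 * (3 * 3 ^ (c - 1)) := by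
    refine card_closure_insert_le hYA ?_ hA
    rw [h.y_pow]
    exact A.mul_mem hSA (A.pow_mem (htA c (by lia)) _)
  have hC := card_closure_insert_le (g := X) (N := B) ?_ ?_ hB
  · set C := Subgroup.closure (insert X (B : Set G))
    have hle : Subgroup.closure {X, Y} ≤ C := by
      rw [Subgroup.closure_le]
      rintro _ (rfl | rfl)
      · exact Subgroup.subset_closure (Set.mem_insert _ _)
      · exact Subgroup.subset_closure (Set.mem_insert_of_mem _ hYB)
    have := hC.1
    refine ⟨Finite.of_injective _ (Subgroup.inclusion_injective hle),
      (Nat.card_le_card_of_injective _ (Subgroup.inclusion_injective hle)).trans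
      (hC.2.trans_eq ?_)⟩
    rw [show c + 2 = c - 1 + 1 + 1 + 1 by lia, pow_succ', pow_succ', pow_succ']
  · refine conj_mem_closure ?_
    rintro s (rfl | hs)
    · have := h.t_two
      rw [eq_comm, pcComm_eq_iff] at this
      rw [mul_assoc, this, mul_assoc, inv_mul_cancel_left]
      exact B.mul_mem hYB (hAB (htA 2 le_rfl))
    · exact hAB (hXA s hs)
  · rw [h.x_pow]
    exact hAB (A.mul_mem (A.mul_mem (A.mul_mem (htA 3 (by lia)) (A.pow_mem (htA 4 (by lia)) _))
      (htA 5 (by lia))) (A.pow_mem (htA c (by lia)) _))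

end bound

namespace Model

variable {n : ℕ}

open CycR

theorem mk_mem_rel_iff {e b : ℕ} {r : CycR n} {s : ZMod 3} :
    (⟨0, 0, r, s⟩ : Model n) ∈ rel n e b ↔ r = 0 ∧ s = 0 := by
  rw [mem_rel]
  constructor
  · rintro ⟨p, q, h⟩
    rw [Model.mk.injEq] at h
    obtain ⟨hp, hq, hr, hs⟩ := h
    obtain rfl : p = 0 := by lia
    obtain rfl : q = 0 := by lia
    simp at hr hs
    exact ⟨hr, hs⟩
  · rintro ⟨rfl, rfl⟩
    exact ⟨0, 0, by simp⟩

theorem mk_zpow (r : CycR n) (s : ZMod 3) (k : ℤ) :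
    (⟨0, 0, r, s⟩ : Model n) ^ k = ⟨0, 0, (k : CycR n) * r, (k : ZMod 3) * s⟩ := by
  change ofPair (Multiplicative.ofAdd (r, s)) ^ k = _
  rw [← map_zpow, ← ofAdd_zsmul]
  simp [ofPair]

theorem x_zpow (k : ℤ) : (⟨1, 0, 0, 0⟩ : Model n) ^ k = ⟨k, 0, 0, 0⟩ := by
  let f : Multiplicative ℤ →* Model n :=
    { toFun := fun k => ⟨k.toAdd, 0, 0, 0⟩
      map_one' := rfl
      map_mul' := by intro k l; simp [mul_def, br_zero] }
  change f (Multiplicative.ofAdd 1) ^ k = f (Multiplicative.ofAdd k)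
  rw [← map_zpow, ← ofAdd_zsmul]
  simp

theorem y_zpow (k : ℤ) : (⟨0, 1, 0, 0⟩ : Model n) ^ k = ⟨0, k, 0, 0⟩ := by
  let f : Multiplicative ℤ →* Model n :=
    { toFun := fun k => ⟨0, k.toAdd, 0, 0⟩
      map_one' := rfl
      map_mul' := by intro k l; simp [mul_def] }
  change f (Multiplicative.ofAdd 1) ^ k = f (Multiplicative.ofAdd k)
  rw [← map_zpow, ← ofAdd_zsmul]
  simp

theorem eq_mul (g : Model n) :
    g = ⟨1, 0, 0, 0⟩ ^ g.i * ⟨0, 1, 0, 0⟩ ^ g.j * ⟨0, 0, g.t, g.s⟩ := by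
  rw [x_zpow, y_zpow]
  simp [mul_def, z_zero, br_zero]

theorem pcComm_mem {G : Type*} [Group G] {K : Subgroup G} {u v : G} (hu : u ∈ K) (hv : v ∈ K) :
    pcComm u v ∈ K :=
  K.mul_mem (K.mul_mem (K.mul_mem (K.inv_mem hu) (K.inv_mem hv)) hu) hv

theorem mk_mem_of_mem {K : Subgroup (Model n)} (h1 : ⟨0, 0, 1, 0⟩ ∈ K) (h2 : ⟨0, 0, D, 0⟩ ∈ K)
    (h3 : ⟨0, 0, 0, 1⟩ ∈ K) (r : CycR n) (s : ZMod 3) : (⟨0, 0, r, s⟩ : Model n) ∈ K := by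
  obtain ⟨u, v, rfl⟩ := exists_eq_int r
  have := K.mul_mem (K.mul_mem (K.zpow_mem h1 u) (K.zpow_mem h2 v)) (K.pow_mem h3 s.val)
  simpa [mk_zpow, pow_mk, mk_mul_mk] using this

theorem eq_top_of_mem {K : Subgroup (Model n)} (hx : ⟨1, 0, 0, 0⟩ ∈ K) (hy : ⟨0, 1, 0, 0⟩ ∈ K) :
    K = ⊤ := by
  have h1 : (⟨0, 0, 1, 0⟩ : Model n) ∈ K := by rw [← comm_y_x]; exact pcComm_mem hy hx
  have h2 : (⟨0, 0, D, 0⟩ : Model n) ∈ K := by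
    rw [← mul_one D, ← comm_t_y 1 0]; exact pcComm_mem h1 hy
  have h3 : (⟨0, 0, 0, 1⟩ : Model n) ∈ K := by
    rw [← map_one eps, ← comm_t_x 1 0]; exact pcComm_mem h1 hx
  rw [eq_top_iff]
  intro g _
  rw [eq_mul g]
  exact K.mul_mem (K.mul_mem (K.zpow_mem hx _) (K.zpow_mem hy _)) (mk_mem_of_mem h1 h2 h3 _ _)

/-- Quadruples whose first two exponents are reduced modulo `3` lie in different cosets. -/
theorem card_le_index {e b : ℕ} [Finite (Model n ⧸ rel n e b)] :
    3 ^ (n + 4) ≤ Nat.card (Model n ⧸ rel n e b) := by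
  let F : Fin 3 × Fin 3 × CycR n × ZMod 3 → Model n ⧸ rel n e b :=
    fun p => ((⟨(p.1 : ℕ), (p.2.1 : ℕ), p.2.2.1, p.2.2.2⟩ : Model n) : Model n ⧸ rel n e b)
  have hF : Function.Injective F := by
    rintro ⟨i, j, r, s⟩ ⟨i', j', r', s'⟩ h
    have h1 : (⟨(i : ℕ), (j : ℕ), r, s⟩ : Model n)⁻¹ * ⟨(i' : ℕ), (j' : ℕ), r', s'⟩ ∈ rel n e b :=
      QuotientGroup.eq.1 h
    obtain ⟨p, q, h2⟩ := mem_rel.1 h1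
    have hp := congrArg Model.i h2
    have hq := congrArg Model.j h2
    simp only [mul_def, inv_def] at hp hq
    obtain rfl : i = i' := Fin.ext (by have := i.2; have := i'.2; omega)
    obtain rfl : j = j' := Fin.ext (by have := j.2; have := j'.2; omega)
    rw [inv_mul_eq_iff_eq_mul, mul_def] at h2
    obtain rfl : p = 0 := by lia
    obtain rfl : q = 0 := by lia
    rw [Model.mk.injEq] at h2
    simp [z_zero] at h2
    rw [h2.1, h2.2]
  refine le_trans (le_of_eq ?_) (Nat.card_le_card_of_injective F hF)
  rw [Nat.card_prod, Nat.card_prod, Nat.card_prod, CycR.card_eq]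
  simp only [Nat.card_eq_fintype_card, Fintype.card_fin, ZMod.card]
  ring

end Model

namespace UGroup

open CycR

variable {n e b : ℕ}

/-- The coordinates of `G(n + 2; e, b)`: the homomorphism from the model that induces an isomorphism
modulo the relations for `x³` and `y³`. The homomorphism from `G(n + 2; e, b)` to the quotient of
the model is onto, and bijective by the bounds `card_closure_le` and `card_le_index`. -/
theorem exists_coord (hn : 3 ≤ n) (e b : ℕ) : ∃ f : Model n →* UGroup (n + 2) e b,
    Function.Surjective f ∧ f.ker = Model.rel n e b ∧ f ⟨1, 0, 0, 0⟩ = X (n + 2) e b ∧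
    f ⟨0, 1, 0, 0⟩ = Y (n + 2) e b ∧ f ⟨0, 0, 0, 1⟩ = S (n + 2) e b ∧
    (∀ j, 2 ≤ j → f ⟨0, 0, D ^ (j - 2), 0⟩ = t (n + 2) e b j) ∧
    Finite (UGroup (n + 2) e b) ∧ Nat.card (UGroup (n + 2) e b) = 3 ^ (n + 4) := by
  have hc : 5 ≤ n + 2 := by lia
  have := Model.rel_normal (n := n) (e := e) (b := b) (by lia)
  have hQ := Model.isUTuple (n := n) (e := e) (b := b) hn (QuotientGroup.mk' (Model.rel n e b))
    (fun g hg => (QuotientGroup.eq_one_iff g).2 hg)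
  have hcard := card_closure_le (isUTuple (e := e) (b := b) hc) hc
  rw [closure_gens_eq_top hc, Subgroup.card_top] at hcard
  have hfin : Finite (UGroup (n + 2) e b) := by
    have := hcard.1
    exact Finite.of_equiv _ Subgroup.topEquiv.toEquiv
  set φ := lift hc hQ with hφ
  have hsurj : Function.Surjective φ := by
    have htop : φ.range.comap (QuotientGroup.mk' (Model.rel n e b)) = ⊤ :=
      Model.eq_top_of_mem ⟨_, lift_X hc hQ⟩ ⟨_, lift_Y hc hQ⟩
    intro q
    obtain ⟨g, rfl⟩ := QuotientGroup.mk'_surjective _ q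
    have : g ∈ φ.range.comap (QuotientGroup.mk' (Model.rel n e b)) := htop ▸ Subgroup.mem_top g
    exact this
  have hQfin : Finite (Model n ⧸ Model.rel n e b) := Finite.of_surjective _ hsurj
  have hle := Model.card_le_index (n := n) (e := e) (b := b)
  have hle' := Nat.card_le_card_of_surjective _ hsurj
  have hcardeq : Nat.card (UGroup (n + 2) e b) = 3 ^ (n + 4) := by
    have := hcard.2
    rw [show n + 2 + 2 = n + 4 by lia] at this
    lia
  have hbij : Function.Bijective φ := by
    refine (Nat.bijective_iff_surjective_and_card φ).2 ⟨hsurj, ?_⟩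
    have := hcard.2
    rw [show n + 2 + 2 = n + 4 by lia] at this
    lia
  let ψ := (MulEquiv.ofBijective φ hbij).symm
  have hψ : ∀ u, ψ (φ u) = u := fun u => (MulEquiv.ofBijective φ hbij).symm_apply_apply u
  refine ⟨ψ.toMonoidHom.comp (QuotientGroup.mk' (Model.rel n e b)), ?_, ?_, ?_, ?_, ?_, ?_, hfin,
    hcardeq⟩
  · exact ψ.surjective.comp (QuotientGroup.mk'_surjective _)
  · ext g
    rw [MonoidHom.mem_ker, ← QuotientGroup.eq_one_iff]
    exact map_eq_one_iff ψ ψ.injective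
  · rw [← hψ (X _ _ _), hφ, lift_X]; rfl
  · rw [← hψ (Y _ _ _), hφ, lift_Y]; rfl
  · rw [← hψ (S _ _ _), hφ, lift_S]; rfl
  · intro j hj
    rw [← hψ (t _ _ _ j), hφ, lift_t hc hQ hj]; rfl

end UGroup

/-! ### Coordinates and central series -/

open scoped commutatorElement

theorem pcComm_eq_commutatorElement {G : Type*} [Group G] (a b : G) : pcComm a b = ⁅a⁻¹, b⁻¹⁆ := by
  simp [pcComm, commutatorElement_def]

theorem commutatorElement_eq_pcComm {G : Type*} [Group G] (a b : G) : ⁅a, b⁆ = pcComm a⁻¹ b⁻¹ := by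
  simp [pcComm, commutatorElement_def]

theorem pcComm_mem_lowerCentralSeries {G : Type*} [Group G] {k : ℕ} {a : G}
    (ha : a ∈ (⊤ : Subgroup G).lowerCentralSeries k) (b : G) :
    pcComm a b ∈ (⊤ : Subgroup G).lowerCentralSeries (k + 1) := by
  rw [pcComm_eq_commutatorElement]
  exact Subgroup.commutator_mem_commutator (Subgroup.inv_mem _ ha) (Subgroup.mem_top _)

theorem IsUTuple.t_mem_lowerCentralSeries {G : Type*} [Group G] {c e b : ℕ} {X Y S : G} {t : ℕ → G}
    (h : IsUTuple c e b X Y S t) (k : ℕ) :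
    t (k + 2) ∈ (⊤ : Subgroup G).lowerCentralSeries (k + 1) := by
  induction k with
  | zero => rw [h.t_two]; exact pcComm_mem_lowerCentralSeries (k := 0) (Subgroup.mem_top _) _
  | succ k ih => rw [h.t_succ _ (by lia)]; exact pcComm_mem_lowerCentralSeries ih _

theorem IsUTuple.s_mem_lowerCentralSeries {G : Type*} [Group G] {c e b : ℕ} {X Y S : G} {t : ℕ → G}
    (h : IsUTuple c e b X Y S t) : S ∈ (⊤ : Subgroup G).lowerCentralSeries 2 := by
  rw [h.s_eq]; exact pcComm_mem_lowerCentralSeries (h.t_mem_lowerCentralSeries 0) _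

theorem lowerCentralSeries_le_lowerPCentralSeries (p : ℕ) (G : Type*) [Group G] (k : ℕ) :
    (⊤ : Subgroup G).lowerCentralSeries k ≤ lowerPCentralSeries p G k := by
  induction k with
  | zero => exact le_rfl
  | succ k ih =>
    rw [Subgroup.lowerCentralSeries_succ, Subgroup.commutator_le]
    intro a ha b _
    rw [commutatorElement_eq_pcComm]
    exact Subgroup.subset_normalClosure (Or.inl ⟨_, Subgroup.inv_mem _ (ih ha), _, rfl⟩)

/-- A pair of mutually inverse homomorphisms between a quotient and a group. -/
theorem nonempty_quotient_mulEquiv {G H : Type*} [Group G] [Group H] (N : Subgroup G) [N.Normal]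
    (f : G →* H) (g : H →* G ⧸ N) (hN : N ≤ f.ker) (h1 : g.comp f = QuotientGroup.mk' N)
    (h2 : (QuotientGroup.lift N f hN).comp g = MonoidHom.id H) : Nonempty (G ⧸ N ≃* H) := by
  refine ⟨MonoidHom.toMulEquiv (QuotientGroup.lift N f hN) g ?_ h2⟩
  refine QuotientGroup.monoidHom_ext _ ?_
  exact h1

namespace Model

variable {n : ℕ}

open CycR

/-- The subgroup generated by `t_{k + 2}, t_{k + 3}, …` and, for `I = ⊤`, by `s₃`. -/
noncomputable def layer (n k : ℕ) (I : AddSubgroup (ZMod 3)) : Subgroup (Model n) where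
  carrier := {g | g.i = 0 ∧ g.j = 0 ∧ (∃ r, g.t = D ^ k * r) ∧ g.s ∈ I}
  one_mem' := ⟨rfl, rfl, ⟨0, by rw [mul_zero]; rfl⟩, I.zero_mem⟩
  mul_mem' := by
    rintro ⟨_, _, _, s⟩ ⟨_, _, _, s'⟩ ⟨rfl, rfl, ⟨r, rfl⟩, hs⟩ ⟨rfl, rfl, ⟨r', rfl⟩, hs'⟩
    rw [mk_mul_mk]
    exact ⟨rfl, rfl, ⟨r + r', by rw [mul_add]⟩, I.add_mem hs hs'⟩
  inv_mem' := by
    rintro ⟨_, _, _, s⟩ ⟨rfl, rfl, ⟨r, rfl⟩, hs⟩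
    have : (⟨0, 0, D ^ k * r, s⟩ : Model n)⁻¹ = ⟨0, 0, D ^ k * -r, -s⟩ := by
      rw [inv_eq_iff_mul_eq_one, mk_mul_mk, one_def]; simp
    rw [this]
    exact ⟨rfl, rfl, ⟨-r, rfl⟩, I.neg_mem hs⟩

theorem pcComm_mem_layer_zero (g h : Model n) : pcComm g h ∈ layer n 0 ⊤ := by
  rw [pcComm_def]
  exact ⟨rfl, rfl, ⟨_, by rw [pow_zero, one_mul]⟩, trivial⟩

theorem comm_mk (r : CycR n) (s : ZMod 3) (h : Model n) :
    pcComm (⟨0, 0, r, s⟩ : Model n) h = ⟨0, 0, D * br h.j * r, h.i * eps r⟩ := by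
  rw [pcComm_def, D_mul_br]
  simp [z_zero, br_zero]

theorem pcComm_mem_layer_one {g : Model n} (hg : g ∈ layer n 0 ⊤) (h : Model n) :
    pcComm g h ∈ layer n 1 ⊤ := by
  obtain ⟨i, j, r, s⟩ := g
  obtain ⟨rfl, rfl, -⟩ := hg
  rw [comm_mk]
  exact ⟨rfl, rfl, ⟨_, by rw [pow_one, mul_assoc]⟩, trivial⟩

theorem pcComm_mem_layer_succ {g : Model n} {k : ℕ} (hk : 1 ≤ k) {I : AddSubgroup (ZMod 3)}
    (hg : g ∈ layer n k I) (h : Model n) : pcComm g h ∈ layer n (k + 1) ⊥ := by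
  obtain ⟨i, j, r, s⟩ := g
  obtain ⟨rfl, rfl, ⟨r, rfl⟩, -⟩ := hg
  rw [comm_mk, map_mul, map_pow, eps_D, zero_pow (by lia)]
  exact ⟨rfl, rfl, ⟨br h.j * r, by ring⟩, by simp⟩

theorem comm_mk_mk (r r' : CycR n) (s s' : ZMod 3) :
    pcComm (⟨0, 0, r, s⟩ : Model n) ⟨0, 0, r', s'⟩ = 1 := by
  rw [comm_mk]
  simp [br_zero, one_def]

theorem pow_three_mem_layer {g : Model n} {k : ℕ} {I : AddSubgroup (ZMod 3)}
    (hg : g ∈ layer n k I) : g ^ 3 ∈ layer n (k + 1) ⊥ := by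
  obtain ⟨i, j, r, s⟩ := g
  obtain ⟨rfl, rfl, ⟨r, rfl⟩, -⟩ := hg
  rw [pow_mk]
  refine ⟨rfl, rfl, ⟨-(D * (1 + D) ^ 2) * r, ?_⟩, ?_⟩
  · dsimp only; push_cast
    linear_combination (D ^ k * r * (D ^ 2 - D + 1)) * (D_sq : (D ^ 2 : CycR n) = _)
  · exact congrArg (· * s) three_eq_zero |>.trans (zero_mul s)

end Model

namespace UGroup

open CycR Model

variable {n : ℕ}

/-- A choice of coordinates on `G(n + 2; e, b)`. -/
noncomputable def coord (hn : 3 ≤ n) (e b : ℕ) : Model n →* UGroup (n + 2) e b :=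
  (exists_coord hn e b).choose

variable (hn : 3 ≤ n) (e b : ℕ)

theorem coord_surjective : Function.Surjective (coord hn e b) :=
  (exists_coord hn e b).choose_spec.1

theorem coord_ker : (coord hn e b).ker = rel n e b := (exists_coord hn e b).choose_spec.2.1

theorem coord_x : coord hn e b ⟨1, 0, 0, 0⟩ = X (n + 2) e b :=
  (exists_coord hn e b).choose_spec.2.2.1

theorem coord_y : coord hn e b ⟨0, 1, 0, 0⟩ = Y (n + 2) e b :=
  (exists_coord hn e b).choose_spec.2.2.2.1

theorem coord_s : coord hn e b ⟨0, 0, 0, 1⟩ = S (n + 2) e b :=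
  (exists_coord hn e b).choose_spec.2.2.2.2.1

theorem coord_t {j : ℕ} (hj : 2 ≤ j) :
    coord hn e b ⟨0, 0, D ^ (j - 2), 0⟩ = t (n + 2) e b j :=
  (exists_coord hn e b).choose_spec.2.2.2.2.2.1 j hj

theorem finite (hn : 3 ≤ n) (e b : ℕ) : Finite (UGroup (n + 2) e b) :=
  (exists_coord hn e b).choose_spec.2.2.2.2.2.2.1

theorem card_eq (hn : 3 ≤ n) (e b : ℕ) : Nat.card (UGroup (n + 2) e b) = 3 ^ (n + 4) :=
  (exists_coord hn e b).choose_spec.2.2.2.2.2.2.2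

theorem coord_mk_eq_one_iff {r : CycR n} {s : ZMod 3} :
    coord hn e b ⟨0, 0, r, s⟩ = 1 ↔ r = 0 ∧ s = 0 := by
  rw [← MonoidHom.mem_ker, coord_ker, mk_mem_rel_iff]

theorem coord_mk_inj {r r' : CycR n} {s s' : ZMod 3}
    (h : coord hn e b ⟨0, 0, r, s⟩ = coord hn e b ⟨0, 0, r', s'⟩) : r = r' ∧ s = s' := by
  have : (⟨0, 0, r, s⟩ : Model n) = ⟨0, 0, r - r', s - s'⟩ * ⟨0, 0, r', s'⟩ := by
    rw [mk_mul_mk, sub_add_cancel, sub_add_cancel]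
  rw [this, map_mul, mul_eq_right, coord_mk_eq_one_iff, sub_eq_zero, sub_eq_zero] at h
  exact h

theorem commutator_map_le {K K' : Subgroup (Model n)} (h : ∀ g ∈ K, ∀ u, pcComm g u ∈ K') :
    ⁅K.map (coord hn e b), ⊤⁆ ≤ K'.map (coord hn e b) := by
  rw [Subgroup.commutator_le]
  rintro _ ⟨g, hg, rfl⟩ v -
  obtain ⟨u, rfl⟩ := coord_surjective hn e b v
  rw [commutatorElement_eq_pcComm, ← map_inv, ← map_inv, ← map_pcComm]
  exact Subgroup.mem_map_of_mem _ (h _ (K.inv_mem hg) _)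

theorem map_top_coord : (⊤ : Subgroup (Model n)).map (coord hn e b) = ⊤ :=
  Subgroup.map_top_of_surjective _ (coord_surjective hn e b)

theorem commutator_le_map : ⁅(⊤ : Subgroup (UGroup (n + 2) e b)), ⊤⁆
    ≤ (layer n 0 ⊤).map (coord hn e b) := by
  have := commutator_map_le hn e b fun g (_ : g ∈ ⊤) u => pcComm_mem_layer_zero g u
  rwa [map_top_coord] at this

theorem lowerCentralSeries_le_map {k : ℕ} (hk : 2 ≤ k) :
    (⊤ : Subgroup (UGroup (n + 2) e b)).lowerCentralSeries (k + 1)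
      ≤ (layer n k ⊥).map (coord hn e b) := by
  induction k, hk using Nat.le_induction with
  | base =>
    have h1 : (⊤ : Subgroup (UGroup (n + 2) e b)).lowerCentralSeries 1 ≤ _ :=
      commutator_le_map hn e b
    have h2 : (⊤ : Subgroup (UGroup (n + 2) e b)).lowerCentralSeries 2 ≤ _ :=
      (Subgroup.commutator_mono h1 le_rfl).trans
        (commutator_map_le hn e b fun g hg u => pcComm_mem_layer_one hg u)
    exact (Subgroup.commutator_mono h2 le_rfl).trans
      (commutator_map_le hn e b fun g hg u => pcComm_mem_layer_succ le_rfl hg u)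
  | succ k hk ih =>
    exact (Subgroup.commutator_mono ih le_rfl).trans
      (commutator_map_le hn e b fun g hg u => pcComm_mem_layer_succ (by lia) hg u)

theorem normal_map_layer {k : ℕ} {I : AddSubgroup (ZMod 3)} {K : Subgroup (Model n)}
    (hK : K ≤ layer n k I) (h : ∀ g ∈ layer n k I, ∀ u, pcComm g u ∈ K) :
    ((layer n k I).map (coord hn e b)).Normal := by
  have : (layer n k I).Normal := by
    refine ⟨fun g hg u => ?_⟩
    have : u * g * u⁻¹ = g * pcComm g u⁻¹ := by simp [pcComm, mul_assoc]
    rw [this]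
    exact Subgroup.mul_mem _ hg (hK (h g hg _))
  exact this.map _ (coord_surjective hn e b)

theorem layer_mono {k l : ℕ} (h : k ≤ l) {I J : AddSubgroup (ZMod 3)} (hIJ : I ≤ J) :
    layer n l I ≤ layer n k J := by
  rintro g ⟨h1, h2, ⟨r, h3⟩, h4⟩
  exact ⟨h1, h2, ⟨D ^ (l - k) * r, by rw [h3, ← mul_assoc, ← pow_add, Nat.add_sub_cancel' h]⟩,
    hIJ h4⟩

theorem lowerPCentralSeries_succ_le {m : ℕ} {K K' : Subgroup (Model n)}
    (h : lowerPCentralSeries 3 (UGroup (n + 2) e b) m ≤ K.map (coord hn e b))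
    (hK' : (K'.map (coord hn e b)).Normal) (h1 : ∀ g ∈ K, ∀ u, pcComm g u ∈ K')
    (h2 : ∀ g ∈ K, (coord hn e b g) ^ 3 ∈ K'.map (coord hn e b)) :
    lowerPCentralSeries 3 (UGroup (n + 2) e b) (m + 1) ≤ K'.map (coord hn e b) := by
  refine Subgroup.normalClosure_le_normal ?_
  rintro _ (⟨g, hg, v, rfl⟩ | ⟨g, hg, rfl⟩)
  · obtain ⟨g, hg', rfl⟩ := h hg
    obtain ⟨u, rfl⟩ := coord_surjective hn e b v
    rw [← map_pcComm]
    exact Subgroup.mem_map_of_mem _ (h1 g hg' u)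
  · obtain ⟨g, hg', rfl⟩ := h hg
    exact h2 g hg'

/-- Modulo the relations for `x³` and `y³`, a cube lies in the derived subgroup. -/
theorem coord_pow_three (g : Model n) : coord hn e b g ^ 3 = coord hn e b ⟨0, 0,
    z g.j * ((g.i : CycR n) * br (2 * g.j)) + z (2 * g.j) * ((g.i : CycR n) * br g.j)
      + (1 + z g.j + z (2 * g.j)) * g.t
      + ((g.i : CycR n) * xCube n b + (g.j : CycR n) * ((e : CycR n) * D ^ n)),
    g.i * g.i * g.j + g.j⟩ := by
  have hmem : (⟨3 * g.i, 3 * g.j, -((g.i : CycR n) * xCube n b)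
      - (g.j : CycR n) * ((e : CycR n) * D ^ n), -g.j⟩ : Model n) ∈ (coord hn e b).ker := by
    rw [coord_ker]; exact ⟨g.i, g.j, rfl⟩
  rw [← map_pow]
  conv_rhs => rw [← one_mul (coord hn e b _), ← MonoidHom.mem_ker.1 hmem, ← map_mul]
  congr 1
  rw [pow_three, mul_def]
  ext
  · simp
  · simp
  · dsimp only; rw [z_zero]; ring
  · dsimp only; push_cast; ring

end UGroup

namespace UGroup

open CycR Model

variable {n : ℕ}

theorem lowerCentralSeries_eq_bot (hn : 3 ≤ n) (e b : ℕ) :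
    (⊤ : Subgroup (UGroup (n + 2) e b)).lowerCentralSeries (n + 2) = ⊥ := by
  rw [eq_bot_iff]
  refine (lowerCentralSeries_le_map hn e b (k := n + 1) (by lia)).trans ?_
  rintro _ ⟨⟨i, j, r, s⟩, ⟨rfl, rfl, ⟨r, rfl⟩, hs⟩, rfl⟩
  have hs' : s = 0 := hs
  rw [Subgroup.mem_bot, coord_mk_eq_one_iff, D_pow_eq_zero (by lia), zero_mul]
  exact ⟨rfl, hs'⟩

theorem isNilpotent (hn : 3 ≤ n) (e b : ℕ) : Group.IsNilpotent (UGroup (n + 2) e b) :=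
  Subgroup.nilpotent_iff_lowerCentralSeries.2 ⟨_, lowerCentralSeries_eq_bot hn e b⟩

theorem t_last_ne_one (hn : 3 ≤ n) (e b : ℕ) : t (n + 2) e b (n + 2) ≠ 1 := by
  rw [← coord_t hn e b (by lia), Ne, coord_mk_eq_one_iff]
  exact fun h => D_pow_ne_zero h.1

theorem nilpotencyClass_eq (hn : 3 ≤ n) (e b : ℕ) :
    Group.nilpotencyClass (UGroup (n + 2) e b) = n + 2 := by
  have := isNilpotent hn e b
  apply le_antisymm
  · exact Subgroup.lowerCentralSeries_eq_bot_iff_nilpotencyClass_le.1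
      (lowerCentralSeries_eq_bot hn e b)
  · by_contra! h
    have h1 := (Subgroup.lowerCentralSeries_eq_bot_iff_nilpotencyClass_le
      (G := UGroup (n + 2) e b) (n := n + 1)).2 (by lia)
    have h2 := (isUTuple (e := e) (b := b) (show 5 ≤ n + 2 by lia)).t_mem_lowerCentralSeries n
    rw [h1, Subgroup.mem_bot] at h2
    exact t_last_ne_one hn e b h2

theorem isMetabelian (hn : 3 ≤ n) (e b : ℕ) : IsMetabelianGroup (UGroup (n + 2) e b) := by
  have h1 : derivedSeries (UGroup (n + 2) e b) 1 ≤ (layer n 0 ⊤).map (coord hn e b) :=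
    commutator_le_map hn e b
  constructor
  · rw [eq_bot_iff]
    refine (Subgroup.commutator_mono h1 h1).trans ?_
    rw [Subgroup.commutator_le]
    rintro _ ⟨⟨i, j, r, s⟩, ⟨rfl, rfl, -⟩, rfl⟩ _ ⟨⟨i, j, r', s'⟩, ⟨rfl, rfl, -⟩, rfl⟩
    rw [← map_commutatorElement, commutatorElement_eq_one_iff_mul_comm.2, map_one]
    · exact Subgroup.one_mem _
    · rw [mk_mul_mk, mk_mul_mk, add_comm r, add_comm s]
  · intro h
    have h2 := (isUTuple (e := e) (b := b) (show 5 ≤ n + 2 by lia)).t_mem_lowerCentralSeries n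
    have h3 : t (n + 2) e b (n + 2) ∈ derivedSeries (UGroup (n + 2) e b) 1 :=
      Subgroup.lowerCentralSeries_antitone _ (show 1 ≤ n + 1 by lia) h2
    rw [h, Subgroup.mem_bot] at h3
    exact t_last_ne_one hn e b h3

end UGroup

/-! ### The root and the mainline -/

namespace SmallGroup243_8

/-- The image of a generator. -/
def gen (g : RootGen) : SmallGroup243_8 := PresentedGroup.of g

theorem mk_eq_one {r : FreeGroup RootGen} (h : RootRelator r) :
    PresentedGroup.mk {r | RootRelator r} r = 1 :=
  PresentedGroup.one_of_mem h

theorem comm_s₃ (g : RootGen) : gen .s₃ * gen g = gen g * gen .s₃ := by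
  have := mk_eq_one (.comm_s₃ g)
  rw [map_pcComm, pcComm_eq_one_iff] at this
  exact this

theorem comm_t₃ (g : RootGen) : gen .t₃ * gen g = gen g * gen .t₃ := by
  have := mk_eq_one (.comm_t₃ g)
  rw [map_pcComm, pcComm_eq_one_iff] at this
  exact this

/-- The generators, extended by `t j = 1` for `j > 3`. -/
def t : ℕ → SmallGroup243_8
  | 2 => gen .t₂
  | 3 => gen .t₃
  | _ => 1

theorem t_of_gt {j : ℕ} (h : 3 < j) : t j = 1 := by
  obtain ⟨k, rfl⟩ := Nat.exists_eq_add_of_lt h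
  rw [show 3 + k + 1 = k + 4 by lia]
  rfl

theorem isUTuple {c : ℕ} (hc : 5 ≤ c) (e b : ℕ) :
    IsUTuple c e b (gen .x) (gen .y) (gen .s₃) t := by
  have hpow {g : RootGen} (h : RootRelator (FreeGroup.of g ^ 3)) : gen g ^ 3 = 1 := by
    have := mk_eq_one h
    rw [map_pow] at this
    exact this
  have hcases : ∀ {j : ℕ}, 2 ≤ j → j = 2 ∨ j = 3 ∨ 3 < j := by lia
  refine ⟨?_, ?_, ?_, fun j hj => t_of_gt (by lia), ?_, hpow .pow_s₃, ?_, ?_, ?_,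
    comm_s₃ _, comm_s₃ _, ?_, ?_⟩
  · have := mk_eq_one .def_t₂
    rw [map_mul, map_inv, inv_mul_eq_one, map_pcComm] at this
    exact this
  · have := mk_eq_one .def_s₃
    rw [map_mul, map_inv, inv_mul_eq_one, map_pcComm] at this
    exact this
  · intro j hj
    rcases hcases hj with rfl | rfl | hj
    · have := mk_eq_one .def_t₃
      rw [map_mul, map_inv, inv_mul_eq_one, map_pcComm] at this
      exact this
    · rw [t_of_gt (by lia), eq_comm, pcComm_eq_one_iff]
      exact comm_t₃ .y
    · rw [t_of_gt (by lia), t_of_gt hj, eq_comm, pcComm_eq_one_iff, one_mul, mul_one]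
  · intro j hj
    rw [t_of_gt (show 3 < j + 2 by lia), t_of_gt (show 3 < j + 3 by lia), one_pow, one_mul]
    rcases hcases hj with rfl | rfl | hj
    · exact hpow .pow_t₂
    · exact hpow .pow_t₃
    · rw [t_of_gt hj, one_pow]
  · have := mk_eq_one .pow_y
    rw [map_mul, map_inv, mul_inv_eq_one, map_pow] at this
    rw [t_of_gt (show 3 < c by lia), one_pow, mul_one]
    exact this
  · have := mk_eq_one .pow_x
    rw [map_mul, map_inv, mul_inv_eq_one, map_pow] at this
    rw [t_of_gt (show 3 < c by lia), t_of_gt (show 3 < 4 by lia), t_of_gt (show 3 < 5 by lia)]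
    simp only [one_pow, mul_one]
    exact this
  · intro j hj
    rcases hj.eq_or_lt with rfl | hj
    · exact comm_t₃ .x
    · rw [t_of_gt hj, one_mul, mul_one]
  · intro j hj
    rcases hcases hj with rfl | rfl | hj
    · exact (comm_s₃ .t₂).symm
    · exact (comm_s₃ .t₃).symm
    · rw [t_of_gt hj, one_mul, mul_one]
  · intro i j hi hj
    rcases hcases hi with rfl | rfl | hi
    · rcases hcases hj with rfl | rfl | hj
      · rfl
      · exact (comm_t₃ .t₂).symm
      · rw [t_of_gt hj, one_mul, mul_one]
    · rcases hcases hj with rfl | rfl | hj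
      · exact comm_t₃ .t₂
      · rfl
      · rw [t_of_gt hj, one_mul, mul_one]
    · rw [t_of_gt hi, one_mul, mul_one]

section lift

variable {E : Type*} [Group E] {c e b : ℕ} {X Y S : E} {t' : ℕ → E}

/-- The values of a tuple on the generators of the presentation. -/
def genMap (X Y S : E) (t : ℕ → E) : RootGen → E
  | .x => X
  | .y => Y
  | .t₂ => t 2
  | .s₃ => S
  | .t₃ => t 3

theorem eq_one_of_four (h : IsUTuple c e b X Y S t') (h4 : t' 4 = 1) {j : ℕ} (hj : 4 ≤ j) :
    t' j = 1 := by
  induction j, hj using Nat.le_induction with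
  | base => exact h4
  | succ j hj ih => rw [h.t_succ j (by lia), ih, pcComm_eq_one_iff, one_mul, mul_one]

theorem lift_relator (hc : 5 ≤ c) (h : IsUTuple c e b X Y S t') (h4 : t' 4 = 1) :
    ∀ r ∈ {r | RootRelator r}, FreeGroup.lift (genMap X Y S t') r = 1 := by
  have h1 := fun {j} => eq_one_of_four h h4 (j := j)
  intro r hr
  have hr' : RootRelator r := hr
  cases hr' with
  | def_t₂ =>
    rw [map_mul, map_inv, inv_mul_eq_one, map_pcComm]
    simp only [FreeGroup.lift_apply_of]
    exact h.t_two
  | def_s₃ =>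
    rw [map_mul, map_inv, inv_mul_eq_one, map_pcComm]
    simp only [FreeGroup.lift_apply_of]
    exact h.s_eq
  | def_t₃ =>
    rw [map_mul, map_inv, inv_mul_eq_one, map_pcComm]
    simp only [FreeGroup.lift_apply_of]
    exact h.t_succ 2 le_rfl
  | pow_x =>
    rw [map_mul, map_inv, mul_inv_eq_one, map_pow]
    simp only [FreeGroup.lift_apply_of]
    refine h.x_pow.trans ?_
    rw [h4, h1 (show 4 ≤ 5 by lia), h1 (show 4 ≤ c by lia)]
    simp only [one_pow, mul_one]
    rfl
  | pow_y =>
    rw [map_mul, map_inv, mul_inv_eq_one, map_pow]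
    simp only [FreeGroup.lift_apply_of]
    refine h.y_pow.trans ?_
    rw [h1 (show 4 ≤ c by lia), one_pow, mul_one]
    rfl
  | pow_t₂ =>
    rw [map_pow, FreeGroup.lift_apply_of]
    refine (h.t_pow 2 le_rfl).trans ?_
    rw [h4, h1 (show 4 ≤ 2 + 3 by lia), one_pow, one_mul]
  | pow_s₃ =>
    rw [map_pow, FreeGroup.lift_apply_of]
    exact h.s_pow
  | pow_t₃ =>
    rw [map_pow, FreeGroup.lift_apply_of]
    refine (h.t_pow 3 (by lia)).trans ?_
    rw [h1 (show 4 ≤ 3 + 2 by lia), h1 (show 4 ≤ 3 + 3 by lia), one_pow, one_mul]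
  | comm_s₃ g =>
    rw [map_pcComm, FreeGroup.lift_apply_of, FreeGroup.lift_apply_of, pcComm_eq_one_iff]
    cases g with
    | x => exact h.s_x
    | y => exact h.s_y
    | t₂ => exact (h.t_s 2 le_rfl).symm
    | s₃ => rfl
    | t₃ => exact (h.t_s 3 (by lia)).symm
  | comm_t₃ g =>
    rw [map_pcComm, FreeGroup.lift_apply_of, FreeGroup.lift_apply_of, pcComm_eq_one_iff]
    cases g with
    | x => exact h.t_x 3 le_rfl
    | y =>
      rw [← pcComm_eq_one_iff]
      exact (h.t_succ 3 (by lia)).symm.trans h4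
    | t₂ => exact h.t_t 3 2 (by lia) le_rfl
    | s₃ => exact h.t_s 3 (by lia)
    | t₃ => rfl

/-- The homomorphism out of `⟨243, 8⟩` defined by a tuple with `t 4 = 1`. -/
def lift (hc : 5 ≤ c) (h : IsUTuple c e b X Y S t') (h4 : t' 4 = 1) : SmallGroup243_8 →* E :=
  PresentedGroup.toGroup (lift_relator hc h h4)

theorem lift_gen (hc : 5 ≤ c) (h : IsUTuple c e b X Y S t') (h4 : t' 4 = 1) (g : RootGen) :
    lift hc h h4 (gen g) = genMap X Y S t' g := PresentedGroup.toGroup.of _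

end lift

theorem hom_ext {E : Type*} [Group E] {f g : SmallGroup243_8 →* E}
    (hX : f (gen .x) = g (gen .x)) (hY : f (gen .y) = g (gen .y)) : f = g := by
  have h := isUTuple (c := 5) le_rfl 0 0
  have h2 : f (gen .t₂) = g (gen .t₂) := by
    have := h.t_two
    change gen .t₂ = _ at this
    rw [this, map_pcComm, map_pcComm, hX, hY]
  have h3 : f (gen .t₃) = g (gen .t₃) := by
    have := h.t_succ 2 le_rfl
    change gen .t₃ = pcComm (gen .t₂) _ at this
    rw [this, map_pcComm, map_pcComm, h2, hY]
  have hs : f (gen .s₃) = g (gen .s₃) := by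
    have := h.s_eq
    change gen .s₃ = pcComm (gen .t₂) _ at this
    rw [this, map_pcComm, map_pcComm, h2, hX]
  refine PresentedGroup.ext ?_
  intro r
  cases r with
  | x => exact hX
  | y => exact hY
  | t₂ => exact h2
  | s₃ => exact hs
  | t₃ => exact h3

end SmallGroup243_8

namespace UGroup

open CycR Model

variable {n : ℕ}

/-- A normal subgroup that contains `t₄` and is generated by `t₄, t₅, …` has quotient `⟨243, 8⟩`. -/
theorem quotient_root (hn : 3 ≤ n) (e b : ℕ) (N : Subgroup (UGroup (n + 2) e b)) [N.Normal]
    (h4 : t (n + 2) e b 4 ∈ N) (hN : N ≤ (layer n 2 ⊥).map (coord hn e b)) :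
    Nonempty (UGroup (n + 2) e b ⧸ N ≃* SmallGroup243_8) := by
  have hc : 5 ≤ n + 2 := by lia
  have hR := SmallGroup243_8.isUTuple hc e b
  have hQ := (isUTuple (e := e) (b := b) hc).map (QuotientGroup.mk' N)
  have h4' : QuotientGroup.mk' N (t (n + 2) e b 4) = 1 := (QuotientGroup.eq_one_iff _).2 h4
  refine nonempty_quotient_mulEquiv N (lift hc hR) (SmallGroup243_8.lift hc hQ h4') ?_ ?_ ?_
  · refine hN.trans ?_
    rw [Subgroup.map_le_iff_le_comap]
    rintro ⟨i, j, r, s⟩ ⟨rfl, rfl, ⟨r, rfl⟩, hs⟩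
    obtain rfl : s = 0 := hs
    obtain ⟨u, v, rfl⟩ := exists_eq_int r
    have hmk : (⟨0, 0, D ^ 2 * ((u : CycR n) + (v : CycR n) * D), 0⟩ : Model n)
        = ⟨0, 0, D ^ (4 - 2), 0⟩ ^ u * ⟨0, 0, D ^ (5 - 2), 0⟩ ^ v := by
      rw [mk_zpow, mk_zpow, mk_mul_mk]
      ext
      · rfl
      · rfl
      · dsimp only; ring
      · simp
    rw [Subgroup.mem_comap, hmk, map_mul, map_zpow, map_zpow, coord_t hn e b (by lia),
      coord_t hn e b (by lia), MonoidHom.mem_ker, map_mul, map_zpow, map_zpow,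
      lift_t hc hR (by lia), lift_t hc hR (by lia), SmallGroup243_8.t_of_gt (by lia),
      SmallGroup243_8.t_of_gt (by lia), one_zpow, one_zpow, one_mul]
  · refine hom_ext hc ?_ ?_
    · rw [MonoidHom.comp_apply, lift_X, SmallGroup243_8.lift_gen]; rfl
    · rw [MonoidHom.comp_apply, lift_Y, SmallGroup243_8.lift_gen]; rfl
  · refine SmallGroup243_8.hom_ext ?_ ?_
    · rw [MonoidHom.comp_apply, SmallGroup243_8.lift_gen]
      exact lift_X hc hR
    · rw [MonoidHom.comp_apply, SmallGroup243_8.lift_gen]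
      exact lift_Y hc hR

theorem lowerPCentralSeries_le_map (hn : 3 ≤ n) (e b : ℕ) :
    lowerPCentralSeries 3 (UGroup (n + 2) e b) 3 ≤ (layer n 2 ⊥).map (coord hn e b) := by
  have hN1 : ((layer n 0 ⊤).map (coord hn e b)).Normal :=
    normal_map_layer hn e b le_rfl fun g _ u => pcComm_mem_layer_zero g u
  have hN2 : ((layer n 1 ⊤).map (coord hn e b)).Normal :=
    normal_map_layer hn e b le_rfl fun g hg u =>
      pcComm_mem_layer_one (layer_mono (Nat.zero_le 1) le_rfl hg) u
  have hN3 : ((layer n 2 ⊥).map (coord hn e b)).Normal :=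
    normal_map_layer hn e b le_rfl fun g hg u =>
      layer_mono (Nat.le_succ 2) le_rfl (pcComm_mem_layer_succ (by lia) hg u)
  have h0 : lowerPCentralSeries 3 (UGroup (n + 2) e b) 0 ≤ (⊤ : Subgroup _).map (coord hn e b) := by
    rw [map_top_coord]; exact le_top
  have h1 := lowerPCentralSeries_succ_le hn e b h0 hN1 (fun g _ u => pcComm_mem_layer_zero g u)
    (fun g _ => by
      rw [coord_pow_three]
      exact Subgroup.mem_map_of_mem _ ⟨rfl, rfl, ⟨_, by rw [pow_zero, one_mul]⟩, trivial⟩)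
  have h2 := lowerPCentralSeries_succ_le hn e b h1 hN2 (fun g hg u => pcComm_mem_layer_one hg u)
    (fun g hg => by
      rw [← map_pow]
      exact Subgroup.mem_map_of_mem _ (layer_mono le_rfl bot_le (pow_three_mem_layer hg)))
  exact lowerPCentralSeries_succ_le hn e b h2 hN3 (fun g hg u => pcComm_mem_layer_succ le_rfl hg u)
    (fun g hg => by
      rw [← map_pow]
      exact Subgroup.mem_map_of_mem _ (pow_three_mem_layer hg))

theorem quotient_lowerCentralSeries (hn : 3 ≤ n) (e b : ℕ) :
    Nonempty (UGroup (n + 2) e b ⧸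
      Subgroup.lowerCentralSeries (⊤ : Subgroup (UGroup (n + 2) e b)) 3 ≃* SmallGroup243_8) :=
  quotient_root hn e b _ ((isUTuple (by lia)).t_mem_lowerCentralSeries 2)
    (lowerCentralSeries_le_map hn e b le_rfl)

theorem isDescendant (hn : 3 ≤ n) (e b : ℕ) :
    IsDescendant 3 (UGroup (n + 2) e b) SmallGroup243_8 :=
  ⟨3, quotient_root hn e b _ (lowerCentralSeries_le_lowerPCentralSeries 3 _ 3
    ((isUTuple (by lia)).t_mem_lowerCentralSeries 2)) (lowerPCentralSeries_le_map hn e b)⟩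

theorem mainline_quotient (hn : 3 ≤ n) : Nonempty (UGroup (n + 2 + 1) 0 0 ⧸
    Subgroup.lowerCentralSeries (⊤ : Subgroup (UGroup (n + 2 + 1) 0 0)) (n + 2) ≃*
      UGroup (n + 2) 0 0) := by
  have hc : 5 ≤ n + 2 := by lia
  have h := isUTuple (e := 0) (b := 0) hc
  have h' : IsUTuple (n + 2 + 1) 0 0 (X (n + 2) 0 0) (Y (n + 2) 0 0) (S (n + 2) 0 0)
      (t (n + 2) 0 0) :=
    { h with
      t_gt := fun j hj => h.t_gt j (by lia)
      y_pow := by have := h.y_pow; rwa [pow_zero] at this ⊢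
      x_pow := by have := h.x_pow; rwa [pow_zero] at this ⊢ }
  set N := Subgroup.lowerCentralSeries (⊤ : Subgroup (UGroup (n + 2 + 1) 0 0)) (n + 2)
  have hG := isUTuple (c := n + 2 + 1) (e := 0) (b := 0) (by lia)
  have hq := hG.map (QuotientGroup.mk' N)
  have hq' : IsUTuple (n + 2) 0 0 (QuotientGroup.mk' N (X (n + 2 + 1) 0 0))
      (QuotientGroup.mk' N (Y (n + 2 + 1) 0 0)) (QuotientGroup.mk' N (S (n + 2 + 1) 0 0))
      (fun j => QuotientGroup.mk' N (t (n + 2 + 1) 0 0 j)) :=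
    { hq with
      t_gt := fun j hj => by
        rcases (show n + 2 + 1 ≤ j from hj).eq_or_lt with rfl | hj
        · exact (QuotientGroup.eq_one_iff _).2 (hG.t_mem_lowerCentralSeries (n + 1))
        · exact hq.t_gt j hj
      y_pow := by have := hq.y_pow; rwa [pow_zero] at this ⊢
      x_pow := by have := hq.x_pow; rwa [pow_zero] at this ⊢ }
  refine nonempty_quotient_mulEquiv N (lift (by lia) h') (lift hc hq') ?_ ?_ ?_
  · rw [← Subgroup.map_eq_bot_iff, eq_bot_iff, Subgroup.map_lowerCentralSeries,
      ← lowerCentralSeries_eq_bot hn 0 0]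
    exact Subgroup.lowerCentralSeries_mono _ le_top
  · refine hom_ext (by lia) ?_ ?_
    · rw [MonoidHom.comp_apply, lift_X, lift_X]
    · rw [MonoidHom.comp_apply, lift_Y, lift_Y]
  · refine hom_ext hc ?_ ?_
    · rw [MonoidHom.comp_apply, lift_X]
      exact lift_X (by lia) h'
    · rw [MonoidHom.comp_apply, lift_Y]
      exact lift_Y (by lia) h'

end UGroup

/-! ### Transfers to subgroups of index three -/

/-- If the powers of `g` form a transversal of a normal subgroup `H` of index three, then the
transfer of `g` is the class of `g ^ 3`. -/
theorem transfer_eq_pow_three {G A : Type*} [Group G] [CommGroup A] {H : Subgroup G} [H.Normal]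
    [H.FiniteIndex] (ϕ : H →* A) {g : G} (hg : g ∉ H) (h3 : g ^ 3 ∈ H)
    (hgen : ∀ u : G, ∃ k : ℕ, ∃ h ∈ H, u = g ^ k * h) :
    MonoidHom.transfer ϕ g = ϕ ⟨g ^ 3, h3⟩ := by
  classical
  have hmk : ∀ q : G ⧸ H, ∃ k : ℕ, q = g ^ k • ((1 : G) : G ⧸ H) := by
    intro q
    obtain ⟨u, rfl⟩ := QuotientGroup.mk_surjective q
    obtain ⟨k, h, hh, rfl⟩ := hgen u
    refine ⟨k, ?_⟩
    rw [MulAction.Quotient.smul_coe, QuotientGroup.eq]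
    simpa using hh
  have hsub : Subsingleton (Quotient (MulAction.orbitRel (Subgroup.zpowers g) (G ⧸ H))) := by
    have h1 : ∀ q : G ⧸ H,
        (MulAction.orbitRel (Subgroup.zpowers g) (G ⧸ H)) q ((1 : G) : G ⧸ H) := by
      intro q
      obtain ⟨k, rfl⟩ := hmk q
      rw [MulAction.orbitRel_apply]
      exact ⟨⟨g ^ k, Subgroup.npow_mem_zpowers g k⟩, rfl⟩
    refine ⟨fun q q' => ?_⟩
    induction q using Quotient.inductionOn with | h a => ?_
    induction q' using Quotient.inductionOn with | h b => ?_
    exact Quotient.sound ((MulAction.orbitRel _ _).trans (h1 a)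
      ((MulAction.orbitRel _ _).symm (h1 b)))
  let q₀ : Quotient (MulAction.orbitRel (Subgroup.zpowers g) (G ⧸ H)) := ⟦((1 : G) : G ⧸ H)⟧
  have hfin : Fintype (Quotient (MulAction.orbitRel (Subgroup.zpowers g) (G ⧸ H))) :=
    Fintype.ofFinite _
  rw [MonoidHom.transfer_eq_prod_quotient_orbitRel_zpowers_quot, Fintype.prod_subsingleton _ q₀]
  have hper : Function.minimalPeriod (g • ·) q₀.out = 3 := by
    have : Fact (Nat.Prime 3) := ⟨Nat.prime_three⟩
    obtain ⟨k, hk⟩ := hmk q₀.out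
    rw [hk]
    refine Function.minimalPeriod_eq_prime ?_ ?_
    · rw [Function.IsPeriodicPt, Function.IsFixedPt, smul_iterate]
      change g ^ 3 • g ^ k • ((1 : G) : G ⧸ H) = g ^ k • ((1 : G) : G ⧸ H)
      rw [smul_smul, ← pow_add,
        add_comm, pow_add, mul_smul]
      congr 1
      rw [MulAction.Quotient.smul_coe, QuotientGroup.eq]
      simpa using h3
    · intro h
      have h' : g • g ^ k • ((1 : G) : G ⧸ H) = g ^ k • ((1 : G) : G ⧸ H) := h
      rw [smul_smul, ← pow_succ', pow_succ, mul_smul, smul_left_cancel_iff,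
        MulAction.Quotient.smul_coe, QuotientGroup.eq] at h'
      exact hg (by simpa using h')
  obtain ⟨k, h, hh, hu⟩ := hgen q₀.out.out
  have key : (⟨q₀.out.out⁻¹ * g ^ Function.minimalPeriod (g • ·) q₀.out * q₀.out.out,
      QuotientGroup.out_conj_pow_minimalPeriod_mem H g q₀.out⟩ : H)
      = (⟨h, hh⟩ : H)⁻¹ * ⟨g ^ 3, h3⟩ * ⟨h, hh⟩ := by
    apply Subtype.ext
    simp only [hper, hu, Subgroup.coe_mul, Subgroup.coe_inv]
    have : g ^ 3 * g ^ k = g ^ k * g ^ 3 := by rw [← pow_add, add_comm, pow_add]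
    calc (g ^ k * h)⁻¹ * g ^ 3 * (g ^ k * h) = h⁻¹ * (g ^ k)⁻¹ * (g ^ 3 * g ^ k) * h := by group
      _ = _ := by rw [this]; group
  rw [key, map_mul, map_mul, mul_comm, map_inv, mul_inv_cancel_left]

/-- The class of an element of `H` in `H / H'` is trivial if and only if it lies in `H'`. -/
theorem of_eq_one_iff {G : Type*} [Group G] {H : Subgroup G} (h : H) :
    Abelianization.of h = 1 ↔ (h : G) ∈ ⁅H, H⁆ := by
  rw [← MonoidHom.mem_ker, Abelianization.ker_of, ← Subgroup.map_subtype_commutator]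
  constructor
  · exact fun hh => ⟨h, hh, rfl⟩
  · rintro ⟨h', hh, he⟩
    rwa [← Subtype.ext he]

theorem commutator_closure_le {G : Type*} [Group G] {N : Subgroup G} [N.Normal] {s : Set G}
    (h : ∀ a ∈ s, ∀ b ∈ s, pcComm a b ∈ N) :
    ⁅Subgroup.closure s, Subgroup.closure s⁆ ≤ N := by
  have hcomm : ∀ a ∈ QuotientGroup.mk' N '' s, ∀ b ∈ QuotientGroup.mk' N '' s,
      a * b = b * a := by
    rintro _ ⟨a, ha, rfl⟩ _ ⟨b, hb, rfl⟩
    rw [← pcComm_eq_one_iff, ← map_pcComm]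
    exact (QuotientGroup.eq_one_iff _).2 (h a ha b hb)
  have hc := Subgroup.isMulCommutative_closure hcomm
  rw [Subgroup.commutator_le]
  intro a ha b hb
  rw [← QuotientGroup.eq_one_iff]
  have h1 : ∀ a ∈ Subgroup.closure s,
      QuotientGroup.mk' N a ∈ Subgroup.closure (QuotientGroup.mk' N '' s) := by
    intro a ha
    rw [← MonoidHom.map_closure]
    exact Subgroup.mem_map_of_mem _ ha
  have h2 := setLike_mul_comm (h1 a ha) (h1 b hb)
  change QuotientGroup.mk' N ⁅a, b⁆ = 1
  rw [map_commutatorElement, commutatorElement_eq_one_iff_mul_comm, h2]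

/-- A maximal subgroup of a nilpotent group is normal with commutative quotient. -/
theorem IsCoatom.commutator_le {G : Type*} [Group G] [Group.IsNilpotent G] {M : Subgroup G}
    (hM : IsCoatom M) : M.Normal ∧ ⁅(⊤ : Subgroup G), ⊤⁆ ≤ M := by
  have hn : M.Normal :=
    Subgroup.NormalizerCondition.normal_of_coatom M Group.normalizerCondition_of_isNilpotent hM
  refine ⟨hn, ?_⟩
  obtain ⟨g, hg⟩ : ∃ g, g ∉ M := by
    by_contra! h
    exact hM.1 (eq_top_iff.2 fun x _ => h x)
  have htop : Subgroup.closure (insert g (M : Set G)) = ⊤ := by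
    refine hM.2 _ (lt_of_le_of_ne ?_ ?_)
    · exact fun m hm => Subgroup.subset_closure (Set.mem_insert_of_mem _ hm)
    · intro h
      exact hg (by rw [h]; exact Subgroup.subset_closure (Set.mem_insert _ _))
  rw [← htop]
  refine commutator_closure_le ?_
  have hm : ∀ m ∈ M, ∀ a, pcComm m a ∈ M := by
    intro m hm a
    have : pcComm m a = m⁻¹ * (a⁻¹ * m * a⁻¹⁻¹) := by simp [pcComm, mul_assoc]
    rw [this]
    exact M.mul_mem (M.inv_mem hm) (hn.conj_mem m hm _)
  have hm' : ∀ m ∈ M, ∀ a, pcComm a m ∈ M := by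
    intro m hm a
    have : pcComm a m = (a⁻¹ * m⁻¹ * a⁻¹⁻¹) * m := by simp [pcComm, mul_assoc]
    rw [this]
    exact M.mul_mem (hn.conj_mem _ (M.inv_mem hm) _) hm
  rintro a (rfl | ha) b (rfl | hb)
  · rw [pcComm_eq_one_iff.2 rfl]; exact M.one_mem
  · exact hm' b hb _
  · exact hm a ha _
  · exact hm a ha _

/-! ### The maximal subgroups and their transfer kernels -/

namespace Model

variable {n : ℕ}

open CycR

theorem pow_i (g : Model n) (m : ℕ) : (g ^ m).i = m * g.i := by
  induction m with
  | zero => simp [one_def]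
  | succ m ih => rw [pow_succ, mul_def, ih]; push_cast; ring

theorem pow_j (g : Model n) (m : ℕ) : (g ^ m).j = m * g.j := by
  induction m with
  | zero => simp [one_def]
  | succ m ih => rw [pow_succ, mul_def, ih]; push_cast; ring

theorem inv_mul_mem_layer {g h : Model n} (hi : g.i = h.i) (hj : g.j = h.j) :
    g⁻¹ * h ∈ layer n 0 ⊤ := by
  refine ⟨?_, ?_, ⟨_, by rw [pow_zero, one_mul]⟩, trivial⟩
  · simp [mul_def, inv_def, hi]
  · simp [mul_def, inv_def, hj]

/-- The commutators with `x ^ k * y ^ l` of the elements of the module. -/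
noncomputable def lineDer (n : ℕ) (k l : ℤ) : Subgroup (Model n) where
  carrier := {g | ∃ r, g = ⟨0, 0, D * br l * r, k * eps r⟩}
  one_mem' := ⟨0, by rw [mul_zero, map_zero, mul_zero]; rfl⟩
  mul_mem' := by
    rintro _ _ ⟨r, rfl⟩ ⟨r', rfl⟩
    exact ⟨r + r', by rw [mk_mul_mk, map_add, mul_add, mul_add]⟩
  inv_mem' := by
    rintro _ ⟨r, rfl⟩
    exact ⟨-r, by rw [inv_eq_iff_mul_eq_one, mk_mul_mk, map_neg, one_def]; simp⟩

theorem lineDer_normal (k l : ℤ) : (lineDer n k l).Normal := by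
  refine ⟨fun g hg u => ?_⟩
  have h : u * g * u⁻¹ = g * pcComm g u⁻¹ := by simp [pcComm, mul_assoc]
  rw [h]
  refine Subgroup.mul_mem _ hg ?_
  obtain ⟨r, rfl⟩ := hg
  rw [comm_mk]
  refine ⟨D * br (u⁻¹).j * r, ?_⟩
  simp only [map_mul, eps_D, zero_mul, mul_zero]
  congr 1
  ring

end Model

namespace UGroup

open CycR Model

variable {n : ℕ}

/-- The character of `G(c; e, b)` with the given values on `x` and `y`. -/
def chi {c : ℕ} (hc : 5 ≤ c) (e b : ℕ) (u v : ZMod 3) :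
    UGroup c e b →* Multiplicative (ZMod 3) :=
  lift hc (X' := Multiplicative.ofAdd u) (Y' := Multiplicative.ofAdd v) (S' := 1) (t' := fun _ => 1)
    (by
      have h1 : ∀ a : Multiplicative (ZMod 3), a ^ 3 = 1 := by decide
      have h2 : ∀ a b : Multiplicative (ZMod 3), pcComm a b = 1 := fun a b =>
        pcComm_eq_one_iff.2 (mul_comm a b)
      constructor <;> simp [h1, h2])

/-- The subgroup generated by `x ^ k * y ^ l` and the derived subgroup. -/
noncomputable def line (hn : 3 ≤ n) (e b : ℕ) (k l : ℤ) : Subgroup (UGroup (n + 2) e b) :=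
  (chi (show 5 ≤ n + 2 by lia) e b (-l) k).ker

variable (hn : 3 ≤ n) (e b : ℕ)

theorem chi_coord (u v : ZMod 3) (g : Model n) :
    chi (show 5 ≤ n + 2 by lia) e b u v (coord hn e b g)
      = Multiplicative.ofAdd (u * g.i + v * g.j) := by
  let f : Model n →* Multiplicative (ZMod 3) :=
    { toFun := fun g => Multiplicative.ofAdd (u * g.i + v * g.j)
      map_one' := by simp [one_def]
      map_mul' := by
        intro g h
        rw [← ofAdd_add, mul_def]
        congr 1
        push_cast; ring }
  have h : MonoidHom.eqLocus ((chi (show 5 ≤ n + 2 by lia) e b u v).comp (coord hn e b)) f = ⊤ := by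
    apply eq_top_of_mem
    · change chi (show 5 ≤ n + 2 by lia) e b u v (coord hn e b _) = Multiplicative.ofAdd _
      rw [coord_x, chi, lift_X]; simp
    · change chi (show 5 ≤ n + 2 by lia) e b u v (coord hn e b _) = Multiplicative.ofAdd _
      rw [coord_y, chi, lift_Y]; simp
  have h' : g ∈ MonoidHom.eqLocus
      ((chi (show 5 ≤ n + 2 by lia) e b u v).comp (coord hn e b)) f := by
    rw [h]; exact Subgroup.mem_top g
  exact h'

/-- The first two coordinates only matter modulo `3`. -/
theorem coord_congr {i j i' j' : ℤ} (hi : (i : ZMod 3) = i') (hj : (j : ZMod 3) = j')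
    (r : CycR n) (s : ZMod 3) :
    ∃ r' s', coord hn e b ⟨i, j, r, s⟩ = coord hn e b ⟨i', j', r', s'⟩ := by
  obtain ⟨p, hp⟩ := (ZMod.intCast_eq_intCast_iff_dvd_sub i i' 3).1 hi
  obtain ⟨q, hq⟩ := (ZMod.intCast_eq_intCast_iff_dvd_sub j j' 3).1 hj
  let w : Model n := ⟨3 * p, 3 * q, -((p : CycR n) * xCube n b)
      - (q : CycR n) * ((e : CycR n) * D ^ n), -q⟩
  have hw : coord hn e b w = 1 := by
    rw [← MonoidHom.mem_ker, coord_ker]; exact ⟨p, q, rfl⟩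
  have h : (⟨i, j, r, s⟩ * w : Model n)
      = ⟨i', j', (⟨i, j, r, s⟩ * w : Model n).t, (⟨i, j, r, s⟩ * w : Model n).s⟩ := by
    ext
    · rw [mul_def]; push_cast at hp; dsimp only [w]; lia
    · rw [mul_def]; push_cast at hq; dsimp only [w]; lia
    · rfl
    · rfl
  refine ⟨(⟨i, j, r, s⟩ * w : Model n).t, (⟨i, j, r, s⟩ * w : Model n).s, ?_⟩
  rw [← h, map_mul, hw, mul_one]

theorem exists_coord_reduced (u : UGroup (n + 2) e b) : ∃ i j r s, (i = -1 ∨ i = 0 ∨ i = 1) ∧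
    (j = -1 ∨ j = 0 ∨ j = 1) ∧ u = coord hn e b ⟨i, j, r, s⟩ := by
  obtain ⟨⟨i, j, r, s⟩, rfl⟩ := coord_surjective hn e b u
  have h : ∀ i : ℤ, ∃ i' : ℤ, (i' = -1 ∨ i' = 0 ∨ i' = 1) ∧ (i : ZMod 3) = i' := by
    intro i
    refine ⟨(i + 1) % 3 - 1, by lia, ?_⟩
    refine (ZMod.intCast_eq_intCast_iff_dvd_sub _ _ 3).2 ?_
    lia
  obtain ⟨i', hi, hi'⟩ := h i
  obtain ⟨j', hj, hj'⟩ := h j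
  obtain ⟨r', s', h'⟩ := coord_congr hn e b hi' hj' r s
  exact ⟨i', j', r', s', hi, hj, h'⟩

theorem coord_mem_line {k l : ℤ} {g : Model n} :
    coord hn e b g ∈ line hn e b k l ↔ (k * g.j - l * g.i : ZMod 3) = 0 := by
  rw [line, MonoidHom.mem_ker, chi_coord, ← ofAdd_zero, Multiplicative.ofAdd.injective.eq_iff]
  ring_nf

instance line_normal (k l : ℤ) : (line hn e b k l).Normal := MonoidHom.normal_ker _

instance line_finiteIndex (k l : ℤ) : (line hn e b k l).FiniteIndex :=
  have := finite hn e b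
  Subgroup.finiteIndex_of_finite

theorem line_eq_closure {k l : ℤ} (hkl : (k : ZMod 3) ≠ 0 ∨ (l : ZMod 3) ≠ 0) :
    line hn e b k l = Subgroup.closure
      (insert (coord hn e b ⟨k, l, 0, 0⟩) ((layer n 0 ⊤).map (coord hn e b))) := by
  apply le_antisymm
  · intro u hu
    obtain ⟨⟨i, j, r, s⟩, rfl⟩ := coord_surjective hn e b u
    rw [coord_mem_line] at hu
    obtain ⟨m, hi, hj⟩ : ∃ m : ZMod 3, (i : ZMod 3) = m * k ∧ (j : ZMod 3) = m * l := by
      generalize (i : ZMod 3) = i at *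
      generalize (j : ZMod 3) = j at *
      generalize (k : ZMod 3) = k at *
      generalize (l : ZMod 3) = l at *
      revert hu hkl
      revert i j k l
      decide
    obtain ⟨r', s', h⟩ := coord_congr hn e b (i' := m.val * k) (j' := m.val * l)
      (by rw [hi]; simp) (by rw [hj]; simp) r s
    rw [h]
    have h2 : (⟨m.val * k, m.val * l, r', s'⟩ : Model n) = ⟨k, l, 0, 0⟩ ^ m.val *
        ((⟨k, l, 0, 0⟩ ^ m.val)⁻¹ * ⟨m.val * k, m.val * l, r', s'⟩) := by
      rw [mul_inv_cancel_left]
    rw [h2, map_mul, map_pow]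
    refine Subgroup.mul_mem _ (Subgroup.pow_mem _ (Subgroup.subset_closure (Set.mem_insert _ _)) _)
      (Subgroup.subset_closure (Set.mem_insert_of_mem _ (Subgroup.mem_map_of_mem _
        (inv_mul_mem_layer ?_ ?_))))
    · rw [pow_i]
    · rw [pow_j]
  · rw [Subgroup.closure_le]
    rintro _ (rfl | ⟨⟨i, j, r, s⟩, ⟨rfl, rfl, -⟩, rfl⟩)
    · refine (coord_mem_line hn e b).2 ?_
      dsimp only; ring
    · refine (coord_mem_line hn e b).2 ?_
      simp

theorem mem_commutator_line {k l : ℤ} (hkl : (k : ZMod 3) ≠ 0 ∨ (l : ZMod 3) ≠ 0)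
    {r : CycR n} {s : ZMod 3} :
    coord hn e b ⟨0, 0, r, s⟩ ∈ ⁅line hn e b k l, line hn e b k l⁆ ↔
      ∃ r', r = D * br l * r' ∧ s = k * eps r' := by
  constructor
  · intro h
    have hN : ((lineDer n k l).map (coord hn e b)).Normal :=
      (lineDer_normal k l).map _ (coord_surjective hn e b)
    have hle : ⁅line hn e b k l, line hn e b k l⁆ ≤ (lineDer n k l).map (coord hn e b) := by
      rw [line_eq_closure hn e b hkl]
      refine commutator_closure_le ?_
      have h1 : ∀ a ∈ layer n 0 ⊤, pcComm a (⟨k, l, 0, 0⟩ : Model n) ∈ lineDer n k l := by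
        rintro ⟨i, j, r, s⟩ ⟨rfl, rfl, -⟩
        rw [comm_mk]
        exact ⟨r, rfl⟩
      rintro _ (rfl | ⟨u, hu, rfl⟩) _ (rfl | ⟨v, hv, rfl⟩)
      · rw [pcComm_eq_one_iff.2 rfl]; exact Subgroup.one_mem _
      · rw [← map_pcComm]
        refine Subgroup.mem_map_of_mem _ ?_
        have h2 : pcComm (⟨k, l, 0, 0⟩ : Model n) v = (pcComm v ⟨k, l, 0, 0⟩)⁻¹ := by
          simp [pcComm, mul_assoc]
        rw [h2]
        exact Subgroup.inv_mem _ (h1 v hv)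
      · rw [← map_pcComm]
        exact Subgroup.mem_map_of_mem _ (h1 u hu)
      · obtain ⟨i, j, r, s⟩ := u
        obtain ⟨i', j', r', s'⟩ := v
        obtain ⟨rfl, rfl, -⟩ := hu
        obtain ⟨rfl, rfl, -⟩ := hv
        rw [← map_pcComm, comm_mk_mk, map_one]
        exact Subgroup.one_mem _
    obtain ⟨_, ⟨r', rfl⟩, hr⟩ := hle h
    obtain ⟨h1, h2⟩ := coord_mk_inj hn e b hr
    exact ⟨r', h1.symm, h2.symm⟩
  · rintro ⟨r', rfl, rfl⟩
    have h1 : (⟨0, 0, D * br l * r', k * eps r'⟩ : Model n)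
        = pcComm ⟨0, 0, r', 0⟩ ⟨k, l, 0, 0⟩ := by
      rw [comm_mk]
    have h2 : coord hn e b ⟨0, 0, r', 0⟩ ∈ line hn e b k l := by
      rw [coord_mem_line]; simp
    have h3 : coord hn e b ⟨k, l, 0, 0⟩ ∈ line hn e b k l := by
      rw [coord_mem_line]; dsimp only; ring
    rw [h1, map_pcComm, pcComm_eq_commutatorElement]
    exact Subgroup.commutator_mem_commutator (Subgroup.inv_mem _ h2) (Subgroup.inv_mem _ h3)

theorem exists_pow_of_not_mem_line {k l : ℤ} {g : UGroup (n + 2) e b} (hg : g ∉ line hn e b k l)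
    (u : UGroup (n + 2) e b) : ∃ m : ℕ, ∃ h ∈ line hn e b k l, u = g ^ m * h := by
  have key : ∀ v w : Multiplicative (ZMod 3), v ≠ 1 → ∃ m : Fin 3, v ^ (m : ℕ) = w := by decide
  obtain ⟨m, hm⟩ := key (chi (show 5 ≤ n + 2 by lia) e b (-l) k g)
    (chi (show 5 ≤ n + 2 by lia) e b (-l) k u) hg
  refine ⟨m, (g ^ (m : ℕ))⁻¹ * u, ?_, by rw [mul_inv_cancel_left]⟩
  rw [line, MonoidHom.mem_ker, map_mul, map_inv, map_pow, hm, inv_mul_cancel]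

theorem pow_three_mem_line {k l : ℤ} (g : UGroup (n + 2) e b) : g ^ 3 ∈ line hn e b k l := by
  have key : ∀ v : Multiplicative (ZMod 3), v ^ 3 = 1 := by decide
  rw [line, MonoidHom.mem_ker, map_pow, key]

theorem eq_top_of_line_lt {k l : ℤ} {K : Subgroup (UGroup (n + 2) e b)} (hK : line hn e b k l ≤ K)
    {g : UGroup (n + 2) e b} (hg : g ∉ line hn e b k l) (hgK : g ∈ K) : K = ⊤ := by
  rw [eq_top_iff]
  intro u _
  obtain ⟨m, h, hh, rfl⟩ := exists_pow_of_not_mem_line hn e b hg u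
  exact K.mul_mem (K.pow_mem hgK m) (hK hh)

theorem isCoatom_line {k l : ℤ} (hkl : (k : ZMod 3) ≠ 0 ∨ (l : ZMod 3) ≠ 0) :
    IsCoatom (line hn e b k l) := by
  constructor
  · intro h
    have h1 : coord hn e b ⟨1, 0, 0, 0⟩ ∈ line hn e b k l := h ▸ Subgroup.mem_top _
    have h2 : coord hn e b ⟨0, 1, 0, 0⟩ ∈ line hn e b k l := h ▸ Subgroup.mem_top _
    rw [coord_mem_line] at h1 h2
    simp at h1 h2
    rcases hkl with h' | h'
    · exact h' h2
    · exact h' h1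
  · intro K hK
    obtain ⟨hle, g, hgK, hg⟩ := SetLike.lt_iff_le_and_exists.1 hK
    exact eq_top_of_line_lt hn e b hle hg hgK

theorem mem_commutator (r : CycR n) (s : ZMod 3) :
    coord hn e b ⟨0, 0, r, s⟩ ∈ ⁅(⊤ : Subgroup (UGroup (n + 2) e b)),
      (⊤ : Subgroup (UGroup (n + 2) e b))⁆ := by
  have h := isUTuple (c := n + 2) (e := e) (b := b) (by lia)
  have ht : ∀ k, t (n + 2) e b (k + 2) ∈ ⁅(⊤ : Subgroup (UGroup (n + 2) e b)),
      (⊤ : Subgroup (UGroup (n + 2) e b))⁆ := fun k =>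
    Subgroup.lowerCentralSeries_antitone _ (show 1 ≤ k + 1 by lia) (h.t_mem_lowerCentralSeries k)
  have hs : S (n + 2) e b ∈ ⁅(⊤ : Subgroup (UGroup (n + 2) e b)),
      (⊤ : Subgroup (UGroup (n + 2) e b))⁆ :=
    Subgroup.lowerCentralSeries_antitone _ (show 1 ≤ 2 by lia) h.s_mem_lowerCentralSeries
  refine mk_mem_of_mem (K := ⁅(⊤ : Subgroup (UGroup (n + 2) e b)),
      (⊤ : Subgroup (UGroup (n + 2) e b))⁆.comap (coord hn e b))
    ?_ ?_ ?_ r s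
  · have := coord_t hn e b (j := 2) le_rfl
    rw [Subgroup.mem_comap, ← pow_zero D, this]; exact ht 0
  · have := coord_t hn e b (j := 3) (by lia)
    rw [Subgroup.mem_comap, ← pow_one D, this]; exact ht 1
  · rw [Subgroup.mem_comap, coord_s]; exact hs

/-- A maximal subgroup contains the derived subgroup and one of `x`, `y`, `xy`, `xy⁻¹`. -/
theorem isCoatom_iff (M : Subgroup (UGroup (n + 2) e b)) : IsCoatom M ↔ M = line hn e b 1 0 ∨
    M = line hn e b 0 1 ∨ M = line hn e b 1 1 ∨ M = line hn e b 1 (-1) := by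
  constructor
  · intro hM
    have := isNilpotent hn e b
    obtain ⟨-, hle⟩ := hM.commutator_le
    have hA : ∀ r s, coord hn e b ⟨0, 0, r, s⟩ ∈ M := fun r s => hle (mem_commutator hn e b r s)
    have hline : ∀ k l : ℤ, ((k : ZMod 3) ≠ 0 ∨ (l : ZMod 3) ≠ 0) → coord hn e b ⟨k, l, 0, 0⟩ ∈ M →
        M = line hn e b k l := by
      intro k l hkl hw
      have hle : line hn e b k l ≤ M := by
        rw [line_eq_closure hn e b hkl, Subgroup.closure_le]
        rintro _ (rfl | ⟨⟨i, j, r, s⟩, ⟨rfl, rfl, -⟩, rfl⟩)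
        · exact hw
        · exact hA r s
      by_contra hne
      exact hM.1 ((isCoatom_line hn e b hkl).2 M (lt_of_le_of_ne hle (Ne.symm hne)))
    have hred : ∀ i j r s, coord hn e b ⟨i, j, r, s⟩ ∈ M → coord hn e b ⟨i, j, 0, 0⟩ ∈ M := by
      intro i j r s h
      have h1 : (⟨i, j, 0, 0⟩ : Model n) = ⟨i, j, r, s⟩ * ⟨0, 0, -r, -s⟩ := by
        simp [mul_def, z_zero]
      rw [h1, map_mul]
      exact M.mul_mem h (hA _ _)
    have hneg : ∀ i j, coord hn e b ⟨i, j, 0, 0⟩ ∈ M → coord hn e b ⟨-i, -j, 0, 0⟩ ∈ M := by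
      intro i j h
      have h1 := M.inv_mem h
      rw [← map_inv, inv_def] at h1
      exact hred _ _ _ _ h1
    by_cases hne : ∃ u ∈ M, u ∉ (layer n 0 ⊤).map (coord hn e b)
    · obtain ⟨u, hu, hu'⟩ := hne
      obtain ⟨i, j, r, s, hi, hj, rfl⟩ := exists_coord_reduced hn e b u
      have h1 := hred _ _ _ _ hu
      have h2 := hneg _ _ h1
      have hne : ¬(i = 0 ∧ j = 0) := by
        rintro ⟨rfl, rfl⟩
        exact hu' (Subgroup.mem_map_of_mem _ ⟨rfl, rfl, ⟨r, by rw [pow_zero, one_mul]⟩, trivial⟩)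
      rcases hi with rfl | rfl | rfl <;> rcases hj with rfl | rfl | rfl <;>
        (try simp only [neg_neg, neg_zero] at h1 h2)
      · exact Or.inr (Or.inr (Or.inl (hline _ _ (by decide) h2)))
      · exact Or.inl (hline _ _ (by decide) h2)
      · exact Or.inr (Or.inr (Or.inr (hline _ _ (by decide) h2)))
      · exact Or.inr (Or.inl (hline _ _ (by decide) h2))
      · exact absurd ⟨rfl, rfl⟩ hne
      · exact Or.inr (Or.inl (hline _ _ (by decide) h1))
      · exact Or.inr (Or.inr (Or.inr (hline _ _ (by decide) h1)))
      · exact Or.inl (hline _ _ (by decide) h1)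
      · exact Or.inr (Or.inr (Or.inl (hline _ _ (by decide) h1)))
    · push Not at hne
      exfalso
      have hlt : M ≤ line hn e b 1 0 := by
        intro u hu
        obtain ⟨⟨i, j, r, s⟩, ⟨rfl, rfl, -⟩, rfl⟩ := hne u hu
        rw [coord_mem_line]; simp
      have h1 : M = line hn e b 1 0 := by
        by_contra hne'
        exact (isCoatom_line hn e b (k := 1) (l := 0) (by decide)).1
          (hM.2 _ (lt_of_le_of_ne hlt hne'))
      have h2 : coord hn e b ⟨1, 0, 0, 0⟩ ∈ M := by
        rw [h1, coord_mem_line]; simp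
      obtain ⟨⟨i, j, r, s⟩, ⟨rfl, rfl, -⟩, h3⟩ := hne _ h2
      have h4 := congrArg (chi (show 5 ≤ n + 2 by lia) e b 1 0) h3
      rw [chi_coord, chi_coord] at h4
      revert h4
      simp only [Int.cast_zero, Int.cast_one, mul_zero, mul_one, add_zero]
      decide
  · rintro (rfl | rfl | rfl | rfl)
    all_goals exact isCoatom_line hn e b (by decide)

end UGroup

/-! ### The transfer kernel types -/

theorem EisInt.one_add_z_add_z : ∀ j : ZMod 3, j ≠ 0 → 1 + z j + z (2 * j) = 0 := by decide

theorem EisInt.z_mul_br_add : ∀ j : ZMod 3, j ≠ 0 →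
    z j * br (2 * j) + z (2 * j) * br j = -(D * (1 + D) ^ 2) := by
  intro j hj
  rw [sq]
  revert j
  decide

namespace CycR

variable {n : ℕ}

theorem one_add_z_add_z {j : ℤ} (hj : (j : ZMod 3) ≠ 0) : (1 + z j + z (2 * j) : CycR n) = 0 := by
  have h := congrArg (mk : EisInt → CycR n) (EisInt.one_add_z_add_z j hj)
  simp only [map_add, map_one, map_zero] at h
  simpa only [z, Int.cast_mul, Int.cast_ofNat] using h

theorem z_mul_br_add {j : ℤ} (hj : (j : ZMod 3) ≠ 0) :
    (z j * br (2 * j) + z (2 * j) * br j : CycR n) = -(D * (1 + D) ^ 2) := by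
  have h := congrArg (mk : EisInt → CycR n) (EisInt.z_mul_br_add j hj)
  simp only [map_add, map_mul, map_one, map_neg, map_pow] at h
  simpa only [z, br, Int.cast_mul, Int.cast_ofNat, D] using h

end CycR

namespace UGroup

open CycR Model

variable {n : ℕ}

variable (hn : 3 ≤ n) (e b : ℕ)

/-- The cube of an element outside `⟨x, G'⟩`. Only the exponents of `x` and `y` matter, and the
leading terms of the value of `x³` cancel. -/
theorem coord_pow_three_of_ne {g : Model n} (hj : (g.j : ZMod 3) ≠ 0) :
    coord hn e b g ^ 3 = coord hn e b ⟨0, 0,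
      ((g.i : CycR n) * (b : CycR n) + (g.j : CycR n) * (e : CycR n)) * D ^ n,
      g.i * g.i * g.j + g.j⟩ := by
  rw [coord_pow_three, xCube]
  congr 2
  linear_combination (g.i : CycR n) * z_mul_br_add hj + g.t * one_add_z_add_z hj

theorem coord_pow_three_of_eq (i : ℤ) (r : CycR n) (s : ZMod 3) :
    coord hn e b ⟨i, 0, r, s⟩ ^ 3 = coord hn e b ⟨0, 0, 3 * r + (i : CycR n) * xCube n b, 0⟩ := by
  rw [coord_pow_three]
  congr 2
  · simp only [mul_zero, z_zero, br_zero, Int.cast_zero]; ring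

theorem mul_mem_artinKernel {k l : ℤ} {g h : UGroup (n + 2) e b} (hg : g ∉ line hn e b k l)
    (hh : h ∉ line hn e b k l) : g * h ∈ artinKernel (line hn e b k l) ↔
      g ^ 3 * h ^ 3 ∈ ⁅line hn e b k l, line hn e b k l⁆ := by
  rw [artinKernel, MonoidHom.mem_ker, map_mul,
    transfer_eq_pow_three _ hg (pow_three_mem_line hn e b g) (exists_pow_of_not_mem_line hn e b hg),
    transfer_eq_pow_three _ hh (pow_three_mem_line hn e b h) (exists_pow_of_not_mem_line hn e b hh),
    ← map_mul, of_eq_one_iff]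
  rfl

theorem mem_artinKernel {k l : ℤ} {g : UGroup (n + 2) e b} (hg : g ∉ line hn e b k l) :
    g ∈ artinKernel (line hn e b k l) ↔ g ^ 3 ∈ ⁅line hn e b k l, line hn e b k l⁆ := by
  rw [artinKernel, MonoidHom.mem_ker,
    transfer_eq_pow_three _ hg (pow_three_mem_line hn e b g) (exists_pow_of_not_mem_line hn e b hg),
    of_eq_one_iff]

theorem coord_not_mem_line {k l : ℤ} {g : Model n} (h : (k * g.j - l * g.i : ZMod 3) ≠ 0) :
    coord hn e b g ∉ line hn e b k l := fun h' => h ((coord_mem_line hn e b).1 h')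

/-- The kernel of a transfer contains the derived subgroup, so that it is a given maximal subgroup
as soon as it contains a generator of it and is not the whole group. -/
theorem artinKernel_line_eq {k l k' l' : ℤ} (hkl : (k' : ZMod 3) ≠ 0 ∨ (l' : ZMod 3) ≠ 0)
    (h1 : coord hn e b ⟨k', l', 0, 0⟩ ∈ artinKernel (line hn e b k l))
    {w : UGroup (n + 2) e b} (h2 : w ∉ artinKernel (line hn e b k l)) :
    artinKernel (line hn e b k l) = line hn e b k' l' := by
  have hle : line hn e b k' l' ≤ artinKernel (line hn e b k l) := by
    rw [line_eq_closure hn e b hkl, Subgroup.closure_le]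
    rintro _ (rfl | ⟨⟨i, j, r, s⟩, ⟨rfl, rfl, -⟩, rfl⟩)
    · exact h1
    · exact Abelianization.commutator_subset_ker _ (mem_commutator hn e b r s)
  by_contra hne
  have := (isCoatom_line hn e b hkl).2 _ (lt_of_le_of_ne hle (Ne.symm hne))
  rw [this] at h2
  exact h2 (Subgroup.mem_top _)

theorem coord_mul_coord_mk (i j i' j' : ℤ) : ∃ r s, (⟨i, j, 0, 0⟩ * ⟨i', j', 0, 0⟩ : Model n)
    = ⟨i + i', j + j', r, s⟩ := ⟨_, _, mul_def _ _⟩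

theorem mem_artinKernel_of_congr {k l i j : ℤ} {r r' : CycR n} {s s' : ZMod 3}
    (h : coord hn e b ⟨i, j, r, s⟩ ∈ artinKernel (line hn e b k l)) :
    coord hn e b ⟨i, j, r', s'⟩ ∈ artinKernel (line hn e b k l) := by
  have h1 := (artinKernel (line hn e b k l)).mul_mem h
    (Abelianization.commutator_subset_ker _ (mem_commutator hn e b (r' - r) (s' - s)))
  rw [← map_mul] at h1
  have h2 : (⟨i, j, r, s⟩ * ⟨0, 0, r' - r, s' - s⟩ : Model n) = ⟨i, j, r', s'⟩ := by
    simp [mul_def, z_zero]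
  rwa [h2] at h1

/-- The transfer to `⟨y, G'⟩` has kernel `⟨x, G'⟩`. -/
theorem artinKernel_zero_one : artinKernel (line hn e b 0 1) = line hn e b 1 0 := by
  refine artinKernel_line_eq hn e b (by decide) ?_ (w := coord hn e b ⟨1, 1, 0, 0⟩) ?_
  · rw [mem_artinKernel hn e b (coord_not_mem_line hn e b (by dsimp only; decide)),
      coord_pow_three_of_eq, mem_commutator_line hn e b (by decide)]
    refine ⟨(1 + D) ^ 2 + (b : CycR n) * D ^ (n - 1), ?_, by simp⟩
    obtain ⟨m, rfl⟩ := Nat.exists_eq_add_of_le' (show 1 ≤ n by lia)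
    rw [br_one, xCube, Nat.add_sub_cancel]
    push_cast; ring
  · rw [mem_artinKernel hn e b (coord_not_mem_line hn e b (by dsimp only; decide)),
      coord_pow_three_of_ne hn e b (by dsimp only; decide), mem_commutator_line hn e b (by decide)]
    rintro ⟨r, -, h⟩
    revert h
    simp only [Int.cast_one, Int.cast_zero, zero_mul]
    decide

theorem br_mul_self {δ : ℤ} (hδ : δ = 1 ∨ δ = -1) :
    ∃ r : CycR n, br δ * r = 1 ∧ eps r = δ := by
  rcases hδ with rfl | rfl
  · exact ⟨1, by rw [br_one, one_mul], by simp⟩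
  · refine ⟨-(1 + D), ?_, ?_⟩
    · rw [br_neg_one]; linear_combination (-1 : CycR n) * (D_sq : (D ^ 2 : CycR n) = _)
    · rw [map_neg, map_add, map_one, eps_D]; simp

/-- The transfers to `⟨xy, G'⟩` and `⟨xy⁻¹, G'⟩` have fixed points as kernels. The transfer of
`x * y ^ δ` is the class of `x³ * y ^ (3 * δ)`, and the factor `s₃ ^ δ` of `y ^ (3 * δ)` is what
makes it a commutator; the class of `x³` alone is nontrivial for the lack of this factor. -/
theorem artinKernel_one_pm {δ : ℤ} (hδ : δ = 1 ∨ δ = -1) :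
    artinKernel (line hn e b 1 δ) = line hn e b 1 δ := by
  have hne : ((1 : ℤ) : ZMod 3) ≠ 0 ∨ (δ : ZMod 3) ≠ 0 := Or.inl (by decide)
  have hδ2 : (δ : ZMod 3) * δ = 1 := by rcases hδ with rfl | rfl <;> decide
  have hδ0 : (δ : ZMod 3) ≠ 0 := by rcases hδ with rfl | rfl <;> decide
  have hx : coord hn e b ⟨1, 0, 0, 0⟩ ∉ line hn e b 1 δ := by
    apply coord_not_mem_line
    simpa using hδ0
  have hy : coord hn e b ⟨0, δ, 0, 0⟩ ∉ line hn e b 1 δ := by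
    apply coord_not_mem_line
    simpa using hδ0
  obtain ⟨m, hm⟩ := Nat.exists_eq_add_of_le' (show 2 ≤ n by lia)
  refine artinKernel_line_eq hn e b hne ?_ (w := coord hn e b ⟨1, 0, 0, 0⟩) ?_
  · obtain ⟨r, s, hrs⟩ := coord_mul_coord_mk (n := n) 1 0 0 δ
    rw [add_zero, zero_add] at hrs
    apply mem_artinKernel_of_congr hn e b (r := r) (s := s)
    rw [← hrs, map_mul, mul_mem_artinKernel hn e b hx hy, coord_pow_three_of_eq,
      coord_pow_three_of_ne hn e b hδ0, ← map_mul, mk_mul_mk, mem_commutator_line hn e b hne]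
    obtain ⟨u, hu, hu'⟩ := br_mul_self (n := n) hδ
    refine ⟨u * ((1 + D) ^ 2 + ((b : CycR n) + (δ : CycR n) * (e : CycR n)) * D ^ (m + 1)), ?_, ?_⟩
    · have : (D : CycR n) ^ n = D ^ (m + 2) := by rw [hm]
      rw [xCube, this]
      push_cast
      linear_combination (-(D * ((1 + D) ^ 2
        + ((b : CycR n) + (δ : CycR n) * (e : CycR n)) * D ^ (m + 1)))) * hu
    · simp [hu', eps_D]
  · rw [mem_artinKernel hn e b hx, coord_pow_three_of_eq, mem_commutator_line hn e b hne]
    rintro ⟨r, h1, h2⟩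
    have h3 : (D : CycR n) ^ 1 * (br δ * r - (1 + D) ^ 2 - (b : CycR n) * D ^ (m + 1)) = 0 := by
      have : (D : CycR n) ^ n = D ^ (m + 2) := by rw [hm]
      rw [xCube, this] at h1
      push_cast at h1
      linear_combination -h1
    have h4 := D_pow_mul_eq_zero (by lia) h3
    simp only [map_sub, map_mul, map_pow, map_add, map_one, eps_D, eps_br] at h4
    simp only [Int.cast_one, one_mul] at h2
    rw [← h2] at h4
    simp at h4

/-- In the numbering `⟨x, G'⟩, ⟨x * y ^ δ, G'⟩, ⟨x * y ^ -δ, G'⟩, ⟨y, G'⟩` of the maximal subgroups,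
the last three entries of the transfer kernel type do not depend on `e` and `b`. -/
theorem hasTKT {δ : ℤ} (hδ : δ = 1 ∨ δ = -1) (κ : Fin 5)
    (h : artinKernel (line hn e b 1 0) = (Fin.cons ⊤ ![line hn e b 1 0, line hn e b 1 δ,
      line hn e b 1 (-δ), line hn e b 0 1] : Fin 5 → Subgroup _) κ) :
    HasTKT (UGroup (n + 2) e b) ![κ, 2, 3, 1] := by
  have hne : ∀ {k l k' l' : ℤ}, ((k * l' - l * k' : ℤ) : ZMod 3) ≠ 0 →
      line hn e b k l ≠ line hn e b k' l' := by
    intro k l k' l' h heq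
    have h1 : coord hn e b ⟨k', l', 0, 0⟩ ∈ line hn e b k' l' := by
      rw [coord_mem_line]; dsimp only; ring
    rw [← heq, coord_mem_line] at h1
    apply h
    push_cast
    exact h1
  have hδ' : -δ = 1 ∨ -δ = -1 := by lia
  refine ⟨![line hn e b 1 0, line hn e b 1 δ, line hn e b 1 (-δ), line hn e b 0 1], ?_, ?_, ?_⟩
  · have h1 : line hn e b 1 0 ≠ line hn e b 1 δ := hne (by rcases hδ with rfl | rfl <;> decide)
    have h2 : line hn e b 1 0 ≠ line hn e b 1 (-δ) := hne (by rcases hδ with rfl | rfl <;> decide)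
    have h3 : line hn e b 1 0 ≠ line hn e b 0 1 := hne (by decide)
    have h4 : line hn e b 1 δ ≠ line hn e b 1 (-δ) := hne (by rcases hδ with rfl | rfl <;> decide)
    have h5 : line hn e b 1 δ ≠ line hn e b 0 1 := hne (by rcases hδ with rfl | rfl <;> decide)
    have h6 : line hn e b 1 (-δ) ≠ line hn e b 0 1 :=
      hne (by rcases hδ with rfl | rfl <;> decide)
    intro i j hij
    fin_cases i <;> fin_cases j <;> first
      | rfl
      | exact absurd hij h1
      | exact absurd hij h2
      | exact absurd hij h3
      | exact absurd hij h4
      | exact absurd hij h5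
      | exact absurd hij h6
      | exact absurd hij.symm h1
      | exact absurd hij.symm h2
      | exact absurd hij.symm h3
      | exact absurd hij.symm h4
      | exact absurd hij.symm h5
      | exact absurd hij.symm h6
  · intro M
    rw [isCoatom_iff hn e b, Fin.exists_fin_succ, Fin.exists_fin_succ, Fin.exists_fin_two]
    rcases hδ with rfl | rfl
    · simp only [Matrix.cons_val_zero, Matrix.cons_val_succ, Matrix.cons_val_one, eq_comm (b := M)]
      tauto
    · simp only [Matrix.cons_val_zero, Matrix.cons_val_succ, Matrix.cons_val_one, eq_comm (b := M),
        neg_neg]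
      tauto
  · intro i
    fin_cases i
    · exact ⟨line_finiteIndex hn e b 1 0, h⟩
    · exact ⟨line_finiteIndex hn e b 1 δ, artinKernel_one_pm hn e b hδ⟩
    · exact ⟨line_finiteIndex hn e b 1 (-δ), artinKernel_one_pm hn e b hδ'⟩
    · exact ⟨line_finiteIndex hn e b 0 1, artinKernel_zero_one hn e b⟩

/-- The transfer to `⟨x, G'⟩` maps `x ^ i * y ^ j`, with `j` prime to `3`, to the class of
`t_c ^ (i * b + j * e)`. -/
theorem mem_artinKernel_one_zero {g : Model n} (hj : (g.j : ZMod 3) ≠ 0) :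
    coord hn e b g ∈ artinKernel (line hn e b 1 0) ↔
      (g.i : ZMod 3) * (b : ZMod 3) + (g.j : ZMod 3) * (e : ZMod 3) = 0 := by
  rw [mem_artinKernel hn e b (coord_not_mem_line hn e b (by simpa using hj)),
    coord_pow_three_of_ne hn e b hj, mem_commutator_line hn e b (by decide)]
  have h1 : ((g.i : CycR n) * (b : CycR n) + (g.j : CycR n) * (e : CycR n)) * D ^ n = 0 ↔
      (g.i : ZMod 3) * (b : ZMod 3) + (g.j : ZMod 3) * (e : ZMod 3) = 0 := by
    rw [mul_comm, D_pow_mul_eq_zero_iff]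
    simp
  rw [← h1, br_zero]
  constructor
  · rintro ⟨r, hr, -⟩
    rw [hr, mul_zero, zero_mul]
  · intro h
    exact ⟨((g.i * g.i * g.j + g.j : ℤ) : CycR n), by rw [h]; ring, by simp⟩

theorem hasTKT_c21 (hn : 3 ≤ n) : HasTKT (UGroup (n + 2) 0 0) tktC21 := by
  refine hasTKT hn 0 0 (δ := 1) (Or.inl rfl) 0 ?_
  have hy : coord hn 0 0 ⟨0, 1, 0, 0⟩ ∈ artinKernel (line hn 0 0 1 0) := by
    rw [mem_artinKernel_one_zero hn 0 0 (by dsimp only; decide)]; simp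
  have hxy : coord hn 0 0 (⟨1, 0, 0, 0⟩ * ⟨0, 1, 0, 0⟩) ∈ artinKernel (line hn 0 0 1 0) := by
    rw [mem_artinKernel_one_zero hn 0 0 (by simp [mul_def])]; simp
  -- `x` lies in `⟨x, G'⟩`, so that its transfer is computed from `x = (x * y) * y⁻¹`.
  have hx : coord hn 0 0 ⟨1, 0, 0, 0⟩ ∈ artinKernel (line hn 0 0 1 0) := by
    have := Subgroup.mul_mem _ hxy (Subgroup.inv_mem _ hy)
    rwa [map_mul, mul_inv_cancel_right] at this
  have htop : (artinKernel (line hn 0 0 1 0)).comap (coord hn 0 0) = ⊤ := eq_top_of_mem hx hy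
  change _ = ⊤
  rw [eq_top_iff]
  intro u _
  obtain ⟨g, rfl⟩ := coord_surjective hn 0 0 u
  have : g ∈ (artinKernel (line hn 0 0 1 0)).comap (coord hn 0 0) := htop ▸ Subgroup.mem_top g
  exact this

theorem hasTKT_g16 (hn : 3 ≤ n) {b : ℕ} (hb : (b : ZMod 3) ≠ 0) :
    HasTKT (UGroup (n + 2) 0 b) tktG16 := by
  refine hasTKT hn 0 b (δ := 1) (Or.inl rfl) 4 ?_
  refine artinKernel_line_eq hn 0 b (w := coord hn 0 b ⟨1, 1, 0, 0⟩) (k' := 0) (l' := 1)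
    (by decide) ?_ ?_
  · rw [mem_artinKernel_one_zero hn 0 b (by dsimp only; decide)]; simp
  · rw [mem_artinKernel_one_zero hn 0 b (by dsimp only; decide)]; simpa using hb

theorem hasTKT_e8 (hn : 3 ≤ n) : HasTKT (UGroup (n + 2) 1 0) tktE8 := by
  refine hasTKT hn 1 0 (δ := 1) (Or.inl rfl) 1 ?_
  refine artinKernel_line_eq hn 1 0 (w := coord hn 1 0 ⟨0, 1, 0, 0⟩) (k' := 1) (l' := 0)
    (by decide) ?_ ?_
  -- `x` lies in `⟨x, G'⟩`, so that its transfer is computed from `x = (x * y) * y⁻¹`.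
  · have h1 : (⟨1, 0, 0, 0⟩ : Model n) = (⟨1, 1, 0, 0⟩ : Model n) * ⟨0, -1, 0, 0⟩ := by
      simp [mul_def]
    rw [h1, map_mul, mul_mem_artinKernel hn 1 0
      (coord_not_mem_line hn 1 0 (by dsimp only; decide))
      (coord_not_mem_line hn 1 0 (by dsimp only; decide)),
      coord_pow_three_of_ne hn 1 0 (by dsimp only; decide),
      coord_pow_three_of_ne hn 1 0 (by dsimp only; decide), ← map_mul, mk_mul_mk,
      mem_commutator_line hn 1 0 (by decide)]
    refine ⟨1, ?_, ?_⟩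
    · rw [br_zero]; push_cast; ring
    · rw [map_one]; dsimp only; decide
  · rw [mem_artinKernel_one_zero hn 1 0 (by dsimp only; decide)]; simp

/-- The case of kernel `⟨x * y ^ δ, G'⟩` with `b + δ = 0`. -/
theorem hasTKT_e9 (hn : 3 ≤ n) {b : ℕ} {δ : ℤ} (hδ : δ = 1 ∨ δ = -1)
    (hb : (b : ZMod 3) + δ = 0) :
    HasTKT (UGroup (n + 2) 1 b) tktE9 := by
  have hδ0 : (δ : ZMod 3) ≠ 0 := by rcases hδ with rfl | rfl <;> decide
  refine hasTKT hn 1 b hδ 2 ?_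
  refine artinKernel_line_eq hn 1 b (w := coord hn 1 b ⟨0, 1, 0, 0⟩) (k' := 1) (l' := δ)
    (Or.inl (by decide)) ?_ ?_
  · rw [mem_artinKernel_one_zero hn 1 b hδ0]; simpa using hb
  · rw [mem_artinKernel_one_zero hn 1 b (by dsimp only; decide)]; simp

end UGroup

/-! ### Isomorphisms between the groups -/

/-- The identity `-3 = ζ² * (ζ - 1)²` for the root of unity `ζ = ζ₃ ^ l`. Together with `mul_br_eq`
it carries the relations from `x` and `y` over to `x ^ i` and `y ^ l`. -/
theorem EisInt.neg_three_eq : ∀ l : ZMod 3, l ≠ 0 → (D * br l) * (D * br l) * (z l * z l) = -3 := by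
  decide

theorem EisInt.mul_br_eq : ∀ l : ZMod 3, l ≠ 0 →
    (D * br l) * (z l * z l) * br l = D * ((1 + D) * (1 + D)) := by decide

namespace CycR

variable {n : ℕ}

theorem D_mul_br_sq_mul {l : ℤ} (hl : (l : ZMod 3) ≠ 0) :
    ((D * br l) * (D * br l) * (z l * z l) : CycR n) = -3 := by
  have h := congrArg (mk : EisInt → CycR n) (EisInt.neg_three_eq l hl)
  simpa only [map_mul, map_neg, map_ofNat, D, br, z] using h

theorem D_mul_br_mul {l : ℤ} (hl : (l : ZMod 3) ≠ 0) :
    ((D * br l) * (z l * z l) * br l : CycR n) = D * ((1 + D) * (1 + D)) := by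
  have h := congrArg (mk : EisInt → CycR n) (EisInt.mul_br_eq l hl)
  simpa only [map_mul, map_add, map_one, D, br, z] using h

theorem mul_D_pow_eq_iff {r r' : CycR n} : r * D ^ n = r' * D ^ n ↔ eps r = eps r' := by
  rw [← sub_eq_zero, ← sub_mul, mul_comm, D_pow_mul_eq_zero_iff, map_sub, sub_eq_zero]

end CycR

namespace UGroup

open CycR Model

variable {n : ℕ} (hn : 3 ≤ n) (e b : ℕ)

/-- The elements `t_j` of a tuple satisfying the relations, in terms of `t₂`. -/
theorem tuple_t_eq {e' b' : ℕ} {Y' X' S' : UGroup (n + 2) e b}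
    {t' : ℕ → UGroup (n + 2) e b} (h : IsUTuple (n + 2) e' b' X' Y' S' t') {g : Model n}
    (hY : Y' = coord hn e b g) {u : CycR n} {s : ZMod 3} (ht : t' 2 = coord hn e b ⟨0, 0, u, s⟩)
    (m : ℕ) : ∃ s', t' (m + 2) = coord hn e b ⟨0, 0, (D * br g.j) ^ m * u, s'⟩ ∧
      (2 ≤ m → s' = 0) := by
  induction m with
  | zero => exact ⟨s, by rw [ht, pow_zero, one_mul], by lia⟩
  | succ m ih =>
    obtain ⟨s', h1, h2⟩ := ih
    refine ⟨_, by rw [h.t_succ _ (by lia), h1, hY, ← map_pcComm, comm_mk, pow_succ',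
      mul_assoc (D * _)], fun hm => ?_⟩
    rw [map_mul, map_pow, map_mul, eps_D, zero_mul, zero_pow (by lia)]
    ring

/-- An embedding of `G(c; e', b')` in `G(c; e, b)` maps `x` and `y` to elements congruent to `x ^ i`
and `y ^ l` modulo the derived subgroup, and the signs `i` and `l` determine `e` and `b` from `e'`
and `b'`: the relations for `x³` and `y³` are compared at `t_c`, which is mapped to
`t_c ^ (i * l ^ (c - 1))`. -/
theorem exists_sign_of_injective {e' b' : ℕ} (φ : UGroup (n + 2) e' b' →* UGroup (n + 2) e b)
    (hφ : Function.Injective φ) : ∃ i l : ℤ, (i = 1 ∨ i = -1) ∧ (l = 1 ∨ l = -1) ∧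
      (e : ZMod 3) = e' * i * l ^ n ∧ (b : ZMod 3) = b' * l ^ (n + 1) ∧
      (∀ u v, chi (show 5 ≤ n + 2 by lia) e b u v (φ (X _ _ _)) = Multiplicative.ofAdd (u * i)) ∧
      ∀ u v, chi (show 5 ≤ n + 2 by lia) e b u v (φ (Y _ _ _)) = Multiplicative.ofAdd (v * l) := by
  have h := (isUTuple (c := n + 2) (e := e') (b := b') (by lia)).map φ
  have hlast : φ (t (n + 2) e' b' (n + 2)) ≠ 1 := fun h1 =>
    t_last_ne_one hn e' b' (hφ (h1.trans (map_one φ).symm))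
  obtain ⟨i, j, α, sx, hi, hj, hX⟩ := exists_coord_reduced hn e b (φ (X _ _ _))
  obtain ⟨k, l, β, sy, hk, hl, hY⟩ := exists_coord_reduced hn e b (φ (Y _ _ _))
  have ht2 := h.t_two
  rw [hX, hY, ← map_pcComm, pcComm_def] at ht2
  dsimp only at ht2
  set u : CycR n := z j * ((i : CycR n) * br l) - z l * ((k : CycR n) * br j) + (z j - 1) * β
    - (z l - 1) * α with hu
  have hepsu : eps u = i * l - k * j := by
    simp only [hu, map_sub, map_add, map_mul, eps_z, eps_br, map_one, map_intCast]; ring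
  have ht := tuple_t_eq hn e b h hY ht2
  dsimp only at ht
  -- `D ^ n` is annihilated by `D`, so that only the residue class `l` of `br l` matters.
  have hpow : (D * br l : CycR n) ^ n * u = ((l : CycR n) ^ n * u) * D ^ n := by
    have : (D * br l : CycR n) ^ n * u = ((br l : CycR n) ^ n * u) * D ^ n := by rw [mul_pow]; ring
    rw [this, mul_D_pow_eq_iff]
    simp only [map_mul, map_pow, eps_br, map_intCast]
  obtain ⟨s2, htc, hs2⟩ := ht n
  obtain rfl := hs2 (by lia)
  rw [hpow] at htc
  have hepslu : (l : ZMod 3) ^ n * eps u ≠ 0 := by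
    intro h0
    refine hlast (htc.trans ?_)
    rw [coord_mk_eq_one_iff, mul_comm, D_pow_mul_eq_zero_iff, map_mul, map_pow, map_intCast]
    exact ⟨h0, rfl⟩
  have hl0 : (l : ZMod 3) ≠ 0 := by
    rintro h0
    rw [h0, zero_pow (by lia), zero_mul] at hepslu
    exact hepslu rfl
  have hu0 : eps u ≠ 0 := right_ne_zero_of_mul hepslu
  obtain ⟨s3, ht3, -⟩ := ht 1
  rw [pow_one] at ht3
  obtain ⟨s4, ht4, hs4⟩ := ht 2
  obtain rfl := hs4 le_rfl
  obtain ⟨s5, ht5, hs5⟩ := ht 3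
  obtain rfl := hs5 (by lia)
  -- `t₃'` commutes with `x'`, while `y` acts on `t₃'` with a nontrivial commutator.
  have hj0 : j = 0 := by
    have h1 := h.t_x 3 le_rfl
    rw [ht3, hX, ← pcComm_eq_one_iff, ← map_pcComm, comm_mk, coord_mk_eq_one_iff] at h1
    have h2 := D_pow_mul_eq_zero (n := n) (k := 2) (r := br j * (br l * u)) (by lia)
      (by rw [← h1.1]; ring)
    rw [map_mul, map_mul, eps_br, eps_br] at h2
    have h3 : (j : ZMod 3) = 0 :=
      (mul_eq_zero.1 h2).resolve_right (mul_ne_zero hl0 hu0)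
    rcases hj with rfl | rfl | rfl
    · exact absurd h3 (by decide)
    · rfl
    · exact absurd h3 (by decide)
  subst hj0
  have hi' : i = 1 ∨ i = -1 := by
    rcases hi with rfl | rfl | rfl
    · exact Or.inr rfl
    · exact absurd (by rw [hepsu]; simp) hu0
    · exact Or.inl rfl
  have hl' : l = 1 ∨ l = -1 := by
    rcases hl with rfl | rfl | rfl
    · exact Or.inr rfl
    · exact absurd rfl hl0
    · exact Or.inl rfl
  have hii : (i : ZMod 3) * i = 1 := by rcases hi' with rfl | rfl <;> decide
  have hll : (l : ZMod 3) * l = 1 := by rcases hl' with rfl | rfl <;> decide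
  rw [Int.cast_zero, mul_zero, sub_zero] at hepsu
  -- The relation for `y³` excludes a factor `x ^ k`, whose contribution to the cube is a power
  -- of `s₃`.
  have hS : φ (S _ _ _) = coord hn e b ⟨0, 0, 0, l⟩ := by
    rw [h.s_eq, ht2, hX, ← map_pcComm, comm_mk, br_zero, mul_zero, zero_mul, hepsu, ← mul_assoc,
      hii, one_mul]
  have hy := h.y_pow
  rw [hY, coord_pow_three_of_ne hn e b hl0, hS, htc, ← map_pow, ← map_mul, pow_mk, mk_mul_mk] at hy
  obtain ⟨hy1, hy2⟩ := coord_mk_inj hn e b hy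
  dsimp only at hy1 hy2
  have hk0 : k = 0 := by
    have h1 : (k : ZMod 3) * k * l = 0 := by linear_combination hy2
    rcases hk with rfl | rfl | rfl
    · exact absurd h1 (by simpa using hl0)
    · rfl
    · exact absurd h1 (by simpa using hl0)
  subst hk0
  rw [zero_add, ← mul_assoc, mul_D_pow_eq_iff] at hy1
  -- In the relation for `x³`, the components of `x'` and `y'` in the derived subgroup cancel.
  have hx := h.x_pow
  rw [hX, coord_pow_three_of_eq, htc, ht3, ht4, ht5, ← map_pow, ← map_pow, ← map_mul, ← map_mul,
    ← map_mul, pow_mk, pow_mk, mk_mul_mk, mk_mul_mk, mk_mul_mk] at hx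
  obtain ⟨hx1, -⟩ := coord_mk_inj hn e b hx
  have hx2 : ((i : CycR n) * (b : CycR n)) * D ^ n
      = ((b' : CycR n) * ((l : CycR n) ^ n * u)) * D ^ n := by
    have hz : (z l : CycR n) = 1 + D * br l := z_eq l
    have h1 : (z l - 1 : CycR n) = D * br l := by rw [hz]; ring
    have h2 := D_mul_br_sq_mul (n := n) hl0
    have h3 := D_mul_br_mul (n := n) hl0
    rw [h1, z_zero, br_zero] at hu
    rw [hz] at h2 h3
    rw [xCube] at hx1
    push_cast at hx1
    generalize hw : (D * br l : CycR n) = w at *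
    rw [hu] at hx1 ⊢
    push_cast at hx1 ⊢
    linear_combination hx1 + (i : CycR n) * h3 - α * h2
  rw [mul_D_pow_eq_iff] at hx2
  simp only [map_add, map_mul, map_natCast, map_intCast, map_pow, hepsu, Int.cast_zero,
    map_zero] at hy1 hx2
  refine ⟨i, l, hi', hl', ?_, ?_, ?_, ?_⟩
  · linear_combination (l : ZMod 3) * hy1 + ((e' : ZMod 3) * i * l ^ n - e) * hll
  · rw [pow_succ]
    linear_combination (i : ZMod 3) * hx2 + ((b' : ZMod 3) * l ^ n * l - b) * hii
  · intro u v
    rw [hX, chi_coord]; simp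
  · intro u v
    rw [hY, chi_coord]; simp

/-- The assignment `x ↦ x ^ i`, `y ↦ y ^ l`, for signs `i` and `l`. -/
theorem exists_sign_hom (hn : 3 ≤ n) (e b : ℕ) {e' b' : ℕ} {i l : ℤ} (hi : i = 1 ∨ i = -1)
    (hl : l = 1 ∨ l = -1)
    (he : (e : ZMod 3) = e' * i * l ^ n) (hb : (b : ZMod 3) = b' * l ^ (n + 1)) :
    ∃ φ : UGroup (n + 2) e' b' →* UGroup (n + 2) e b,
      φ (X _ _ _) = X _ _ _ ^ i ∧ φ (Y _ _ _) = Y _ _ _ ^ l := by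
  have hl0 : (l : ZMod 3) ≠ 0 := by rcases hl with rfl | rfl <;> decide
  have hii : (i : ZMod 3) * i = 1 := by rcases hi with rfl | rfl <;> decide
  have hll : (l : ZMod 3) * l = 1 := by rcases hl with rfl | rfl <;> decide
  have hXi : X (n + 2) e b ^ i = coord hn e b ⟨i, 0, 0, 0⟩ := by
    rw [← coord_x hn, ← map_zpow, x_zpow]
  have hYl : Y (n + 2) e b ^ l = coord hn e b ⟨0, l, 0, 0⟩ := by
    rw [← coord_y hn, ← map_zpow, y_zpow]
  set u : CycR n := (i : CycR n) * br l with hu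
  -- Only the image `[y ^ l, x ^ i]` of `t₂` has a component at `s₃`.
  let s : ℕ → ZMod 3 := fun j => if j = 2 then l * (2 * i * (i - 1)) else 0
  have hs : ∀ j, 2 < j → s j = 0 := fun j hj => if_neg (by lia)
  have hpow : (D * br l : CycR n) ^ n * u
      = ((l : CycR n) ^ n * ((i : CycR n) * (l : CycR n))) * D ^ n := by
    have : (D * br l : CycR n) ^ n * u = ((br l : CycR n) ^ n * u) * D ^ n := by rw [mul_pow]; ring
    rw [this, mul_D_pow_eq_iff]
    simp only [map_mul, map_pow, eps_br, map_intCast, hu]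
  have htup : IsUTuple (n + 2) e' b' (X (n + 2) e b ^ i) (Y (n + 2) e b ^ l)
      (coord hn e b ⟨0, 0, 0, l⟩)
      (fun j => coord hn e b ⟨0, 0, (D * br l) ^ (j - 2) * u, s j⟩) := by
    rw [hXi, hYl]
    refine ⟨?_, ?_, ?_, ?_, ?_, ?_, ?_, ?_, ?_, ?_, ?_, ?_, ?_⟩
    · rw [← map_pcComm, pcComm_def]
      simp [z_zero, br_zero, s, hu]
    · rw [← map_pcComm, comm_mk]
      simp only [hu, br_zero, map_mul, eps_br, map_intCast, Nat.sub_self, pow_zero,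
        one_mul, mul_zero, zero_mul]
      rw [← mul_assoc, hii, one_mul]
    · intro j hj
      obtain ⟨m, rfl⟩ := Nat.exists_eq_add_of_le' hj
      rw [← map_pcComm, comm_mk, hs (m + 2 + 1) (by lia), show m + 2 + 1 - 2 = m + 2 - 2 + 1 by lia,
        pow_succ', Int.cast_zero, zero_mul, mul_assoc (D * _)]
    · intro j hj
      rw [mul_pow, D_pow_eq_zero (by lia), zero_mul, zero_mul, hs j (by lia)]
      exact map_one _
    · intro j hj
      obtain ⟨m, rfl⟩ := Nat.exists_eq_add_of_le' hj
      rw [← map_pow, ← map_pow, ← map_mul, pow_mk, pow_mk, mk_mul_mk, hs (m + 2 + 2) (by lia),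
        hs (m + 2 + 3) (by lia), show m + 2 - 2 = m by lia, show m + 2 + 2 - 2 = m + 2 by lia,
        show m + 2 + 3 - 2 = m + 3 by lia]
      have h2 := D_mul_br_sq_mul (n := n) hl0
      have h5 := one_add_z_add_z (n := n) hl0
      rw [two_mul, z_add, z_eq] at h5
      generalize (D * br l : CycR n) = w at *
      congr 2
      · push_cast
        have : (w ^ 2 + 3 + 3 * w : CycR n) = 0 := by linear_combination h5
        linear_combination (-w^m * u * (w - 1)) * this
      · rw [mul_zero, add_zero]
        exact congrArg (· * s (m + 2)) three_eq_zero |>.trans (zero_mul _)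
    · rw [← map_pow, pow_mk]
      have : ((3 : ℕ) : ZMod 3) * l = 0 := zero_mul _
      rw [mul_zero, this]
      exact map_one _
    · rw [coord_pow_three_of_ne hn e b hl0, hs (n + 2) (by lia), ← map_pow, ← map_mul, pow_mk,
        mk_mul_mk, show n + 2 - 2 = n by lia, hpow]
      congr 2
      · rw [zero_add, ← mul_assoc, mul_D_pow_eq_iff]
        simp only [map_add, map_mul, map_natCast, map_intCast, map_pow, Int.cast_zero, map_zero]
        rw [he]; ring
      · simp
    · rw [coord_pow_three_of_eq, hs (n + 2) (by lia), hs 3 (by lia), hs 4 (by lia), hs 5 (by lia),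
        ← map_pow, ← map_pow, ← map_mul, ← map_mul, ← map_mul, pow_mk, pow_mk, mk_mul_mk, mk_mul_mk,
        mk_mul_mk, show n + 2 - 2 = n by lia, hpow]
      have hx2 : ((i : CycR n) * (b : CycR n)) * D ^ n
          = ((b' : CycR n) * ((l : CycR n) ^ n * ((i : CycR n) * (l : CycR n)))) * D ^ n := by
        rw [mul_D_pow_eq_iff]
        simp only [map_mul, map_natCast, map_intCast, map_pow]
        rw [hb]; ring
      have h3 := D_mul_br_mul (n := n) hl0
      rw [z_eq] at h3
      rw [hu, xCube]
      generalize (D * br l : CycR n) = w at *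
      congr 2
      · push_cast
        linear_combination hx2 - (i : CycR n) * h3
    · intro j hj
      obtain ⟨m, rfl⟩ := Nat.exists_eq_add_of_le' hj
      rw [← pcComm_eq_one_iff, ← map_pcComm, comm_mk, br_zero, show m + 3 - 2 = m + 1 by lia]
      simp only [map_mul, map_pow, eps_D, zero_mul, mul_zero, zero_pow (Nat.succ_ne_zero m)]
      exact map_one _
    · rw [← pcComm_eq_one_iff, ← map_pcComm, comm_mk, mul_zero, map_zero, mul_zero]
      exact map_one _
    · rw [← pcComm_eq_one_iff, ← map_pcComm, comm_mk, mul_zero, map_zero, mul_zero]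
      exact map_one _
    · intro j hj
      rw [← pcComm_eq_one_iff, ← map_pcComm, comm_mk_mk, map_one]
    · intro j k hj hk
      rw [← pcComm_eq_one_iff, ← map_pcComm, comm_mk_mk, map_one]
  exact ⟨lift (by lia) htup, lift_X _ _, lift_Y _ _⟩

theorem exists_sign_equiv (hn : 3 ≤ n) (e b : ℕ) {e' b' : ℕ} {i l : ℤ} (hi : i = 1 ∨ i = -1)
    (hl : l = 1 ∨ l = -1)
    (he : (e : ZMod 3) = e' * i * l ^ n) (hb : (b : ZMod 3) = b' * l ^ (n + 1)) :
    ∃ φ : UGroup (n + 2) e' b' ≃* UGroup (n + 2) e b,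
      φ (X _ _ _) = X _ _ _ ^ i ∧ φ (Y _ _ _) = Y _ _ _ ^ l := by
  obtain ⟨φ, hX, hY⟩ := exists_sign_hom hn e b hi hl he hb
  have hsurj : Function.Surjective φ := by
    rw [← MonoidHom.range_eq_top, ← top_le_iff,
      ← closure_gens_eq_top (c := n + 2) (e := e) (b := b) (by lia), Subgroup.closure_le]
    have key : ∀ (K : Subgroup (UGroup (n + 2) e b)) (g : UGroup (n + 2) e b) (k : ℤ),
        k = 1 ∨ k = -1 → g ^ k ∈ K → g ∈ K := by
      rintro K g k (rfl | rfl) h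
      · simpa using h
      · simpa using h
    rintro _ (rfl | rfl)
    · exact key _ _ i hi ⟨_, hX⟩
    · exact key _ _ l hl ⟨_, hY⟩
  have := finite hn e' b'
  have := finite hn e b
  exact ⟨MulEquiv.ofBijective φ ((Nat.bijective_iff_surjective_and_card φ).2
    ⟨hsurj, by rw [card_eq hn, card_eq hn]⟩), hX, hY⟩

/-- In odd class `b` is an invariant, and `e` is one up to sign. -/
theorem eq_of_equiv_of_odd (hn : 3 ≤ n) (hodd : Odd n) {e b e' b' : ℕ} (he : e < 2) (hb : b < 3)
    (he' : e' < 2) (hb' : b' < 3) (h : Nonempty (UGroup (n + 2) e b ≃* UGroup (n + 2) e' b')) :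
    e = e' ∧ b = b' := by
  obtain ⟨φ⟩ := h
  obtain ⟨i, l, hi, hl, h1, h2, -, -⟩ :=
    exists_sign_of_injective hn e' b' φ.toMonoidHom φ.injective
  have h3 : (l : ZMod 3) ^ (n + 1) = 1 := by
    rcases hl with rfl | rfl
    · simp
    · rw [Int.cast_neg, Int.cast_one, hodd.add_one.neg_one_pow]
  have h4 : (i : ZMod 3) * l ^ n = 1 ∨ (i : ZMod 3) * l ^ n = -1 := by
    rcases hl with rfl | rfl <;> rcases hi with rfl | rfl <;> simp [hodd.neg_one_pow]
  rw [h3, mul_one] at h2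
  rw [mul_assoc] at h1
  constructor
  · rcases h4 with h4 | h4 <;> rw [h4] at h1 <;> clear h4 h2 h3 hi hl <;>
      interval_cases e <;> interval_cases e' <;> first | rfl | exact absurd h1 (by decide)
  · clear h1 h3 h4 hi hl
    interval_cases b <;> interval_cases b' <;> first | rfl | exact absurd h2 (by decide)

/-- In every class `e` and `b` are invariants up to sign. -/
theorem eq_of_equiv_of_lt_two (hn : 3 ≤ n) {e b e' b' : ℕ} (he : e < 2) (hb : b < 2) (he' : e' < 2)
    (hb' : b' < 2) (h : Nonempty (UGroup (n + 2) e b ≃* UGroup (n + 2) e' b')) :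
    e = e' ∧ b = b' := by
  obtain ⟨φ⟩ := h
  obtain ⟨i, l, hi, hl, h1, h2, -, -⟩ :=
    exists_sign_of_injective hn e' b' φ.toMonoidHom φ.injective
  have key : ∀ m, (l : ZMod 3) ^ m = 1 ∨ (l : ZMod 3) ^ m = -1 := by
    intro m
    rcases hl with rfl | rfl
    · simp
    · simpa using neg_one_pow_eq_or (ZMod 3) m
  have h4 : (i : ZMod 3) * l ^ n = 1 ∨ (i : ZMod 3) * l ^ n = -1 := by
    rcases key n with h | h <;> rcases hi with rfl | rfl <;> simp [h]
  rw [mul_assoc] at h1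
  constructor
  · rcases h4 with h4 | h4 <;> rw [h4] at h1 <;> clear h4 h2 key hi hl <;>
      interval_cases e <;> interval_cases e' <;> first | rfl | exact absurd h1 (by decide)
  · rcases key (n + 1) with h3 | h3 <;> rw [h3] at h2 <;> clear h1 h3 h4 hi hl key <;>
      interval_cases b <;> interval_cases b' <;> first | rfl | exact absurd h2 (by decide)

/-- The isomorphism is `x ↦ x`, `y ↦ y⁻¹`. -/
theorem nonempty_equiv_of_even (hn : 3 ≤ n) (heven : Even n) (e : ℕ) :
    Nonempty (UGroup (n + 2) e 1 ≃* UGroup (n + 2) e 2) := by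
  obtain ⟨φ, -⟩ := exists_sign_equiv hn e 2 (e' := e) (b' := 1) (i := 1) (l := -1) (Or.inl rfl)
    (Or.inr rfl) (by simp [heven.neg_one_pow]) (by
      rw [Int.cast_neg, Int.cast_one, heven.add_one.neg_one_pow]; decide)
  exact ⟨φ⟩

end UGroup

/-! ### Automorphisms acting as inversion on the first cohomology group -/

section cohomology

open groupCohomology

variable {p : ℕ} {G : Type} [Group G] (σ : MulAut G)

/-- The first cohomology group with trivial coefficients consists of the characters. -/
theorem invertsCohomology_one_iff : InvertsCohomology p σ 1 ↔
    ∀ (χ : G →* Multiplicative (ZMod p)) (g : G), χ (σ g) = (χ g)⁻¹ := by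
  constructor
  · intro h χ g
    let x : cocycles₁ (Rep.trivial (ZMod p) G (ZMod p)) :=
      ⟨fun g => (χ g).toAdd, mem_cocycles₁_of_addMonoidHom
        (A := Rep.trivial (ZMod p) G (ZMod p)) (MonoidHom.toAdditive χ)⟩
    have h1 := h (H1π _ x)
    erw [H1π_comp_map_apply] at h1
    rw [← map_neg, H1π_eq_iff, coboundaries₁_eq_bot_of_isTrivial, Submodule.mem_bot] at h1
    have h2 : (χ (σ g)).toAdd - (-(χ g).toAdd) = 0 := congrFun h1 g
    exact Multiplicative.toAdd.injective (sub_eq_zero.1 h2)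
  · intro h z
    induction z using H1_induction_on with | @h x => ?_
    erw [H1π_comp_map_apply]
    rw [← map_neg]
    congr 1
    refine cocycles₁_ext fun g => ?_
    let χ : G →* Multiplicative (ZMod p) :=
      { toFun := fun g => Multiplicative.ofAdd (x g)
        map_one' := congrArg Multiplicative.ofAdd (cocycles₁_map_one x)
        map_mul' := fun a b => congrArg Multiplicative.ofAdd
          (((mem_cocycles₁_iff x).1 x.2 a b).trans (add_comm _ _)) }
    exact h χ g

/-- Inversion on the second cohomology group, in terms of cocycles: the sum of a cocycle and its
image under `σ` is a coboundary. -/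
theorem invertsCohomology_two
    (h : ∀ f : G × G → ZMod p, (∀ g h j, f (g * h, j) + f (g, h) = f (h, j) + f (g, h * j)) →
      ∃ u : G → ZMod p, ∀ g h, f (σ g, σ h) + f (g, h) = u g + u h - u (g * h)) :
    InvertsCohomology p σ 2 := by
  intro z
  induction z using H2_induction_on with | @h x => ?_
  erw [H2π_comp_map_apply]
  rw [← map_neg, H2π_eq_iff]
  obtain ⟨u, hu⟩ := h x ((mem_cocycles₂_iff x).1 x.2)
  refine ⟨u, ?_⟩
  ext ⟨g, j⟩
  have h1 : u j - u (g * j) + u g = x (σ g, σ j) - (-x (g, j)) := by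
    rw [sub_neg_eq_add, hu]; ring
  exact h1

end cohomology

namespace UGroup

variable {n : ℕ}

/-- The automorphism `x ↦ x⁻¹`, `y ↦ y⁻¹`. -/
theorem exists_inverting_aut (hn : 3 ≤ n) {e b : ℕ} (h : Odd n ∨ (e = 0 ∧ b = 0)) :
    ∃ σ : MulAut (UGroup (n + 2) e b), σ (X _ _ _) = (X _ _ _)⁻¹ ∧ σ (Y _ _ _) = (Y _ _ _)⁻¹ := by
  obtain ⟨σ, hX, hY⟩ := exists_sign_equiv hn e b (e' := e) (b' := b) (i := -1) (l := -1)
    (Or.inr rfl) (Or.inr rfl) (by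
      rcases h with h | ⟨rfl, rfl⟩
      · simp [h.neg_one_pow]
      · simp) (by
      rcases h with h | ⟨rfl, rfl⟩
      · simp [h.add_one.neg_one_pow]
      · simp)
  exact ⟨σ, by rw [hX, zpow_neg_one], by rw [hY, zpow_neg_one]⟩

variable {e b : ℕ} {σ : MulAut (UGroup (n + 2) e b)}

theorem orderOf_inverting (hn : 3 ≤ n) (hX : σ (X _ _ _) = (X _ _ _)⁻¹)
    (hY : σ (Y _ _ _) = (Y _ _ _)⁻¹) : orderOf σ = 2 := by
  refine orderOf_eq_prime ?_ ?_
  · have : (σ ^ 2).toMonoidHom = MonoidHom.id _ := by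
      refine hom_ext (by lia) ?_ ?_
      · change σ (σ (X _ _ _)) = X _ _ _
        rw [hX, map_inv, hX, inv_inv]
      · change σ (σ (Y _ _ _)) = Y _ _ _
        rw [hY, map_inv, hY, inv_inv]
    ext g
    exact DFunLike.congr_fun this g
  · rintro rfl
    have h1 := congrArg (chi (show 5 ≤ n + 2 by lia) e b 1 0) hX
    rw [map_inv, MulAut.one_apply, ← coord_x hn, chi_coord] at h1
    revert h1
    simp only [Int.cast_one, Int.cast_zero]
    decide

theorem invertsCohomology_one_of_inverting (hn : 3 ≤ n) (hX : σ (X _ _ _) = (X _ _ _)⁻¹)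
    (hY : σ (Y _ _ _) = (Y _ _ _)⁻¹) : InvertsCohomology 3 σ 1 := by
  rw [invertsCohomology_one_iff]
  intro χ g
  have : χ.comp σ.toMonoidHom = χ⁻¹ := by
    refine hom_ext (by lia) ?_ ?_
    · change χ (σ _) = (χ _)⁻¹
      rw [hX, map_inv]
    · change χ (σ _) = (χ _)⁻¹
      rw [hY, map_inv]
  exact DFunLike.congr_fun this g

theorem hasGeneratorInvertingAut_of_odd (hn : 3 ≤ n) (hodd : Odd n) (e b : ℕ) :
    HasGeneratorInvertingAut 3 (UGroup (n + 2) e b) := by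
  obtain ⟨σ, hX, hY⟩ := exists_inverting_aut hn (e := e) (b := b) (Or.inl hodd)
  exact ⟨σ, orderOf_inverting hn hX hY, invertsCohomology_one_of_inverting hn hX hY⟩

/-- In even class the relations for `x³` and `y³` obstruct the inversion of `x` and `y` modulo the
derived subgroup, unless they do not involve `t_c`. -/
theorem eq_zero_of_hasGeneratorInvertingAut (hn : 3 ≤ n) (heven : Even n) (he : e < 2) (hb : b < 3)
    (h : HasGeneratorInvertingAut 3 (UGroup (n + 2) e b)) : e = 0 ∧ b = 0 := by
  obtain ⟨σ, -, h⟩ := h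
  rw [invertsCohomology_one_iff] at h
  obtain ⟨i, l, hi, hl, h1, h2, h3, h4⟩ := exists_sign_of_injective hn e b σ.toMonoidHom σ.injective
  have h5 := (h3 1 0).symm.trans (h _ _)
  have h6 := (h4 0 1).symm.trans (h _ _)
  rw [← coord_x hn, chi_coord] at h5
  rw [← coord_y hn, chi_coord] at h6
  obtain rfl : i = -1 := by
    refine hi.resolve_left ?_
    rintro rfl
    revert h5
    simp only [Int.cast_one, Int.cast_zero]
    decide
  obtain rfl : l = -1 := by
    refine hl.resolve_left ?_
    rintro rfl
    revert h6
    simp only [Int.cast_one, Int.cast_zero]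
    decide
  rw [Int.cast_neg, Int.cast_one, heven.neg_one_pow, mul_one] at h1
  rw [Int.cast_neg, Int.cast_one, heven.add_one.neg_one_pow] at h2
  clear h h3 h4 h5 h6 hi hl
  constructor
  · interval_cases e
    · rfl
    · exact absurd h1 (by decide)
  · interval_cases b
    · rfl
    · exact absurd h2 (by decide)
    · exact absurd h2 (by decide)

end UGroup

/-! ### Vanishing of the errors in the relations -/

section errors

variable {M : Type*} [AddCommGroup M] {Z : AddSubgroup M} {x y τ : M →+ M} {t s P Q : M}
  {d : ℕ → M} {n e b : ℕ}

theorem eq_zero_of_two_smul {z : M} (h3 : (3 : ℤ) • z = 0) (h2 : (2 : ℤ) • z = 0) : z = 0 := by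
  linear_combination (norm := module) h3 - h2

/-- Let `Q` and `P` stand for the cubes of lifts of `x` and `y` to a central extension, `d k` for
the lift of `t_{k + 2}`, and `s` for the lift of `s₃`, in an abelian normal subgroup on which the
lifts of `x` and `y` act by `x` and `y`, and let `τ` be induced by an automorphism that inverts the lifts
of `x` and `y`. If the relations hold up to errors in a central subgroup `Z` of exponent `3`
that is fixed by `τ`, then they hold exactly. -/
theorem errors_eq_zero (hn : 3 ≤ n)
    (hx3 : ∀ m, x (x (x m)) = m) (hy3 : ∀ m, y (y (y m)) = m) (hxy : ∀ m, x (y m) = y (x m))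
    (hyP : y P = P) (hxQ : x Q = Q) (hxP : x P = P + y (y t) + y t + t)
    (hyQ : y Q = Q - x (x t) - x t - t)
    (hτx : ∀ m, x (τ (x m)) = τ m) (hτy : ∀ m, y (τ (y m)) = τ m) (hτt : y (x (τ t)) = t)
    (hτP : τ P = -P) (hτQ : τ Q = -Q)
    (hZx : ∀ z ∈ Z, x z = z) (hZy : ∀ z ∈ Z, y z = z) (hZ3 : ∀ z ∈ Z, (3 : ℤ) • z = 0)
    (hZτ : ∀ z ∈ Z, τ z = z)
    (hd0 : d 0 = t) (hd : ∀ k, d (k + 1) = y (d k) - d k) (hs : s = x t - t)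
    (hys : y s - s ∈ Z) (hxs : x s - s ∈ Z) (h3 : d 2 + (3 : ℤ) • d 1 + (3 : ℤ) • t ∈ Z)
    (hlast : d (n + 1) ∈ Z) (hP : P - s - (e : ℤ) • d n ∈ Z)
    (hQ : Q - d 1 - (2 : ℤ) • d 2 - d 3 - (b : ℤ) • d n ∈ Z)
    (hcond : (e = 1 ∧ Odd n) ∨ (e = 0 ∧ b = 0 ∧ Even n)) :
    y s = s ∧ x s = s ∧ (∀ k, x (d (k + 1)) = d (k + 1)) ∧ d 2 + (3 : ℤ) • d 1 + (3 : ℤ) • t = 0 ∧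
      (3 : ℤ) • s = 0 ∧ d (n + 1) = 0 ∧ P = s + (e : ℤ) • d n ∧
      Q = d 1 + (2 : ℤ) • d 2 + d 3 + (b : ℤ) • d n := by
  have hd1 : d 1 = y t - t := by rw [← hd0]; exact hd 0
  have hd2 : d 2 = y (d 1) - d 1 := hd 1
  have hd3 : d 3 = y (d 2) - d 2 := hd 2
  have hxd1 : x (d 1) - d 1 = y s - s := by
    rw [hd1, hs]; simp only [map_sub, hxy]; abel
  have hxd : ∀ k, x (d (k + 2)) = d (k + 2) := by
    have key : ∀ k, x (d (k + 1)) - d (k + 1) = y (x (d k) - d k) - (x (d k) - d k) := by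
      intro k
      rw [hd]; simp only [map_sub, hxy]; abel
    intro k
    induction k with
    | zero =>
      rw [← sub_eq_zero, key 1, hxd1, hZy _ hys, sub_self]
    | succ k ih =>
      rw [← sub_eq_zero, key (k + 2), ih, sub_self, map_zero, sub_zero]
  have hxdn : x (d n) = d n := by
    obtain ⟨m, rfl⟩ := Nat.exists_eq_add_of_le' (show 2 ≤ n by lia)
    exact hxd m
  have hxd2 : x (d 2) = d 2 := hxd 0
  have hxd3 : x (d 3) = d 3 := hxd 1
  -- Conjugation by `x` fixes `x³`; in the relation for `x³` it can only move `t₃`, by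
  -- `x (d 1) - d 1 = y s - s`.
  have k1 : y s - s = 0 := by
    have h := hZx _ hQ
    simp only [map_sub, map_zsmul, hxQ, hxdn, hxd2, hxd3] at h
    linear_combination (norm := module) -hxd1 - h
  have hys' : y s = s := sub_eq_zero.1 k1
  have hxd1' : x (d 1) = d 1 := by rw [← sub_eq_zero, hxd1, k1]
  have hxd' : ∀ k, x (d (k + 1)) = d (k + 1) := by
    intro k
    cases k with
    | zero => exact hxd1'
    | succ k => exact hxd k
  -- Conjugation by `y` fixes `y³`; in the relation for `y³` it can only move `t_c`.
  have k5e : (e : ℤ) • d (n + 1) = 0 := by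
    have h := hZy _ hP
    simp only [map_sub, map_zsmul, hyP, hys'] at h
    rw [hd n]
    linear_combination (norm := module) -h
  -- the value of `τ` on `t_{k + 2}`, up to the invertible operator `x * y ^ (k + 1)`
  have hτd : ∀ k, y^[k + 1] (x (τ (d k))) = (-1 : ℤ) ^ k • d k := by
    intro k
    induction k with
    | zero => rw [hd0]; simpa using hτt
    | succ k ih =>
      have h1 : y (τ (d (k + 1))) = -(y (τ (d k)) - τ (d k)) := by
        rw [hd, map_sub, map_sub, hτy]; abel
      rw [Function.iterate_succ_apply, ← hxy, h1]
      have h2 : y^[k + 1] (y (x (τ (d k))) - x (τ (d k)))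
          = y ((-1 : ℤ) ^ k • d k) - (-1 : ℤ) ^ k • d k := by
        rw [← ih, iterate_map_sub, ← Function.iterate_succ_apply, Function.iterate_succ_apply']
      have h3 : x (-(y (τ (d k)) - τ (d k))) = -(y (x (τ (d k))) - x (τ (d k))) := by
        rw [map_neg, map_sub, hxy]
      rw [h3, iterate_map_neg, h2, hd, map_zsmul, pow_succ]
      module
  have hfix : ∀ {m : M}, y m = m → ∀ k, y^[k] m = m := fun h k =>
    Function.iterate_fixed h k
  have hτfixx : ∀ {m}, x m = m → x (τ m) = τ m := fun {m} h => by
    have := hτx m; rwa [h] at this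
  have hτfixy : ∀ {m}, y m = m → y (τ m) = τ m := fun {m} h => by
    have := hτy m; rwa [h] at this
  -- For `e = 0` and even `n`, the central element `d (n + 1)` is both fixed and inverted by `τ`.
  have k5 : d (n + 1) = 0 := by
    rcases hcond with ⟨rfl, -⟩ | ⟨-, -, hn2⟩
    · simpa using k5e
    · have h := hτd (n + 1)
      rw [hZτ _ hlast, hZx _ hlast, hfix (hZy _ hlast), hn2.add_one.neg_one_pow] at h
      exact eq_zero_of_two_smul (hZ3 _ hlast) (by linear_combination (norm := module) h)
  have hydn : y (d n) = d n := by rw [← sub_eq_zero, ← hd, k5]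
  -- The commutator of `y³` with `x` is `t + y t + y² t`, which is the right-hand side.
  have k23 : x s - s = d 2 + (3 : ℤ) • d 1 + (3 : ℤ) • t := by
    have h := hZx _ hP
    simp only [map_sub, map_zsmul, hxdn, hxP] at h
    rw [hd2, hd1]
    simp only [map_sub]
    linear_combination (norm := module) -h
  -- Since `x³` acts trivially, `0 = x³ t - t = 3 s + 3 (x s - s)`.
  have k4 : (3 : ℤ) • s = 0 := by
    have h1 := hZ3 _ hxs
    have h2 := hZx _ hxs
    have h3 := hx3 t
    rw [hs] at h1 h2 ⊢
    simp only [map_sub] at h1 h2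
    rw [h3] at h2
    linear_combination (norm := module) -h1 - h2
  -- The commutator of `x³` with `y` is `-(t + x t + x² t)`; comparison with the right-hand side of
  -- the relation for `x³` leaves twice the error `x s - s`.
  have k2 : x s - s = 0 := by
    refine eq_zero_of_two_smul (hZ3 _ hxs) ?_
    have h := hZy _ hQ
    have h1 := hZy _ h3
    simp only [map_sub, map_add, map_zsmul, hyQ, hydn] at h h1
    have hxt : x t = t + s := by rw [hs]; abel
    have hyt : y t = t + d 1 := by rw [hd1]; abel
    have hy1 : y (d 1) = d 1 + d 2 := by rw [hd2]; abel
    have hy2 : y (d 2) = d 2 + d 3 := by rw [hd3]; abel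
    rw [hyt, hy1, hy2] at h1
    have h2 : d 3 = -((3 : ℤ) • d 2) - (3 : ℤ) • d 1 := by linear_combination (norm := module) h1
    have hy3' : y (d 3) = -((3 : ℤ) • (d 2 + d 3)) - (3 : ℤ) • (d 1 + d 2) := by
      rw [← hy1, ← hy2]; conv_lhs => rw [h2]
      simp only [map_sub, map_neg, map_zsmul]
    rw [hy1, hy2, hy3', hxt, map_add, hxt] at h
    linear_combination (norm := module) -h - k4 + k23 + (2 : ℤ) • h2
  have hxs' : x s = s := sub_eq_zero.1 k2
  have k3 : d 2 + (3 : ℤ) • d 1 + (3 : ℤ) • t = 0 := by rw [← k23, k2]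
  have hτdn : τ (d n) = (-1 : ℤ) ^ n • d n := by
    have h := hτd n
    rwa [hτfixx hxdn, hfix (hτfixy hydn)] at h
  have hτs : τ s = -s := by
    have h1 : x (τ s) = -(x (τ t) - τ t) := by
      rw [hs, map_sub, map_sub, hτx]; abel
    rw [hτfixx hxs'] at h1
    have h2 : y (τ s) = τ s := hτfixy hys'
    have h3 : x (τ s) = τ s := hτfixx hxs'
    rw [← h2, ← h3, h1, hs, map_neg, map_neg, map_sub, map_sub, ← hxy (x (τ t)), hτt]
  -- The errors in the relations for `y³` and `x³` are fixed by `τ`, while both sides of these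
  -- relations are inverted.
  refine ⟨hys', hxs', hxd', k3, k4, k5, ?_, ?_⟩
  · rw [← sub_eq_zero, ← sub_sub]
    refine eq_zero_of_two_smul (hZ3 _ hP) ?_
    have h := hZτ _ hP
    simp only [map_sub, map_zsmul, hτP, hτs, hτdn] at h
    rcases hcond with ⟨rfl, hn2⟩ | ⟨rfl, -, hn2⟩
    · rw [hn2.neg_one_pow] at h
      linear_combination (norm := module) -h
    · linear_combination (norm := module) -h
  · have hW : τ (d 1 + (2 : ℤ) • d 2 + d 3) = -(d 1 + (2 : ℤ) • d 2 + d 3) := by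
      have hW' : d 1 + (2 : ℤ) • d 2 + d 3 = y (y (d 1)) := by
        rw [hd3, hd2, map_sub]; module
      have h1 := hτd 1
      rw [hτfixx hxd1'] at h1
      have h1' : y (y (τ (d 1))) = -d 1 := by simpa using h1
      have h2 : y (y (τ (y (y (d 1))))) = τ (d 1) := by rw [hτy, hτy]
      calc τ (d 1 + (2 : ℤ) • d 2 + d 3) = y (y (y (y (y (y (τ (y (y (d 1))))))))) := by
            rw [hW', hy3, hy3]
        _ = -(d 1 + (2 : ℤ) • d 2 + d 3) := by rw [h2, h1', map_neg, map_neg, hW']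
    have h := hZτ _ hQ
    have hQ' : Q - d 1 - (2 : ℤ) • d 2 - d 3 - (b : ℤ) • d n
        = Q - (d 1 + (2 : ℤ) • d 2 + d 3) - (b : ℤ) • d n := by abel
    have h0 : Q - d 1 - (2 : ℤ) • d 2 - d 3 - (b : ℤ) • d n = 0 := by
      refine eq_zero_of_two_smul (hZ3 _ hQ) ?_
      rw [hQ'] at h ⊢
      simp only [map_sub, map_zsmul, hτQ, hτdn, hW] at h
      rcases hcond with ⟨rfl, hn2⟩ | ⟨-, rfl, hn2⟩
      · rw [hn2.neg_one_pow] at h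
        linear_combination (norm := module) -h
      · linear_combination (norm := module) -h
    linear_combination (norm := module) h0

end errors

/-! ### Central extensions with an inverting endomorphism -/

open UGroup CycR Model

/-- The homomorphism `π` is a central extension of `G(c; e, b)` with kernel of exponent `3`, and the
endomorphism `τ` covers `σ`, fixes the kernel and inverts the lifts `x` and `y` of the
generators. -/
structure IsInvertingExtension {E : Type*} [Group E] {c e b : ℕ} (π : E →* UGroup c e b)
    (σ : UGroup c e b →* UGroup c e b) (τ : E →* E) (x y : E) : Prop where
  central : ∀ z ∈ π.ker, ∀ g, z * g = g * z
  pow_three : ∀ z ∈ π.ker, z ^ 3 = 1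
  map_ker : ∀ z ∈ π.ker, τ z = z
  map_tau : ∀ g, π (τ g) = σ (π g)
  map_x : π x = X c e b
  map_y : π y = Y c e b
  tau_x : τ x = x⁻¹
  tau_y : τ y = y⁻¹

/-- An element inverted modulo the kernel can be corrected by an element of the kernel, since the
kernel has odd exponent. -/
theorem exists_inverted_lift {E G : Type*} [Group E] [Group G] {π : E →* G} {σ : G →* G}
    {τ : E →* E} (hπ : Function.Surjective π)
    (central : ∀ z ∈ π.ker, ∀ g, z * g = g * z) (pow_three : ∀ z ∈ π.ker, z ^ 3 = 1)
    (map_ker : ∀ z ∈ π.ker, τ z = z) (map_tau : ∀ g, π (τ g) = σ (π g)) {g : G}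
    (hg : σ g = g⁻¹) : ∃ x, π x = g ∧ τ x = x⁻¹ := by
  obtain ⟨a, rfl⟩ := hπ g
  have hz : a * τ a ∈ π.ker := by
    rw [MonoidHom.mem_ker, map_mul, map_tau, hg, mul_inv_cancel]
  have h3 := pow_three _ hz
  have hc := central _ hz
  refine ⟨a * (a * τ a), ?_, ?_⟩
  · rw [map_mul, MonoidHom.mem_ker.1 hz, mul_one]
  · rw [map_mul, map_ker _ hz, eq_comm, inv_eq_iff_mul_eq_one]
    have h1 : a * (a * τ a) * (τ a * (a * τ a)) = a * ((a * τ a) * τ a) * (a * τ a) := by group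
    rw [h1, hc (τ a), ← mul_assoc a, ← pow_two, ← pow_succ, h3]

namespace IsInvertingExtension

variable {E : Type*} [Group E] {n e b : ℕ} {π : E →* UGroup (n + 2) e b}
  {σ : UGroup (n + 2) e b →* UGroup (n + 2) e b} {τ : E →* E} {x y : E}

theorem map_t (hn : 3 ≤ n) (h : IsInvertingExtension π σ τ x y) :
    π (pcComm y x) = coord hn e b ⟨0, 0, 1, 0⟩ := by
  rw [map_pcComm, h.map_x, h.map_y, ← coord_x hn, ← coord_y hn, ← map_pcComm, comm_y_x]

theorem map_s (hn : 3 ≤ n) (h : IsInvertingExtension π σ τ x y) :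
    π (pcComm (pcComm y x) x) = coord hn e b ⟨0, 0, 0, 1⟩ := by
  rw [map_pcComm, h.map_t hn, h.map_x, ← coord_x hn, ← map_pcComm, comm_t_x, map_one]

theorem map_r (hn : 3 ≤ n) (h : IsInvertingExtension π σ τ x y) :
    π (pcComm (pcComm y x) y) = coord hn e b ⟨0, 0, D, 0⟩ := by
  rw [map_pcComm, h.map_t hn, h.map_y, ← coord_y hn, ← map_pcComm, comm_t_y, mul_one]

/-- Elements with the same image differ by an element of the kernel. -/
theorem exists_mul_ker {u v : E} (huv : π u = π v) : ∃ z ∈ π.ker, u = v * z :=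
  ⟨v⁻¹ * u, by rw [MonoidHom.mem_ker, map_mul, map_inv, huv, inv_mul_cancel], by group⟩

/-- The preimage of the derived subgroup is generated by `t₂`, `t₃`, `s₃` and the kernel. -/
theorem comap_commutator_le (hn : 3 ≤ n) (h : IsInvertingExtension π σ τ x y) {K : Subgroup E}
    (hker : π.ker ≤ K) (ht : pcComm y x ∈ K) (hr : pcComm (pcComm y x) y ∈ K)
    (hs : pcComm (pcComm y x) x ∈ K) : (commutator (UGroup (n + 2) e b)).comap π ≤ K := by
  intro g hg
  obtain ⟨⟨i, j, r, s⟩, ⟨rfl, rfl, -⟩, hr'⟩ := commutator_le_map hn e b hg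
  obtain ⟨u, v, rfl⟩ := exists_eq_int r
  have h1 : π g = π (pcComm y x ^ u * pcComm (pcComm y x) y ^ v
      * pcComm (pcComm y x) x ^ s.val) := by
    rw [← hr', map_mul, map_mul, map_zpow, map_zpow, map_pow, h.map_t hn, h.map_s hn, h.map_r hn,
      ← map_zpow, ← map_zpow, ← map_pow, ← map_mul, ← map_mul, mk_zpow, mk_zpow, pow_mk, mk_mul_mk,
      mk_mul_mk]
    simp
  obtain ⟨z, hz, rfl⟩ := exists_mul_ker h1
  exact K.mul_mem (K.mul_mem (K.mul_mem (K.zpow_mem ht u) (K.zpow_mem hr v)) (K.pow_mem hs _))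
    (hker hz)

/-- The composite of `τ` with conjugation by `x * y`. It fixes `t₂ = [y, x]`, since `[y⁻¹, x⁻¹]` is
conjugate to `[y, x]` by `x * y`. -/
def tau' (τ : E →* E) (x y : E) : E →* E := (MulAut.conj (x * y)⁻¹).toMonoidHom.comp τ

theorem tau'_apply (g : E) : tau' τ x y g = (x * y)⁻¹ * τ g * (x * y) := by
  simp [tau', mul_assoc]

theorem tau'_t (h : IsInvertingExtension π σ τ x y) : tau' τ x y (pcComm y x) = pcComm y x := by
  rw [tau'_apply, map_pcComm, h.tau_x, h.tau_y]
  simp [pcComm, mul_assoc]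

theorem tau'_ker (h : IsInvertingExtension π σ τ x y) {z : E} (hz : z ∈ π.ker) :
    tau' τ x y z = z := by
  rw [tau'_apply, h.map_ker z hz, mul_assoc, h.central z hz, inv_mul_cancel_left]

/-- If an endomorphism fixes `a` and inverts `g` modulo the powers of `a` and a central subgroup
containing the commutator of `a` and `g`, whose elements are fixed and have odd order, then `a` and
`g` commute. -/
theorem comm_of_inverted (h : IsInvertingExtension π σ τ x y) {φ : E →* E} {a g : E}
    (hφ : ∀ z ∈ π.ker, φ z = z) (ha : φ a = a) (hag : π (a * g) = π (g * a)) {k : ℤ}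
    (hg : π (φ g) = π (g⁻¹ * a ^ k)) : a * g = g * a := by
  obtain ⟨c, hc, h1⟩ := exists_mul_ker hag
  obtain ⟨z, hz, h2⟩ := exists_mul_ker hg
  have h3 := congrArg φ h1
  rw [map_mul, map_mul, map_mul, ha, h2, hφ c hc, mul_assoc _ a c, ← h.central c hc a] at h3
  have hcc := h.central c hc
  have hzc := h.central z hz
  have h4 : a * g⁻¹ = g⁻¹ * a * c := by
    have e1 : a * (g⁻¹ * a ^ k * z) = (a * g⁻¹) * (a ^ k * z) := by group
    have e2 : g⁻¹ * a ^ k * z * (c * a) = (g⁻¹ * a * c) * (a ^ k * z) := by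
      rw [mul_assoc (g⁻¹ * a ^ k), hzc (c * a), hcc a, mul_assoc (g⁻¹ * a) c, ← mul_assoc c,
        hcc (a ^ k)]
      group
    rw [e1, e2] at h3
    exact mul_right_cancel h3
  have h5 : g⁻¹ * a = a * g⁻¹ * c := by
    rw [mul_assoc, ← hcc, inv_mul_eq_iff_eq_mul, ← mul_assoc, ← mul_assoc, ← h1,
      mul_inv_cancel_right]
  have h6 : c ^ 2 = 1 := by
    rw [h5, mul_assoc _ c, ← pow_two] at h4
    exact mul_eq_left.1 h4.symm
  have h7 : c = 1 := by
    have := h.pow_three c hc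
    rwa [pow_succ, h6, one_mul] at this
  rw [h1, h7, mul_one]

/-- The endomorphism `tau'` fixes `t₂` and maps `t₃` to `t₃⁻¹ * t₂ ^ (-3)` modulo the kernel, so
that `t₂` and `t₃` commute. -/
theorem comm_t_r (hn : 3 ≤ n) (h : IsInvertingExtension π σ τ x y) :
    pcComm y x * pcComm (pcComm y x) y = pcComm (pcComm y x) y * pcComm y x := by
  refine h.comm_of_inverted (φ := tau' τ x y) (fun z => h.tau'_ker) h.tau'_t ?_ (k := -3) ?_
  · rw [map_mul, map_mul, h.map_t hn, h.map_r hn, ← pcComm_eq_one_iff, ← map_pcComm, comm_mk_mk,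
      map_one]
  · have h1 : ∃ r s, π (tau' τ x y y) = coord hn e b ⟨0, -1, r, s⟩ := by
      rw [tau'_apply, h.tau_y]
      simp only [map_mul, map_inv, h.map_x, h.map_y]
      rw [← coord_x hn, ← coord_y hn]
      simp only [← map_mul, ← map_inv, mul_def, inv_def]
      norm_num
      exact ⟨_, _, rfl⟩
    obtain ⟨r, s, h1⟩ := h1
    rw [map_pcComm, h.tau'_t, map_pcComm, h1, h.map_t hn, ← map_pcComm, comm_mk, map_mul, map_inv,
      map_zpow, h.map_t hn, h.map_r hn, ← map_inv, ← map_zpow, ← map_mul, mk_zpow, eq_comm,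
      map_mul, map_inv, inv_mul_eq_iff_eq_mul, ← map_mul, mk_mul_mk, br_neg_one]
    congr 2

/-- The endomorphism `tau'` fixes `t₂` and inverts `s₃` modulo the kernel, so that `t₂` and `s₃`
commute. -/
theorem comm_t_s (hn : 3 ≤ n) (h : IsInvertingExtension π σ τ x y) :
    pcComm y x * pcComm (pcComm y x) x = pcComm (pcComm y x) x * pcComm y x := by
  refine h.comm_of_inverted (φ := tau' τ x y) (fun z => h.tau'_ker) h.tau'_t ?_ (k := 0) ?_
  · rw [map_mul, map_mul, h.map_t hn, h.map_s hn, ← pcComm_eq_one_iff, ← map_pcComm, comm_mk_mk,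
      map_one]
  · have h1 : ∃ r s, π (tau' τ x y x) = coord hn e b ⟨-1, 0, r, s⟩ := by
      rw [tau'_apply, h.tau_x]
      simp only [map_mul, map_inv, h.map_x, h.map_y]
      rw [← coord_x hn, ← coord_y hn]
      simp only [← map_mul, ← map_inv, mul_def, inv_def]
      norm_num
      exact ⟨_, _, rfl⟩
    obtain ⟨r, s, h1⟩ := h1
    rw [map_pcComm, h.tau'_t, map_pcComm, h1, h.map_t hn, ← map_pcComm, comm_mk, zpow_zero,
      mul_one, mul_one, map_inv, h.map_s hn, eq_inv_iff_mul_eq_one, ← map_mul, mk_mul_mk, br_zero,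
      map_one]
    simp only [mul_zero, add_zero, Int.cast_neg, Int.cast_one, mul_one, neg_add_cancel]
    exact map_one _

/-- Conjugation by `x` maps `t₂` to `t₂ * s₃` and fixes `t₃` modulo the kernel, so that `t₃`
commutes with `t₂ * s₃`. -/
theorem comm_r_s (hn : 3 ≤ n) (h : IsInvertingExtension π σ τ x y) :
    pcComm (pcComm y x) y * pcComm (pcComm y x) x
    = pcComm (pcComm y x) x * pcComm (pcComm y x) y := by
  set t := pcComm y x with ht
  set r := pcComm t y with hr
  set s := pcComm t x with hs
  have htx : x⁻¹ * t * x = t * s := by rw [hs, pcComm]; group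
  obtain ⟨z, hz, h1⟩ : ∃ z ∈ π.ker, x⁻¹ * r * x = r * z := by
    refine exists_mul_ker ?_
    rw [map_mul, map_mul, map_inv, h.map_r hn, h.map_x, mul_assoc, inv_mul_eq_iff_eq_mul,
      ← coord_x hn, ← pcComm_eq_one_iff, ← map_pcComm, Model.comm_t_x, eps_D]
    exact map_one _
  have h2 : (t * s) * (r * z) = (r * z) * (t * s) := by
    rw [← htx, ← h1]
    have := h.comm_t_r hn
    calc x⁻¹ * t * x * (x⁻¹ * r * x) = x⁻¹ * (t * r) * x := by group
      _ = x⁻¹ * (r * t) * x := by rw [this]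
      _ = _ := by group
  rw [mul_assoc r, h.central z hz, ← mul_assoc, ← mul_assoc] at h2
  have h3 := mul_right_cancel h2
  rw [mul_assoc t, ← mul_assoc r, ← h.comm_t_r hn, mul_assoc t] at h3
  exact (mul_left_cancel h3).symm

/-- The preimage of the derived subgroup is abelian. -/
theorem comm_of_mem (hn : 3 ≤ n) (h : IsInvertingExtension π σ τ x y) {u v : E}
    (hu : π u ∈ commutator (UGroup (n + 2) e b))
    (hv : π v ∈ commutator (UGroup (n + 2) e b)) : u * v = v * u := by
  have h0 : ∀ g : E, π.ker ≤ Subgroup.centralizer {g} := fun g z hz =>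
    Subgroup.mem_centralizer_singleton_iff.2 (h.central z hz g)
  have key : ∀ g : E, pcComm y x * g = g * pcComm y x →
      pcComm (pcComm y x) y * g = g * pcComm (pcComm y x) y →
      pcComm (pcComm y x) x * g = g * pcComm (pcComm y x) x →
      ∀ w, π w ∈ commutator (UGroup (n + 2) e b) → w * g = g * w := by
    intro g h1 h2 h3 w hw
    exact Subgroup.mem_centralizer_singleton_iff.1 (h.comap_commutator_le hn (h0 g)
      (Subgroup.mem_centralizer_singleton_iff.2 h1) (Subgroup.mem_centralizer_singleton_iff.2 h2)
      (Subgroup.mem_centralizer_singleton_iff.2 h3) hw)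
  refine key v ?_ ?_ ?_ u hu
  · exact (key _ rfl (h.comm_t_r hn).symm (h.comm_t_s hn).symm v hv).symm
  · exact (key _ (h.comm_t_r hn) rfl (h.comm_r_s hn).symm v hv).symm
  · exact (key _ (h.comm_t_s hn) (h.comm_r_s hn) rfl v hv).symm

end IsInvertingExtension

namespace IsInvertingExtension

variable {E : Type*} [Group E] {n e b : ℕ} {π : E →* UGroup (n + 2) e b}
  {σ : UGroup (n + 2) e b →* UGroup (n + 2) e b} {τ : E →* E} {x y : E}

theorem pow_three_mem (hn : 3 ≤ n) (g : UGroup (n + 2) e b) :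
    g ^ 3 ∈ commutator (UGroup (n + 2) e b) := by
  obtain ⟨g, rfl⟩ := coord_surjective hn e b g
  rw [coord_pow_three]
  exact mem_commutator hn e b _ _

theorem pcComm_mem_commutator {G : Type*} [Group G] (g k : G) : pcComm g k ∈ commutator G :=
  pcComm_mem_lowerCentralSeries (k := 0) (Subgroup.mem_top g) k

theorem map_mem_commutator {G : Type*} [Group G] (f : G →* G) {g : G} (hg : g ∈ commutator G) :
    f g ∈ commutator G := by
  have : (commutator G).map f ≤ commutator G := by
    rw [commutator_def, Subgroup.map_commutator]
    exact Subgroup.commutator_mono le_top le_top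
  exact this (Subgroup.mem_map_of_mem f hg)

/-- The relations of `G(c; e, b)` lift to the extension. -/
theorem exists_isUTuple (hn : 3 ≤ n) (h : IsInvertingExtension π σ τ x y)
    (hcond : (e = 1 ∧ Odd n) ∨ (e = 0 ∧ b = 0 ∧ Even n)) :
    ∃ S t, IsUTuple (n + 2) e b x y S t := by
  -- The preimage `B` of the derived subgroup is abelian and is written additively; conjugation and
  -- `τ` act on it by additive endomorphisms.
  let B : Subgroup E := (commutator (UGroup (n + 2) e b)).comap π
  have hcomm : ∀ {u v : E}, u ∈ B → v ∈ B → u * v = v * u := fun hu hv => h.comm_of_mem hn hu hv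
  let _ : CommGroup B :=
    { (inferInstance : Group B) with mul_comm := fun u v => Subtype.ext (hcomm u.2 v.2) }
  have : B.Normal := Subgroup.Normal.comap inferInstance π
  let ι : Additive B → E := fun m => (m.toMul : E)
  have hι : Function.Injective ι := fun u v huv => Subtype.ext huv
  have hιB : ∀ m, ι m ∈ B := fun m => m.toMul.2
  have hadd : ∀ u v, ι (u + v) = ι u * ι v := fun u v => rfl
  have hsub : ∀ u v, ι (u - v) = ι u * (ι v)⁻¹ := fun u v => by rw [sub_eq_add_neg]; rfl
  have hneg : ∀ u, ι (-u) = (ι u)⁻¹ := fun u => rfl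
  have hzero : ι 0 = 1 := rfl
  have hsmul : ∀ (k : ℤ) u, ι (k • u) = ι u ^ k := fun k u => rfl
  let conj : E → Additive B →+ Additive B := fun g =>
    MonoidHom.toAdditive (MulAut.conjNormal (H := B) g⁻¹).toMonoidHom
  have hconj : ∀ g m, ι (conj g m) = g⁻¹ * ι m * g := fun g m => by
    change g⁻¹ * ι m * g⁻¹⁻¹ = _
    rw [inv_inv]
  let τB : Additive B →+ Additive B := MonoidHom.toAdditive ((τ.comp B.subtype).codRestrict B
    (fun g => by
      change π (τ g) ∈ commutator (UGroup (n + 2) e b)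
      rw [h.map_tau]
      exact map_mem_commutator σ g.2))
  have hτ : ∀ m, ι (τB m) = τ (ι m) := fun m => rfl
  let t : Additive B := Additive.ofMul ⟨pcComm y x, by
    change π (pcComm y x) ∈ commutator _; rw [map_pcComm]; exact pcComm_mem_commutator _ _⟩
  have ht : ι t = pcComm y x := rfl
  let P : Additive B := Additive.ofMul ⟨y ^ 3, by
    change π (y ^ 3) ∈ commutator _; rw [map_pow]; exact pow_three_mem hn _⟩
  have hP : ι P = y ^ 3 := rfl
  let Q : Additive B := Additive.ofMul ⟨x ^ 3, by
    change π (x ^ 3) ∈ commutator _; rw [map_pow]; exact pow_three_mem hn _⟩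
  have hQ : ι Q = x ^ 3 := rfl
  -- `d k` is the iterated commutator of `t₂` with `k` factors `y`, which lifts `t_{k + 2}`.
  let d : ℕ → Additive B := fun k => (fun m => conj y m - m)^[k] t
  have hd0 : d 0 = t := rfl
  have hd : ∀ k, d (k + 1) = conj y (d k) - d k := fun k => Function.iterate_succ_apply' _ _ _
  have hpc : ∀ g m, ι (conj g m - m) = pcComm (ι m) g := fun g m => by
    have h1 := hcomm (hιB (conj g m)) (B.inv_mem (hιB m))
    rw [hsub, h1, hconj, pcComm]; group
  let Z : AddSubgroup (Additive B) :=
    { carrier := {m | ι m ∈ π.ker}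
      zero_mem' := π.ker.one_mem
      add_mem' := fun hu hv => π.ker.mul_mem hu hv
      neg_mem' := fun hu => π.ker.inv_mem hu }
  have hπt : π (ι t) = coord hn e b ⟨0, 0, 1, 0⟩ := h.map_t hn
  have hπd : ∀ k, π (ι (d k)) = coord hn e b ⟨0, 0, D ^ k, 0⟩ := by
    intro k
    induction k with
    | zero => rw [hd0, hπt, pow_zero]
    | succ k ih =>
      rw [hd, hpc, map_pcComm, ih, h.map_y, ← coord_y hn, ← map_pcComm, Model.comm_t_y, pow_succ']
  let s : Additive B := conj x t - t
  have hπs : π (ι s) = coord hn e b ⟨0, 0, 0, 1⟩ := by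
    rw [hpc]; exact h.map_s hn
  have hπt' : ∀ k, π (ι (d k)) = UGroup.t (n + 2) e b (k + 2) := fun k => by
    rw [hπd, ← coord_t hn e b (by lia), Nat.add_sub_cancel]
  have hPπ : π (ι P) = π (ι (s + (e : ℤ) • d n)) := by
    rw [hP, map_pow, h.map_y, (isUTuple (show 5 ≤ n + 2 by lia)).y_pow, hadd, hsmul, map_mul,
      zpow_natCast, map_pow, hπs, hπt', coord_s]
  have hQπ : π (ι Q) = π (ι (d 1 + ((2 : ℤ) • d 2 + (d 3 + (b : ℤ) • d n)))) := by
    rw [hQ, map_pow, h.map_x, (isUTuple (show 5 ≤ n + 2 by lia)).x_pow, hadd, hadd, hadd, hsmul,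
      hsmul, map_mul, map_mul, map_mul, zpow_natCast, map_pow, map_zpow, hπt', hπt', hπt', hπt',
      mul_assoc, mul_assoc]
    rfl
  obtain ⟨hys, hxs, hxd, h3, hs3, hlast, hPeq, hQeq⟩ := errors_eq_zero (Z := Z) (x := conj x)
    (y := conj y) (τ := τB) (t := t) (s := s) (P := P) (Q := Q) (d := d) (n := n) (e := e) (b := b)
    hn
    (by
      intro m
      apply hι
      simp only [hconj]
      have := hcomm (hιB m) (hιB Q)
      rw [hQ] at this
      calc _ = (x ^ 3)⁻¹ * (ι m * x ^ 3) := by simp [pow_succ, mul_assoc]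
        _ = _ := by rw [this, inv_mul_cancel_left])
    (by
      intro m
      apply hι
      simp only [hconj]
      have := hcomm (hιB m) (hιB P)
      rw [hP] at this
      calc _ = (y ^ 3)⁻¹ * (ι m * y ^ 3) := by simp [pow_succ, mul_assoc]
        _ = _ := by rw [this, inv_mul_cancel_left])
    (by
      intro m
      apply hι
      simp only [hconj]
      have := hcomm (hιB (conj y (conj x m))) (hιB t)
      simp only [hconj, ht] at this
      calc x⁻¹ * (y⁻¹ * ι m * y) * x
          = (pcComm y x)⁻¹ * (y⁻¹ * (x⁻¹ * ι m * x) * y * pcComm y x) := by rw [pcComm]; group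
        _ = _ := by rw [this, inv_mul_cancel_left])
    (by apply hι; rw [hconj, hP]; group)
    (by apply hι; rw [hconj, hQ]; group)
    (by apply hι; simp only [hadd, hconj, hP, ht, pcComm]; simp [pow_succ, mul_assoc])
    (by apply hι; simp only [hsub, hconj, hQ, ht, pcComm]; simp [pow_succ, mul_assoc])
    (by intro m; apply hι; simp only [hconj, hτ, map_mul, map_inv, h.tau_x]; group)
    (by intro m; apply hι; simp only [hconj, hτ, map_mul, map_inv, h.tau_y]; group)
    (by apply hι; simp only [hconj, hτ, ht, pcComm, map_mul, map_inv, h.tau_x, h.tau_y]; group)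
    (by apply hι; rw [hτ, hneg, hP, map_pow, h.tau_y]; group)
    (by apply hι; rw [hτ, hneg, hQ, map_pow, h.tau_x]; group)
    (by intro z hz; apply hι; rw [hconj, mul_assoc, h.central _ hz, inv_mul_cancel_left])
    (by intro z hz; apply hι; rw [hconj, mul_assoc, h.central _ hz, inv_mul_cancel_left])
    (by intro z hz; apply hι; rw [hsmul]; exact_mod_cast h.pow_three _ hz)
    (by intro z hz; apply hι; rw [hτ, h.map_ker _ hz])
    hd0 hd rfl
    (by
      change π (ι _) = 1
      rw [hpc, map_pcComm, hπs, h.map_y, ← coord_y hn, ← map_pcComm, Model.comm_t_y, mul_zero]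
      exact map_one _)
    (by
      change π (ι _) = 1
      rw [hpc, map_pcComm, hπs, h.map_x, ← coord_x hn, ← map_pcComm, Model.comm_t_x, map_zero]
      exact map_one _)
    (by
      change π (ι _) = 1
      rw [hadd, hadd, hsmul, hsmul, map_mul, map_mul, map_zpow, map_zpow, hπd, hπd, hπt, ← map_zpow,
        ← map_zpow, ← map_mul, ← map_mul, mk_zpow, mk_zpow, mk_mul_mk, mk_mul_mk,
        coord_mk_eq_one_iff]
      constructor
      · rw [D_sq]; push_cast; ring
      · simp)
    (by
      change π (ι _) = 1
      rw [hπd, D_pow_eq_zero (Nat.lt_succ_self n)]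
      exact map_one _)
    (by
      change π (ι _) = 1
      rw [sub_sub, hsub, map_mul, map_inv, hPπ, mul_inv_cancel])
    (by
      change π (ι _) = 1
      rw [sub_sub, sub_sub, sub_sub, hsub, map_mul, map_inv, hQπ, mul_inv_cancel])
    hcond
  -- The relation `y² + y + 1 = 0`, which holds on `t₂`, propagates along the `d k` and yields the
  -- power relations.
  have hd3 : ∀ k, d (k + 2) + (3 : ℤ) • d (k + 1) + (3 : ℤ) • d k = 0 := by
    intro k
    induction k with
    | zero => exact h3
    | succ k ih =>
      have := congrArg (fun m => conj y m - m) ih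
      simp only [map_add, map_zsmul, map_zero] at this
      rw [hd (k + 2), hd (k + 1), hd k]
      rw [hd (k + 1), hd k] at this
      linear_combination (norm := module) this
  have hdgt : ∀ k, d (n + 1 + k) = 0 := by
    intro k
    induction k with
    | zero => exact hlast
    | succ k ih => rw [← add_assoc, hd, ih, map_zero, sub_zero]
  have hfix : ∀ {g m}, conj g m = m → ι m * g = g * ι m := by
    intro g m hm
    have h1 := congrArg ι hm
    rw [hconj, mul_assoc, inv_mul_eq_iff_eq_mul] at h1
    exact h1
  refine ⟨ι s, fun j => ι (d (j - 2)), rfl, hpc x t, ?_, ?_, ?_, ?_, ?_, ?_, ?_, hfix hxs, hfix hys,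
    fun j _ => hcomm (hιB _) (hιB _), fun i j _ _ => hcomm (hιB _) (hιB _)⟩
  · intro j hj
    obtain ⟨k, rfl⟩ := Nat.exists_eq_add_of_le' hj
    change ι (d (k + 1)) = _
    rw [hd, hpc]; rfl
  · intro j hj
    obtain ⟨k, rfl⟩ := Nat.exists_eq_add_of_le (show n + 3 ≤ j from hj)
    rw [show n + 3 + k - 2 = n + 1 + k by lia, hdgt, hzero]
  · intro j hj
    obtain ⟨k, rfl⟩ := Nat.exists_eq_add_of_le' hj
    change ι (d k) ^ 3 = ι (d (k + 2)) ^ 2 * ι (d (k + 3))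
    have h1 : (3 : ℤ) • d k = (2 : ℤ) • d (k + 2) + d (k + 3) := by
      linear_combination (norm := module) hd3 k - hd3 (k + 1)
    have h2 := congrArg ι h1
    rw [hadd, hsmul, hsmul] at h2
    exact_mod_cast h2
  · have h2 := congrArg ι hs3
    rw [hsmul] at h2
    exact_mod_cast h2
  · have h2 := congrArg ι hPeq
    rw [hadd, hsmul, hP, zpow_natCast] at h2
    exact h2
  · have h2 := congrArg ι hQeq
    rw [hadd, hadd, hadd, hsmul, hsmul, hQ, zpow_natCast] at h2
    exact_mod_cast h2
  · intro j hj
    obtain ⟨k, rfl⟩ := Nat.exists_eq_add_of_le' hj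
    exact hfix (hxd k)

end IsInvertingExtension

/-! ### The action on the second cohomology group -/

/-- The extension of `G` by `ℤ/p` defined by a `2`-cocycle `f`, which need not be normalized. -/
@[ext]
structure CocycleExtension {p : ℕ} {G : Type*} [Group G] (f : G × G → ZMod p)
    (hf : ∀ g h j, f (g * h, j) + f (g, h) = f (h, j) + f (g, h * j)) where
  /-- The projection onto `G`. -/
  fst : G
  /-- The component in `ℤ/p`. -/
  snd : ZMod p

namespace CocycleExtension

variable {p : ℕ} {G : Type*} [Group G] {f : G × G → ZMod p}
  {hf : ∀ g h j, f (g * h, j) + f (g, h) = f (h, j) + f (g, h * j)}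

instance : Mul (CocycleExtension f hf) :=
  ⟨fun a b => ⟨a.fst * b.fst, a.snd + b.snd + f (a.fst, b.fst)⟩⟩

instance : One (CocycleExtension f hf) := ⟨⟨1, -f (1, 1)⟩⟩

instance : Inv (CocycleExtension f hf) :=
  ⟨fun a => ⟨a.fst⁻¹, -a.snd - f (a.fst⁻¹, a.fst) - f (1, 1)⟩⟩

theorem mul_def (a b : CocycleExtension f hf) :
    a * b = ⟨a.fst * b.fst, a.snd + b.snd + f (a.fst, b.fst)⟩ := rfl

theorem one_def : (1 : CocycleExtension f hf) = ⟨1, -f (1, 1)⟩ := rfl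

theorem inv_def (a : CocycleExtension f hf) :
    a⁻¹ = ⟨a.fst⁻¹, -a.snd - f (a.fst⁻¹, a.fst) - f (1, 1)⟩ := rfl

theorem map_one_left (hf : ∀ g h j, f (g * h, j) + f (g, h) = f (h, j) + f (g, h * j)) (g : G) :
    f (1, g) = f (1, 1) := by
  have := hf 1 1 g
  rw [one_mul, one_mul] at this
  exact (add_left_cancel this).symm

theorem map_one_right (hf : ∀ g h j, f (g * h, j) + f (g, h) = f (h, j) + f (g, h * j)) (g : G) :
    f (g, 1) = f (1, 1) := by
  have := hf g 1 1
  rw [mul_one, mul_one] at this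
  exact add_right_cancel this

instance : Group (CocycleExtension f hf) :=
  Group.ofLeftAxioms
    (by
      intro a b c
      ext
      · exact mul_assoc _ _ _
      · simp only [mul_def]
        linear_combination hf a.fst b.fst c.fst)
    (by
      intro a
      ext
      · exact one_mul _
      · simp only [mul_def, one_def, map_one_left hf a.fst]
        ring)
    (by
      intro a
      ext
      · exact inv_mul_cancel _
      · simp only [mul_def, one_def, inv_def]
        ring)

/-- The projection onto `G`. -/
def proj (f : G × G → ZMod p)
    (hf : ∀ g h j, f (g * h, j) + f (g, h) = f (h, j) + f (g, h * j)) :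
    CocycleExtension f hf →* G where
  toFun := fst
  map_one' := rfl
  map_mul' _ _ := rfl

/-- The endomorphism induced by an endomorphism of `G` that fixes the cocycle. -/
def map (σ : G →* G) (hσ : ∀ g h, f (σ g, σ h) = f (g, h)) :
    CocycleExtension f hf →* CocycleExtension f hf where
  toFun a := ⟨σ a.fst, a.snd⟩
  map_one' := by rw [one_def, map_one]
  map_mul' a b := by rw [mul_def, mul_def, map_mul, hσ]

theorem mk_one_pow (a : ZMod p) (k : ℕ) : (⟨1, a⟩ : CocycleExtension f hf) ^ k
    = ⟨1, k * (a + f (1, 1)) - f (1, 1)⟩ := by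
  induction k with
  | zero => rw [pow_zero, one_def]; congr 1; push_cast; ring
  | succ k ih => rw [pow_succ, ih, mul_def, one_mul]; congr 1; push_cast; ring

theorem mk_one_mul (a : ZMod p) (g : CocycleExtension f hf) : ⟨1, a⟩ * g = g * ⟨1, a⟩ := by
  simp only [mul_def, one_mul, mul_one, map_one_left hf g.fst, map_one_right hf g.fst, add_comm a]

end CocycleExtension

/-- For a cocycle `f`, the sum of `f` and its image under `σ` is a `σ`-invariant cocycle. The
central extension that it defines has an endomorphism covering `σ`, so it splits. -/
theorem UGroup.invertsCohomology_two_of_inverting {n e b : ℕ} (hn : 3 ≤ n)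
    {σ : MulAut (UGroup (n + 2) e b)} (hX : σ (X _ _ _) = (X _ _ _)⁻¹)
    (hY : σ (Y _ _ _) = (Y _ _ _)⁻¹) (hcond : (e = 1 ∧ Odd n) ∨ (e = 0 ∧ b = 0 ∧ Even n)) :
    InvertsCohomology 3 σ 2 := by
  refine invertsCohomology_two σ fun f hf => ?_
  let F : UGroup (n + 2) e b × UGroup (n + 2) e b → ZMod 3 := fun a => f (σ a.1, σ a.2) + f a
  have hF : ∀ g h j, F (g * h, j) + F (g, h) = F (h, j) + F (g, h * j) := by
    intro g h j
    simp only [F, map_mul]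
    linear_combination hf g h j + hf (σ g) (σ h) (σ j)
  have hσσ : ∀ g, σ (σ g) = g := fun g => by
    have h := pow_orderOf_eq_one σ
    rw [orderOf_inverting hn hX hY, pow_two] at h
    exact DFunLike.congr_fun h g
  have hσF : ∀ g h, F (σ.toMonoidHom g, σ.toMonoidHom h) = F (g, h) := by
    intro g h
    change f (σ (σ g), σ (σ h)) + f (σ g, σ h) = f (σ g, σ h) + f (g, h)
    rw [hσσ, hσσ, add_comm]
  have hker : ∀ z ∈ (CocycleExtension.proj F hF).ker, z = ⟨1, z.snd⟩ := by
    intro z hz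
    ext
    · exact hz
    · rfl
  have hsurj : Function.Surjective (CocycleExtension.proj F hF) := fun g => ⟨⟨g, 0⟩, rfl⟩
  have hcentral : ∀ z ∈ (CocycleExtension.proj F hF).ker, ∀ g, z * g = g * z := by
    intro z hz g
    rw [hker z hz, CocycleExtension.mk_one_mul]
  have hpow : ∀ z ∈ (CocycleExtension.proj F hF).ker, z ^ 3 = 1 := by
    intro z hz
    rw [hker z hz, CocycleExtension.mk_one_pow, CocycleExtension.one_def]
    congr 1
    have h3 : ((3 : ℕ) : ZMod 3) = 0 := rfl
    rw [h3, zero_mul, zero_sub]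
  have hfix : ∀ z ∈ (CocycleExtension.proj F hF).ker,
      CocycleExtension.map σ.toMonoidHom hσF z = z := by
    intro z hz
    rw [hker z hz]
    ext
    · exact map_one σ
    · rfl
  have hcover : ∀ g, CocycleExtension.proj F hF (CocycleExtension.map σ.toMonoidHom hσF g)
      = σ.toMonoidHom (CocycleExtension.proj F hF g) := fun g => rfl
  obtain ⟨x, hx, hx'⟩ :=
    exists_inverted_lift (σ := σ.toMonoidHom) hsurj hcentral hpow hfix hcover hX
  obtain ⟨y, hy, hy'⟩ :=
    exists_inverted_lift (σ := σ.toMonoidHom) hsurj hcentral hpow hfix hcover hY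
  have hext : IsInvertingExtension (CocycleExtension.proj F hF) σ.toMonoidHom
      (CocycleExtension.map σ.toMonoidHom hσF) x y :=
    ⟨hcentral, hpow, hfix, hcover, hx, hy, hx', hy'⟩
  obtain ⟨S, t, htup⟩ := hext.exists_isUTuple hn hcond
  let s := lift (show 5 ≤ n + 2 by lia) htup
  have hs : (CocycleExtension.proj F hF).comp s = MonoidHom.id _ := by
    refine hom_ext (by lia) ?_ ?_
    · change CocycleExtension.proj F hF (s (X _ _ _)) = X _ _ _
      rw [lift_X, hx]
    · change CocycleExtension.proj F hF (s (Y _ _ _)) = Y _ _ _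
      rw [lift_Y, hy]
  have hfst : ∀ g, (s g).fst = g := fun g => DFunLike.congr_fun hs g
  refine ⟨fun g => -(s g).snd, fun g h => ?_⟩
  have h1 := congrArg CocycleExtension.snd (map_mul s g h)
  rw [CocycleExtension.mul_def] at h1
  dsimp only at h1
  rw [hfst, hfst] at h1
  change F (g, h) = _
  linear_combination -h1

theorem UGroup.hasRelatorInvertingAut {n e b : ℕ} (hn : 3 ≤ n)
    (hcond : (e = 1 ∧ Odd n) ∨ (e = 0 ∧ b = 0 ∧ Even n)) :
    HasRelatorInvertingAut 3 (UGroup (n + 2) e b) := by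
  obtain ⟨σ, hX, hY⟩ := exists_inverting_aut hn (e := e) (b := b)
    (hcond.imp (fun h => h.2) (fun h => ⟨h.1, h.2.1⟩))
  exact ⟨σ, orderOf_inverting hn hX hY, invertsCohomology_one_of_inverting hn hX hY,
    invertsCohomology_two_of_inverting hn hX hY hcond⟩

/-! ### The groups `G(c; e, b)` of class at least five -/

theorem mainTheorem8 (c : ℕ) (hc : 5 ≤ c) :
    -- the six groups
    (∀ e < 2, ∀ b < 3,
      Nat.card (UGroup c e b) = 3 ^ (c + 2) ∧
      Group.IsNilpotent (UGroup c e b) ∧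
      Group.nilpotencyClass (UGroup c e b) = c ∧
      HasCoclass 3 (UGroup c e b) 2 ∧
      IsMetabelianGroup (UGroup c e b) ∧
      Subgroup.closure {UGroup.img c e b (UGen.wx c), UGroup.img c e b (UGen.wy c)} = ⊤ ∧
      UGroup.img c e b (UGen.ws₃ c) ∈ commutator (UGroup c e b) ∧
      (∀ j, 2 ≤ j → j ≤ c → UGroup.img c e b (UGen.wt c j) ∈ commutator (UGroup c e b)) ∧
      IsDescendant 3 (UGroup c e b) SmallGroup243_8 ∧
      Nonempty (UGroup c e b ⧸ Subgroup.lowerCentralSeries (⊤ : Subgroup (UGroup c e b)) 3 ≃*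
        SmallGroup243_8)) ∧
    -- the transfer kernel types
    HasTKT (UGroup c 0 0) tktC21 ∧
    HasTKT (UGroup c 0 1) tktG16 ∧
    HasTKT (UGroup c 0 2) tktG16 ∧
    HasTKT (UGroup c 1 0) tktE8 ∧
    HasTKT (UGroup c 1 1) tktE9 ∧
    HasTKT (UGroup c 1 2) tktE9 ∧
    -- the groups of type c.21 form the mainline
    Nonempty (UGroup (c + 1) 0 0 ⧸
        Subgroup.lowerCentralSeries (⊤ : Subgroup (UGroup (c + 1) 0 0)) c ≃* UGroup c 0 0) ∧
    -- odd class
    (Odd c →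
      (∀ e < 2, ∀ b < 3, ∀ e' < 2, ∀ b' < 3,
        Nonempty (UGroup c e b ≃* UGroup c e' b') → e = e' ∧ b = b') ∧
      (∀ e < 2, ∀ b < 3, HasGeneratorInvertingAut 3 (UGroup c e b)) ∧
      (∀ b < 3, HasRelatorInvertingAut 3 (UGroup c 1 b))) ∧
    -- even class
    (Even c →
      (∀ e < 2, Nonempty (UGroup c e 1 ≃* UGroup c e 2)) ∧
      (∀ e < 2, ∀ b < 2, ∀ e' < 2, ∀ b' < 2,
        Nonempty (UGroup c e b ≃* UGroup c e' b') → e = e' ∧ b = b') ∧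
      HasRelatorInvertingAut 3 (UGroup c 0 0) ∧
      (∀ e < 2, ∀ b < 3, HasGeneratorInvertingAut 3 (UGroup c e b) → e = 0 ∧ b = 0)) := by
  obtain ⟨n, rfl⟩ := Nat.exists_eq_add_of_le' (show 2 ≤ c by lia)
  have hn : 3 ≤ n := by lia
  refine ⟨fun e _ b _ => ?_, UGroup.hasTKT_c21 hn, UGroup.hasTKT_g16 hn (by decide),
    UGroup.hasTKT_g16 hn (by decide), UGroup.hasTKT_e8 hn,
    UGroup.hasTKT_e9 hn (δ := -1) (Or.inr rfl) (by decide),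
    UGroup.hasTKT_e9 hn (δ := 1) (Or.inl rfl) (by decide), UGroup.mainline_quotient hn, ?_, ?_⟩
  · have htup := UGroup.isUTuple (c := n + 2) (e := e) (b := b) hc
    refine ⟨UGroup.card_eq hn e b, UGroup.isNilpotent hn e b, UGroup.nilpotencyClass_eq hn e b,
      ⟨UGroup.isNilpotent hn e b, ?_⟩, UGroup.isMetabelian hn e b, UGroup.closure_gens_eq_top hc,
      ?_, ?_, UGroup.isDescendant hn e b, UGroup.quotient_lowerCentralSeries hn e b⟩
    · rw [UGroup.card_eq hn e b, UGroup.nilpotencyClass_eq hn e b]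
    · exact Subgroup.lowerCentralSeries_antitone _ one_le_two htup.s_mem_lowerCentralSeries
    · intro j hj _
      obtain ⟨k, rfl⟩ := Nat.exists_eq_add_of_le' hj
      exact Subgroup.lowerCentralSeries_antitone _ (show 1 ≤ k + 1 by lia)
        (htup.t_mem_lowerCentralSeries k)
  · intro hodd
    have hodd' : Odd n := by simpa [Nat.odd_add] using hodd
    exact ⟨fun e he b hb e' he' b' hb' h => UGroup.eq_of_equiv_of_odd hn hodd' he hb he' hb' h,
      fun e _ b _ => UGroup.hasGeneratorInvertingAut_of_odd hn hodd' e b,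
      fun b _ => UGroup.hasRelatorInvertingAut hn (Or.inl ⟨rfl, hodd'⟩)⟩
  · intro heven
    have heven' : Even n := by simpa [Nat.even_add] using heven
    exact ⟨fun e _ => UGroup.nonempty_equiv_of_even hn heven' e,
      fun e he b hb e' he' b' hb' h => UGroup.eq_of_equiv_of_lt_two hn he hb he' hb' h,
      UGroup.hasRelatorInvertingAut hn (Or.inr ⟨rfl, rfl, heven'⟩),
      fun e he b hb h => UGroup.eq_zero_of_hasGeneratorInvertingAut hn heven' he hb h⟩
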